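/- Let $C$ (pre-treatment covariates), $A$ (treatment), $Z$ (mediator) and $Y$ (real-valued outcome) be discrete random variables with sets of values $\mathcal C,\mathcal A,\mathcal Z,\mathcal Y$, let $Z(a)$ and $Y(a,z)$ be the potential mediators and outcomes, and put $Y(a)=Y(a,Z(a))$. Assume consistency (almost surely: $Y=Y(a)$ and $Z=Z(a)$ if $A=a$; $Y=Y(a,z)$ if $A=a$, $Z=z$) and positivity ($P(Y(a)=y,A=a',Z=z,C=c)>0$ for all $a,a'\in\mathcal A$, $y\in\mathcal Y$, $z\in\mathcal Z$, $c\in\mathcal C$). Assume moreover, for all $a,a'\in\mathcal A$, $z\in\mathcal Z$, * (FD) $Y(a,z)=Y(a',z)$ almost surely, $Z(a')\perp A$, and $Y(a,z)\perp Z(a')\mid A$; * (TD) $Y(a,z)=Y(a',z)$ almost surely, $Z(a')\perp A\mid C$, and $Y(a,z)\perp Z(a')\mid A,C$; * $Z(a)\perp C\mid A$. Let $a^*\ne a$ be two treatment levels with $E\,Y(a^*)^2<\infty$, $E\,Y(a)^2<\infty$, and let $\theta=E\,Y(a^*)-E\,Y(a)$. Write $p$ for (conditional) probability mass functions. Let $$\begin{aligned}\varphi_{fd,td}={}&\bigl(Y-E(Y|A,Z,C)\bigr)\frac{p(Z|a^*)-p(Z|a)}{p(Z|A)}\\&+\sum_c\Bigl(\sum_{\bar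 a}E(Y|\bar a,Z,c)p(\bar a|c)-\sum_{\bar a,z}E(Y|\bar a,z,c)p(z|A)p(\bar a|c)\Bigr)\frac{(I(A=a^*)-I(A=a))\,p(c)}{p(A)}\\&+\sum_zE(Y|A,z,C)\bigl(p(z|a^*)-p(z|a)\bigr)-\theta\end{aligned}$$ and assume $E\varphi_{fd,td}^2<\infty$. Consider the semiparametric model of all observed-data distributions arising from variables that satisfy the assumptions above. Its regular parametric submodels are the families $(Q_t)$ of such systems of variables, with $t$ near $0$ in some $\mathbb R^k$ and the true observed-data distribution at $t=0$, for which the law of $(C,A,Z,Y)$ is differentiable in quadratic mean at $t=0$ with score $S$, the laws of $(C,A,Z(b),Y(b))$, $b\in\{a^*,a\}$, are differentiable in quadratic mean at $t=0$ as well, and $E_tY(b)^2$ is bounded near $t=0$ (for finite value sets the last two requirements follow from the others). An influence function for $\theta$ is a square integrable function $\varphi$ of $(C,A,Z,Y)$ such that along every such submodel $\theta$ is differentiable at $t=0$ with gradient $E(\varphi S)$; the tangent space is the mean square closure of the linear combinations of components of scores; the efficient influence function is the influence function that is the projection of every influence function onto the tangent space; the semiparametric efficiency bound is the supremum of the Cramér–Rao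 bounds for $\theta$ over the regular parametric submodels with nonsingular information matrix. Then: 1. $p(c,a,z,y)=p(y|a,z,c)\,p(z|a)\,p(a|c)\,p(c)$ for all $c,a,z,y$. 2. $\varphi_{fd,td}$ is the efficient influence function for $\theta$. 3. Let $$\begin{aligned}\varphi_{td}={}&\bigl(Y-E(Y|A,Z,C)\bigr)\frac{p(Z|a^*,C)-p(Z|a,C)}{p(Z|A,C)}\\&+\Bigl(\sum_{\bar a}E(Y|\bar a,Z,C)p(\bar a|C)-\sum_{\bar a,z}E(Y|\bar a,z,C)p(z|A,C)p(\bar a|C)\Bigr)\frac{I(A=a^*)-I(A=a)}{p(A|C)}\\&+\sum_zE(Y|A,z,C)\bigl(p(z|a^*,C)-p(z|a,C)\bigr)-\theta.\end{aligned}$$ If $E\varphi_{td}^2<\infty$, then $\varphi_{td}$ is an influence function for $\theta$ and $\varphi_{fd,td}$ is its projection onto the tangent space. 4. The semiparametric efficiency bound for $\theta$ is equal to $$\begin{aligned}\operatorname{var}\varphi_{fd,td}={}&\sum_z\bigl(p(z|a^*)-p(z|a)\bigr)^2\sum_{\bar a,c}\frac{p(\bar a,c)}{p(z|\bar a)}\operatorname{var}(Y|\bar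 a,z,c)\\&+\sum_{b\in\{a^*,a\}}\Bigl[\sum_z\frac{p(z|b)}{p(b)}\Bigl(\sum_{\bar a,c}E(Y|\bar a,z,c)p(\bar a|c)p(c)\Bigr)^2-\frac{\bigl(\sum_{\bar a,z,c}E(Y|\bar a,z,c)p(z|b)p(\bar a|c)p(c)\bigr)^2}{p(b)}\Bigr]\\&+\sum_{\bar a,c}p(\bar a,c)\Bigl(\sum_zE(Y|\bar a,z,c)\bigl(p(z|a^*)-p(z|a)\bigr)\Bigr)^2-\theta^2.\end{aligned}$$ -/

import Mathlib

open MeasureTheory ProbabilityTheory Filter Topology Asymptotics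
open scoped Matrix RealInnerProductSpace

universe u

noncomputable section

/-- `X` and `W` are conditionally independent given the discrete variable `V`: they are independent
under the conditional distribution given `V = v`, for each value `v` (for an event of probability
zero, the conditional measure is `0` and nothing is required). -/
def DiscreteCondIndep {Ω α β γ : Type*} [MeasurableSpace Ω] [MeasurableSpace α]
    [MeasurableSpace β] (X : Ω → α) (W : Ω → β) (V : Ω → γ) (μ : Measure Ω) : Prop :=
  ∀ v : γ, IndepFun X W (μ[|V ⁻¹' {v}])

/-- A system of observed and potential variables on a probability space: covariates `C`, treatment
`A`, observed mediator `Z`, observed outcome `Y`, potential mediators `Z(a)`, and potential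
outcomes `Y(a, z)`; the outcomes take values in the set `𝒴` of real numbers. -/
structure CausalModel (𝒞 𝒜 𝒵 : Type u) (𝒴 : Set ℝ) [MeasurableSpace 𝒞] [MeasurableSpace 𝒜]
    [MeasurableSpace 𝒵] where
  /-- the sample space -/
  Ω : Type u
  /-- its events -/
  [mΩ : MeasurableSpace Ω]
  /-- the probability distribution -/
  μ : Measure Ω
  [prob : IsProbabilityMeasure μ]
  /-- pre-treatment covariates -/
  C : Ω → 𝒞
  /-- treatment -/
  A : Ω → 𝒜
  /-- observed mediator -/
  Z : Ω → 𝒵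
  /-- observed outcome -/
  Y : Ω → 𝒴
  /-- `Zpot a` is the mediator `Z(a)` under treatment `a` -/
  Zpot : 𝒜 → Ω → 𝒵
  /-- `Ypot a z` is the outcome `Y(a, z)` under treatment `a` and mediator value `z` -/
  Ypot : 𝒜 → 𝒵 → Ω → 𝒴
  measurable_C : Measurable C
  measurable_A : Measurable A
  measurable_Z : Measurable Z
  measurable_Y : Measurable Y
  measurable_Zpot : ∀ a, Measurable (Zpot a)
  measurable_Ypot : ∀ a z, Measurable (Ypot a z)

namespace CausalModel

attribute [instance] CausalModel.mΩ CausalModel.prob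

variable {𝒞 𝒜 𝒵 : Type u} {𝒴 : Set ℝ} [MeasurableSpace 𝒞] [MeasurableSpace 𝒜] [MeasurableSpace 𝒵]

section assumptions

variable (M : CausalModel 𝒞 𝒜 𝒵 𝒴)

/-- The potential outcome `Y(a) = Y(a, Z(a))` under treatment `a`. -/
def Yout (a : 𝒜) (ω : M.Ω) : 𝒴 := M.Ypot a (M.Zpot a ω) ω

/-- The average causal effect `θ = E Y(a₁) - E Y(a₀)`. -/
def ACE (a₁ a₀ : 𝒜) : ℝ := (∫ ω, (M.Yout a₁ ω : ℝ) ∂M.μ) - ∫ ω, (M.Yout a₀ ω : ℝ) ∂M.μ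

/-- Consistency of observed and potential variables. -/
structure Consistency : Prop where
  outcome : ∀ a, ∀ᵐ ω ∂M.μ, M.A ω = a → M.Y ω = M.Yout a ω
  mediator : ∀ a, ∀ᵐ ω ∂M.μ, M.A ω = a → M.Z ω = M.Zpot a ω
  joint : ∀ a z, ∀ᵐ ω ∂M.μ, M.A ω = a → M.Z ω = z → M.Y ω = M.Ypot a z ω

/-- Positivity: `p(Y(a), A, Z, C) > 0` for each treatment `a`, at all values of the variables. -/
def Positivity : Prop :=
  ∀ (a : 𝒜) (y : 𝒴) (a' : 𝒜) (z : 𝒵) (c : 𝒞),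
    0 < M.μ {ω | M.Yout a ω = y ∧ M.A ω = a' ∧ M.Z ω = z ∧ M.C ω = c}

/-- The front-door assumption. -/
structure FrontDoor : Prop where
  no_direct_effect : ∀ a a' z, M.Ypot a z =ᵐ[M.μ] M.Ypot a' z
  mediator_indep : ∀ a', IndepFun (M.Zpot a') M.A M.μ
  outcome_indep : ∀ a a' z, DiscreteCondIndep (M.Ypot a z) (M.Zpot a') M.A M.μ

/-- The two-door assumption. -/
structure TwoDoor : Prop where
  no_direct_effect : ∀ a a' z, M.Ypot a z =ᵐ[M.μ] M.Ypot a' z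
  mediator_indep : ∀ a', DiscreteCondIndep (M.Zpot a') M.A M.C M.μ
  outcome_indep : ∀ a a' z,
    DiscreteCondIndep (M.Ypot a z) (M.Zpot a') (fun ω => (M.A ω, M.C ω)) M.μ

/-- The causal model in which the front-door and the two-door assumptions hold together and the
potential mediators are independent of the covariates given the treatment, under the standing
assumptions of consistency and positivity. -/
structure IsFrontTwoDoor : Prop where
  consistency : M.Consistency
  positivity : M.Positivity
  frontDoor : M.FrontDoor
  twoDoor : M.TwoDoor
  mediator_covariates : ∀ a, DiscreteCondIndep (M.Zpot a) M.C M.A M.μ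

/-- The distribution of the observed data `(C, A, Z, Y)`. -/
def obsLaw : Measure (𝒞 × 𝒜 × 𝒵 × 𝒴) := M.μ.map fun ω => (M.C ω, M.A ω, M.Z ω, M.Y ω)

/-- The distribution of `(C, A, Z(a), Y(a))`. -/
def potLaw (a : 𝒜) : Measure (𝒞 × 𝒜 × 𝒵 × 𝒴) :=
  M.μ.map fun ω => (M.C ω, M.A ω, M.Zpot a ω, M.Yout a ω)

/-! ### Probabilities and conditional moments of the observed data -/

/-- `p(c)` -/
def pC (c : 𝒞) : ℝ := M.μ.real {ω | M.C ω = c}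

/-- `p(a)` -/
def pA (a : 𝒜) : ℝ := M.μ.real {ω | M.A ω = a}

/-- `p(a, c)` -/
def pAC (a : 𝒜) (c : 𝒞) : ℝ := M.μ.real {ω | M.A ω = a ∧ M.C ω = c}

/-- `p(a | c)` -/
def pAgivenC (a : 𝒜) (c : 𝒞) : ℝ := (M.μ[|{ω | M.C ω = c}]).real {ω | M.A ω = a}

/-- `p(z | a)` -/
def pZgivenA (z : 𝒵) (a : 𝒜) : ℝ := (M.μ[|{ω | M.A ω = a}]).real {ω | M.Z ω = z}

/-- `p(z | a, c)` -/
def pZgivenAC (z : 𝒵) (a : 𝒜) (c : 𝒞) : ℝ :=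
  (M.μ[|{ω | M.A ω = a ∧ M.C ω = c}]).real {ω | M.Z ω = z}

/-- `p(y | a, z, c)` -/
def pYgivenAZC (y : 𝒴) (a : 𝒜) (z : 𝒵) (c : 𝒞) : ℝ :=
  (M.μ[|{ω | M.A ω = a ∧ M.Z ω = z ∧ M.C ω = c}]).real {ω | M.Y ω = y}

/-- `E(Y | a, z, c)` -/
def EY (a : 𝒜) (z : 𝒵) (c : 𝒞) : ℝ :=
  ∫ ω, (M.Y ω : ℝ) ∂(M.μ[|{ω | M.A ω = a ∧ M.Z ω = z ∧ M.C ω = c}])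

/-- `var(Y | a, z, c)` -/
def varY (a : 𝒜) (z : 𝒵) (c : 𝒞) : ℝ :=
  variance (fun ω => (M.Y ω : ℝ)) (M.μ[|{ω | M.A ω = a ∧ M.Z ω = z ∧ M.C ω = c}])

/-- The contrast `I(a = a₁) - I(a = a₀)`. -/
def contrast (a₁ a₀ a : 𝒜) : ℝ :=
  ({a₁} : Set 𝒜).indicator (fun _ => (1 : ℝ)) a - ({a₀} : Set 𝒜).indicator (fun _ => (1 : ℝ)) a

/-- The function `φ_td`, the efficient influence function for `θ` under the two-door
assumption alone. -/
def phiTD (a₁ a₀ : 𝒜) : 𝒞 × 𝒜 × 𝒵 × 𝒴 → ℝ := fun (c, a, z, y) =>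
  ((y : ℝ) - M.EY a z c) * ((M.pZgivenAC z a₁ c - M.pZgivenAC z a₀ c) / M.pZgivenAC z a c)
  + ((∑' a' : 𝒜, M.EY a' z c * M.pAgivenC a' c)
      - ∑' w : 𝒜 × 𝒵, M.EY w.1 w.2 c * M.pZgivenAC w.2 a c * M.pAgivenC w.1 c)
    * (contrast a₁ a₀ a / M.pAgivenC a c)
  + (∑' z' : 𝒵, M.EY a z' c * (M.pZgivenAC z' a₁ c - M.pZgivenAC z' a₀ c))
  - M.ACE a₁ a₀

/-- The function `φ_{fd,td}`. -/
def phiFDTD (a₁ a₀ : 𝒜) : 𝒞 × 𝒜 × 𝒵 × 𝒴 → ℝ := fun (c, a, z, y) =>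
  ((y : ℝ) - M.EY a z c) * ((M.pZgivenA z a₁ - M.pZgivenA z a₀) / M.pZgivenA z a)
  + (∑' c' : 𝒞,
      ((∑' a' : 𝒜, M.EY a' z c' * M.pAgivenC a' c')
        - ∑' w : 𝒜 × 𝒵, M.EY w.1 w.2 c' * M.pZgivenA w.2 a * M.pAgivenC w.1 c')
      * (contrast a₁ a₀ a * M.pC c' / M.pA a))
  + (∑' z' : 𝒵, M.EY a z' c * (M.pZgivenA z' a₁ - M.pZgivenA z' a₀))
  - M.ACE a₁ a₀

/-- The two lines of the efficiency bound that belong to the treatment level `b`: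
`∑_z p(z|b)/p(b) (∑_{a,c} E(Y|a,z,c) p(a|c) p(c))² - (∑_{a,z,c} E(Y|a,z,c) p(z|b) p(a|c) p(c))² / p(b)`. -/
def boundTerm (b : 𝒜) : ℝ :=
  (∑' z : 𝒵, M.pZgivenA z b / M.pA b
      * (∑' w : 𝒜 × 𝒞, M.EY w.1 z w.2 * M.pAgivenC w.1 w.2 * M.pC w.2) ^ 2)
  - (∑' w : 𝒜 × 𝒵 × 𝒞,
      M.EY w.1 w.2.1 w.2.2 * M.pZgivenA w.2.1 b * M.pAgivenC w.1 w.2.2 * M.pC w.2.2) ^ 2 / M.pA b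

/-- The explicit formula for the efficiency bound. -/
def boundFDTD (a₁ a₀ : 𝒜) : ℝ :=
  (∑' z : 𝒵, (M.pZgivenA z a₁ - M.pZgivenA z a₀) ^ 2
      * ∑' w : 𝒜 × 𝒞, M.pAC w.1 w.2 / M.pZgivenA z w.1 * M.varY w.1 z w.2)
  + M.boundTerm a₁ + M.boundTerm a₀
  + (∑' w : 𝒜 × 𝒞, M.pAC w.1 w.2
      * (∑' z : 𝒵, M.EY w.1 z w.2 * (M.pZgivenA z a₁ - M.pZgivenA z a₀)) ^ 2)
  - M.ACE a₁ a₀ ^ 2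

end assumptions

/-! ### Semiparametric efficiency -/

/-- The family `P` of distributions on a countable space is differentiable in quadratic mean at the
parameter `0`, with the square integrable score `S`. -/
def DiffQuadraticMean {X : Type*} [MeasurableSpace X] {k : ℕ}
    (P : EuclideanSpace ℝ (Fin k) → Measure X) (S : X → EuclideanSpace ℝ (Fin k)) : Prop :=
  MemLp S 2 (P 0) ∧
  (fun h => ∑' x, (√((P h).real {x}) - √((P 0).real {x}) - ⟪h, S x⟫ / 2 * √((P 0).real {x})) ^ 2)
    =o[𝓝 0] fun h => ‖h‖ ^ 2

/-- `Q` is a regular `k`-dimensional parametric submodel of the front- and two-door model, through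
the observed-data distribution of `M` at the parameter `0`, with score `S`: near `0` each member
satisfies the assumptions of the model, and the observed-data distribution is differentiable in
quadratic mean at `0`. So that `E Y(a₁)` and `E Y(a₀)` are regular functions of the parameter, the
laws of `(C, A, Z(b), Y(b))`, `b = a₁, a₀`, are differentiable in quadratic mean at `0` as well,
and `E Y(b)²` is bounded near `0`. (For finite spaces these last two requirements follow from the
others.) -/
structure IsRegularSubmodel (M : CausalModel 𝒞 𝒜 𝒵 𝒴) (a₁ a₀ : 𝒜) {k : ℕ}
    (Q : EuclideanSpace ℝ (Fin k) → CausalModel 𝒞 𝒜 𝒵 𝒴)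
    (S : 𝒞 × 𝒜 × 𝒵 × 𝒴 → EuclideanSpace ℝ (Fin k)) : Prop where
  inModel : ∀ᶠ t in 𝓝 0, (Q t).IsFrontTwoDoor
  truth : (Q 0).obsLaw = M.obsLaw
  score : DiffQuadraticMean (fun t => (Q t).obsLaw) S
  smooth_pot : ∀ b ∈ ({a₁, a₀} : Set 𝒜), ∃ T, DiffQuadraticMean (fun t => (Q t).potLaw b) T
  moment : ∀ b ∈ ({a₁, a₀} : Set 𝒜), ∃ K : ℝ, ∀ᶠ t in 𝓝 0,
    MemLp (fun ω => ((Q t).Yout b ω : ℝ)) 2 (Q t).μ ∧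
      ∫ ω, ((Q t).Yout b ω : ℝ) ^ 2 ∂(Q t).μ ≤ K

/-- `φ` is an influence function of `θ` in the model: it is square integrable, and along each
regular parametric submodel `θ` is differentiable with gradient `E(φ S)`. -/
def IsInfluenceFunction (M : CausalModel 𝒞 𝒜 𝒵 𝒴) (a₁ a₀ : 𝒜) (φ : 𝒞 × 𝒜 × 𝒵 × 𝒴 → ℝ) : Prop :=
  MemLp φ 2 M.obsLaw ∧
  ∀ (k : ℕ) (Q : EuclideanSpace ℝ (Fin k) → CausalModel 𝒞 𝒜 𝒵 𝒴)
    (S : 𝒞 × 𝒜 × 𝒵 × 𝒴 → EuclideanSpace ℝ (Fin k)), IsRegularSubmodel M a₁ a₀ Q S →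
    HasGradientAt (fun t => (Q t).ACE a₁ a₀) (∫ x, φ x • S x ∂M.obsLaw) 0

/-- The tangent space: the mean square closure of the linear combinations of (components of)
scores of regular parametric submodels. -/
def tangentSpace (M : CausalModel 𝒞 𝒜 𝒵 𝒴) (a₁ a₀ : 𝒜) : Submodule ℝ (Lp ℝ 2 M.obsLaw) :=
  (Submodule.span ℝ {f : Lp ℝ 2 M.obsLaw |
    ∃ (k : ℕ) (Q : EuclideanSpace ℝ (Fin k) → CausalModel 𝒞 𝒜 𝒵 𝒴)
      (S : 𝒞 × 𝒜 × 𝒵 × 𝒴 → EuclideanSpace ℝ (Fin k)) (i : Fin k),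
      IsRegularSubmodel M a₁ a₀ Q S ∧ f =ᵐ[M.obsLaw] fun x => S x i}).topologicalClosure

/-- `φ` is the orthogonal projection of `ψ` onto the tangent space. -/
def IsTangentProjection (M : CausalModel 𝒞 𝒜 𝒵 𝒴) (a₁ a₀ : 𝒜)
    (ψ φ : 𝒞 × 𝒜 × 𝒵 × 𝒴 → ℝ) : Prop :=
  MemLp ψ 2 M.obsLaw ∧
  (∃ f ∈ tangentSpace M a₁ a₀, f =ᵐ[M.obsLaw] φ) ∧
  ∀ g ∈ tangentSpace M a₁ a₀, ∫ x, (ψ x - φ x) * g x ∂M.obsLaw = 0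

/-- `φ` is the efficient influence function of `θ`: `θ` is pathwise differentiable, and `φ` is an
influence function that is the projection of every influence function onto the tangent space. -/
def IsEfficientInfluenceFunction (M : CausalModel 𝒞 𝒜 𝒵 𝒴) (a₁ a₀ : 𝒜)
    (φ : 𝒞 × 𝒜 × 𝒵 × 𝒴 → ℝ) : Prop :=
  IsInfluenceFunction M a₁ a₀ φ ∧
  ∀ ψ, IsInfluenceFunction M a₁ a₀ ψ → IsTangentProjection M a₁ a₀ ψ φ

/-- The Cramér–Rao bounds `gᵀ I⁻¹ g` for `θ` in the regular parametric submodels, where `g` is the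
gradient of `θ` and `I = E(S Sᵀ)` is the information matrix, required to be nonsingular. -/
def cramerRaoBounds (M : CausalModel 𝒞 𝒜 𝒵 𝒴) (a₁ a₀ : 𝒜) : Set ℝ :=
  {v | ∃ (k : ℕ) (Q : EuclideanSpace ℝ (Fin k) → CausalModel 𝒞 𝒜 𝒵 𝒴)
      (S : 𝒞 × 𝒜 × 𝒵 × 𝒴 → EuclideanSpace ℝ (Fin k)) (g : EuclideanSpace ℝ (Fin k))
      (I : Matrix (Fin k) (Fin k) ℝ),
      IsRegularSubmodel M a₁ a₀ Q S ∧
      HasGradientAt (fun t => (Q t).ACE a₁ a₀) g 0 ∧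
      (∀ i j, I i j = ∫ x, S x i * S x j ∂M.obsLaw) ∧ IsUnit I.det ∧
      v = (fun i => g i) ⬝ᵥ (I⁻¹ *ᵥ fun i => g i)}

/-- `v` is the semiparametric efficiency bound: the supremum of the Cramér–Rao bounds over the
regular parametric submodels. -/
def IsEfficiencyBound (M : CausalModel 𝒞 𝒜 𝒵 𝒴) (a₁ a₀ : 𝒜) (v : ℝ) : Prop :=
  IsLUB (cramerRaoBounds M a₁ a₀) v

end CausalModel

end

set_option linter.unusedSectionVars false

noncomputable section

/-! ### Differentiability of expectations along quadratic mean differentiable families -/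

/-! Everything rests on a factorisation. Under the assumptions `Z(b)` is independent of `(C, A)`,
and the law of `Y(b, z)` given `C, A` is the observed law of `Y` given `C, A, Z = z`. Hence the
observed law is p(c, a) p(z | a) p(y | c, a, z) (`obsLaw_isAssembled`), and the law of `(C, A, Z(b),
Y(b))` is the same product with p(z | b) in place of p(z | a), whatever a is (`potLaw_isAssembled`).
Conversely, any three positive factors come from a causal model (`ofLaws_isFrontTwoDoor`), so the
factors vary freely.

Consequently each score is a sum s₁(c, a, z, y) + s₂(a, z) + s₃(c, a) whose terms are centred given
`(C, A, Z)`, given `A`, and unconditionally (`exists_centredTriple`); the three kinds of terms are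
mutually orthogonal. The score of the law of `(C, A, Z(b), Y(b))` is then s₁ + s₂(b, z) + s₃. The
derivative of `E Y(b)` is the mean of `Y(b)` times this score, and each term sees only one
regression of the outcome: the residual, the mean given the mediator, the mean given `(C, A)`
(`integral_outcome_mul`). The likelihood ratio p(z | b) / p(z | a) carries the residual term back to
the observed law, and the result is the inner product of the score with φ_{fd,td}, which has three
components of the same kind (`phiFDTD_eq`). The function φ_td shares the outer two; its mediator
component also depends on c, but has the mean of the other one given `(A, Z)` (`condMean_phiZC`),
and scores see no more than that. So both are influence functions
(`isInfluenceFunction_of_components`).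

Two influence functions have the same inner products with all scores, hence their difference is
orthogonal to the tangent space. That φ_{fd,td} lies in the tangent space follows from explicit
submodels with factor densities 1 + t sᵢ (`isRegularSubmodel_tilt`), whose bounded scores are dense
among the sums of centred triples (`toLp_mem_closure`). A Cramér–Rao bound is the squared norm of
the projection of φ_{fd,td} onto the span of the score components, hence at most its second moment,
and by density the one-dimensional submodels come arbitrarily close. The explicit formula is
Pythagoras for the three components.

The value sets may be infinite and second moments are assumed only for `Y(a₁)`, `Y(a₀)`. The
analytic core is therefore `DiffQuadraticMean.hasGradientAt`, for unbounded functions with locally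
bounded second moment; square integrability under the potential laws needs separate attention,
because their density with respect to the observed law can be unbounded. -/

theorem summable_mul_of_summable_sq {ι : Type*} {f g : ι → ℝ} (hf : Summable fun i => f i ^ 2)
    (hg : Summable fun i => g i ^ 2) : Summable fun i => f i * g i := by
  refine Summable.of_norm_bounded (hf.add hg) fun i => ?_
  rw [Real.norm_eq_abs, abs_le]
  constructor <;> nlinarith [sq_nonneg (f i + g i), sq_nonneg (f i - g i), sq_nonneg (f i),
    sq_nonneg (g i)]

theorem abs_tsum_mul_le_sqrt {ι : Type*} {f g : ι → ℝ} (hf : Summable fun i => f i ^ 2)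
    (hg : Summable fun i => g i ^ 2) :
    |∑' i, f i * g i| ≤ √(∑' i, f i ^ 2) * √(∑' i, g i ^ 2) := by
  have hs := (summable_mul_of_summable_sq hf hg).abs
  calc |∑' i, f i * g i| ≤ ∑' i, |f i * g i| := by
        exact norm_tsum_le_tsum_norm (f := fun i => f i * g i) hs
    _ ≤ _ := by
        refine hs.tsum_le_of_sum_le fun s => ?_
        simp only [abs_mul]
        refine (Real.sum_mul_le_sqrt_mul_sqrt s _ _).trans ?_
        simp only [sq_abs]
        gcongr
        · exact hf.sum_le_tsum s fun i _ => sq_nonneg (f i)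
        · exact hg.sum_le_tsum s fun i _ => sq_nonneg (g i)

/-- Bounded pointwise convergence in `ℓ²` implies weak convergence. -/
theorem tendsto_tsum_mul_of_bounded {ι α : Type*} {l : Filter α} {G : ι → ℝ} {v : α → ι → ℝ}
    {B : ℝ} (hG : Summable fun i => G i ^ 2)
    (hv : ∀ᶠ h in l, Summable (fun i => v h i ^ 2) ∧ ∑' i, v h i ^ 2 ≤ B)
    (hlim : ∀ i, Tendsto (fun h => v h i) l (𝓝 0)) :
    Tendsto (fun h => ∑' i, G i * v h i) l (𝓝 0) := by
  rw [Metric.tendsto_nhds]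
  intro ε hε
  -- Outside a finite set `F` the function `G` has small norm and Cauchy–Schwarz applies; on `F`
  -- pointwise convergence suffices. The `+ 1` keeps the denominator positive when `B = 0`.
  have hδ : 0 < (ε / (2 * (√B + 1))) ^ 2 := by positivity
  obtain ⟨F, hF⟩ := ((tendsto_tsum_compl_atTop_zero fun i => G i ^ 2).eventually_lt_const hδ).exists
  have hfin : Tendsto (fun h => ∑ i ∈ F, G i * v h i) l (𝓝 0) := by
    have := tendsto_finsetSum F fun i _ => (hlim i).const_mul (G i)
    simpa using this
  have h2 := (Metric.tendsto_nhds.1 hfin) (ε / 2) (by positivity)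
  filter_upwards [hv, h2] with h ⟨hs, hB⟩ hsmall
  rw [Real.dist_eq, sub_zero] at hsmall ⊢
  have hsum := summable_mul_of_summable_sq hG hs
  rw [← hsum.sum_add_tsum_subtype_compl F]
  have hG' : Summable fun i : {x // x ∉ F} => G i ^ 2 := hG.subtype _
  have hs' : Summable fun i : {x // x ∉ F} => v h i ^ 2 := hs.subtype _
  have htail := abs_tsum_mul_le_sqrt hG' hs'
  have h3 : √(∑' i : {x // x ∉ F}, v h i ^ 2) ≤ √B := by
    refine Real.sqrt_le_sqrt (le_trans ?_ hB)
    exact hs.tsum_subtype_le (fun i => v h i ^ 2) {x | x ∉ F} (fun _ => sq_nonneg _)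
  have h4 : √(∑' i : {x // x ∉ F}, G i ^ 2) ≤ ε / (2 * (√B + 1)) := by
    rw [← Real.sqrt_sq (show 0 ≤ ε / (2 * (√B + 1)) by positivity)]
    exact Real.sqrt_le_sqrt hF.le
  have h5 : ε / (2 * (√B + 1)) * √B ≤ ε / 2 := by
    rw [div_mul_eq_mul_div, div_le_div_iff₀ (by positivity) (by positivity)]
    nlinarith [Real.sqrt_nonneg B]
  have h6 : √(∑' i : {x // x ∉ F}, G i ^ 2) * √(∑' i : {x // x ∉ F}, v h i ^ 2) ≤ ε / 2 :=
    (mul_le_mul h4 h3 (Real.sqrt_nonneg _) (by positivity)).trans h5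
  calc _ ≤ _ := abs_add_le _ _
    _ < ε / 2 + ε / 2 := add_lt_add_of_lt_of_le hsmall (htail.trans h6)
    _ = ε := by ring

section dqm

variable {X : Type*} [MeasurableSpace X] [MeasurableSingletonClass X] [Countable X]

theorem integral_eq_tsum_mass {P : Measure X} {f : X → ℝ} (hf : Integrable f P) :
    ∫ x, f x ∂P = ∑' x, P.real {x} * f x := by
  simpa using integral_countable hf

theorem summable_mass_mul {P : Measure X} {f : X → ℝ} (hf : Integrable f P) :
    Summable fun x => P.real {x} * f x := by
  have h := hasSum_integral_iUnion (μ := P) (f := f) (s := fun x : X => {x})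
    (fun x => measurableSet_singleton x)
    (fun x y hxy => by simpa using hxy) hf.integrableOn
  refine h.summable.congr fun x => ?_
  simp [measureReal_def]

theorem summable_mass_mul_sq {P : Measure X} {f : X → ℝ} (hf : MemLp f 2 P) :
    Summable fun x => (f x * √(P.real {x})) ^ 2 := by
  refine (summable_mass_mul hf.integrable_sq).congr fun x => ?_
  rw [mul_pow, Real.sq_sqrt measureReal_nonneg]; ring

theorem tsum_mass_mul_sq {P : Measure X} {f : X → ℝ} (hf : MemLp f 2 P) :
    ∑' x, (f x * √(P.real {x})) ^ 2 = ∫ x, f x ^ 2 ∂P := by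
  rw [integral_eq_tsum_mass hf.integrable_sq]
  refine tsum_congr fun x => ?_
  rw [mul_pow, Real.sq_sqrt measureReal_nonneg]; ring

/-- Along a family that is differentiable in quadratic mean, the expectation of a function whose
second moment is locally bounded is differentiable. -/
theorem DiffQuadraticMean.hasGradientAt {k : ℕ} {P : EuclideanSpace ℝ (Fin k) → Measure X}
    [∀ h, IsProbabilityMeasure (P h)] {S : X → EuclideanSpace ℝ (Fin k)}
    (hS : CausalModel.DiffQuadraticMean P S) {f : X → ℝ} {K : ℝ}
    (hf : ∀ᶠ h in 𝓝 0, MemLp f 2 (P h) ∧ ∫ x, f x ^ 2 ∂P h ≤ K) :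
    HasGradientAt (fun h => ∫ x, f x ∂P h) (∫ x, f x • S x ∂P 0) 0 := by
  obtain ⟨hS2, hr⟩ := hS
  set u : EuclideanSpace ℝ (Fin k) → X → ℝ := fun h x => √((P h).real {x}) with hu
  set r : EuclideanSpace ℝ (Fin k) → X → ℝ := fun h x => u h x - u 0 x - ⟪h, S x⟫ / 2 * u 0 x
    with hrdef
  have hf0 : MemLp f 2 (P 0) := hf.self_of_nhds.1
  have hu2 : ∀ h, Summable fun x => u h x ^ 2 := fun h => by
    simpa only [one_mul] using summable_mass_mul_sq (P := P h) (f := fun _ => 1) (memLp_const 1)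
  have hSn : MemLp (fun x => ‖S x‖) 2 (P 0) := hS2.norm
  have hSi : ∀ h, MemLp (fun x => ⟪h, S x⟫) 2 (P 0) := fun h => hS2.const_inner h
  have hSsum : ∀ h, Summable fun x => (⟪h, S x⟫ * u 0 x) ^ 2 := fun h =>
    summable_mass_mul_sq (hSi h)
  have sq_sub : ∀ {a b : X → ℝ}, Summable (fun x => a x ^ 2) → Summable (fun x => b x ^ 2) →
      Summable fun x => (a x - b x) ^ 2 := fun {a b} ha hb => by
    refine ((ha.add hb).add ((summable_mul_of_summable_sq ha hb).mul_left (-2))).congr fun x => ?_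
    ring
  have sq_add : ∀ {a b : X → ℝ}, Summable (fun x => a x ^ 2) → Summable (fun x => b x ^ 2) →
      Summable fun x => (a x + b x) ^ 2 := fun {a b} ha hb => by
    refine ((ha.add hb).add ((summable_mul_of_summable_sq ha hb).mul_left 2)).congr fun x => ?_
    ring
  have hShalf : ∀ h, Summable fun x => (⟪h, S x⟫ / 2 * u 0 x) ^ 2 := fun h => by
    refine ((hSsum h).mul_left (1/4)).congr fun x => ?_
    ring
  have hrsum : ∀ h, Summable fun x => r h x ^ 2 := fun h =>
    sq_sub (sq_sub (hu2 h) (hu2 0)) (hShalf h)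
  -- the remainder tends to zero
  have hr0 : Tendsto (fun h => ∑' x, r h x ^ 2) (𝓝 0) (𝓝 0) := by
    refine hr.trans_tendsto ?_
    have : Tendsto (fun h : EuclideanSpace ℝ (Fin k) => ‖h‖ ^ 2) (𝓝 0) (𝓝 (‖(0 : EuclideanSpace ℝ (Fin k))‖ ^ 2)) :=
      (continuous_norm.pow 2).tendsto 0
    simpa using this
  have hrx : ∀ x, Tendsto (fun h => r h x) (𝓝 0) (𝓝 0) := fun x => by
    have h1 : Tendsto (fun h => √(∑' x, r h x ^ 2)) (𝓝 0) (𝓝 0) := by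
      simpa using hr0.sqrt
    refine squeeze_zero_norm (fun h => ?_) h1
    rw [Real.norm_eq_abs, ← Real.sqrt_sq_eq_abs]
    exact Real.sqrt_le_sqrt ((hrsum h).le_tsum x fun _ _ => sq_nonneg _)
  have hux : ∀ x, Tendsto (fun h => u h x - u 0 x) (𝓝 0) (𝓝 0) := fun x => by
    have h1 : Tendsto (fun h : EuclideanSpace ℝ (Fin k) => ⟪h, S x⟫ / 2 * u 0 x) (𝓝 0) (𝓝 0) := by
      have : Continuous fun h : EuclideanSpace ℝ (Fin k) => ⟪h, S x⟫ / 2 * u 0 x := by fun_prop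
      simpa using this.tendsto 0
    have h2 := (hrx x).add h1
    simp only [add_zero] at h2
    refine h2.congr fun h => ?_
    simp [hrdef]
  have hK : 0 ≤ K := (integral_nonneg fun _ => sq_nonneg _).trans hf.self_of_nhds.2
  have hfu0 := summable_mass_mul_sq hf0
  have hfu : ∀ᶠ h in 𝓝 0, Summable (fun x => (f x * u h x) ^ 2) ∧
      ∑' x, (f x * u h x) ^ 2 ≤ K := by
    filter_upwards [hf] with h ⟨h1, h2⟩
    exact ⟨summable_mass_mul_sq h1, (tsum_mass_mul_sq h1).trans_le h2⟩
  -- Both signs are needed: `u h + u 0` multiplies the remainder, `u h - u 0` multiplies the score.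
  -- The bound is 2K + 2K, from (x + σy)² ≤ 2x² + 2y².
  have key : ∀ (σ : ℝ), σ ^ 2 = 1 → ∀ᶠ h in 𝓝 0, Summable (fun x => (f x * (u h x + σ * u 0 x)) ^ 2) ∧
      ∑' x, (f x * (u h x + σ * u 0 x)) ^ 2 ≤ 4 * K := by
    intro σ hσ
    filter_upwards [hfu] with h ⟨h1, h2⟩
    have h3 := (hfu.self_of_nhds).1
    have h4 := (hfu.self_of_nhds).2
    have hle : ∀ x, (f x * (u h x + σ * u 0 x)) ^ 2 ≤
        2 * (f x * u h x) ^ 2 + 2 * (f x * u 0 x) ^ 2 := fun x => by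
      have : 2 * (f x * u h x) ^ 2 + 2 * (σ ^ 2 * (f x * u 0 x) ^ 2)
        - (f x * (u h x + σ * u 0 x)) ^ 2 = (f x * u h x - σ * (f x * u 0 x)) ^ 2 := by ring
      rw [hσ] at this
      nlinarith [sq_nonneg (f x * u h x - σ * (f x * u 0 x))]
    have hs2 := (h1.mul_left 2).add (h3.mul_left 2)
    have hs1 := Summable.of_nonneg_of_le (fun x => sq_nonneg _) hle hs2
    refine ⟨hs1, (hs1.tsum_le_tsum hle hs2).trans ?_⟩
    rw [(h1.mul_left 2).tsum_add (h3.mul_left 2), tsum_mul_left, tsum_mul_left]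
    linarith
  -- Nothing dominates `f * (u h - u 0)`, and it need not tend to zero in norm. It is bounded in ℓ²
  -- and tends to zero pointwise, which is enough against the fixed square summable function `‖S‖ *
  -- u 0`.
  have hW : Tendsto (fun h => ∑' x, (‖S x‖ * u 0 x) * |f x * (u h x - u 0 x)|) (𝓝 0) (𝓝 0) := by
    refine tendsto_tsum_mul_of_bounded (B := 4 * K) (summable_mass_mul_sq hSn) ?_ fun x => ?_
    · filter_upwards [key (-1) (by norm_num)] with h hh
      simp only [sq_abs]
      simpa [sub_eq_add_neg] using hh
    · have := ((hux x).const_mul (f x)).abs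
      simpa using this
  have hsqrt : (fun h => √(∑' x, r h x ^ 2)) =o[𝓝 0] fun h => ‖h‖ := by
    rw [isLittleO_iff] at hr ⊢
    intro c hc
    filter_upwards [hr (show 0 < c ^ 2 by positivity)] with h hh
    rw [Real.norm_of_nonneg (tsum_nonneg fun _ => sq_nonneg _), norm_pow, norm_norm,
      ← mul_pow] at hh
    rw [Real.norm_of_nonneg (Real.sqrt_nonneg _), norm_norm]
    exact Real.sqrt_le_iff.2 ⟨by positivity, hh⟩
  have hintS : Integrable (fun x => f x • S x) (P 0) := by
    have := hS2.smul hf0 (r := 1)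
    exact memLp_one_iff_integrable.1 this
  have hbound : ∀ᶠ h in 𝓝 0, ‖(∫ x, f x ∂P h) - (∫ x, f x ∂P 0) - ⟪∫ x, f x • S x ∂P 0, h⟫‖ ≤
      ‖√(∑' x, r h x ^ 2) * √(4 * K) +
      ‖h‖ * ((1 / 2) * ∑' x, (‖S x‖ * u 0 x) * |f x * (u h x - u 0 x)|)‖ := by
    filter_upwards [hf, hfu, key 1 (by norm_num), key (-1) (by norm_num)] with h hfh hfuh hp hm
    simp only [one_mul] at hp
    have hm1 : Summable fun x => (f x * (u h x - u 0 x)) ^ 2 := by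
      simpa [sub_eq_add_neg] using hm.1
    have hinner : ⟪∫ x, f x • S x ∂P 0, h⟫ = ∑' x, (P 0).real {x} * (f x * ⟪h, S x⟫) := by
      have hi2 : Integrable (fun x => f x * ⟪h, S x⟫) (P 0) := (hSi h).integrable_mul hf0 |>.congr
        (by filter_upwards with x; simp [mul_comm])
      rw [← integral_eq_tsum_mass hi2, real_inner_comm, ← integral_inner hintS]
      simp only [inner_smul_right]
    rw [hinner, integral_eq_tsum_mass (hfh.1.integrable (by norm_num)),
      integral_eq_tsum_mass (hf0.integrable (by norm_num))]
    have hA := summable_mass_mul (hfh.1.integrable (by norm_num))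
    have hB := summable_mass_mul (hf0.integrable (by norm_num))
    have hC : Summable fun x => (P 0).real {x} * (f x * ⟪h, S x⟫) :=
      summable_mass_mul ((hSi h).integrable_mul hf0 |>.congr
        (by filter_upwards with x; simp [mul_comm]))
    have hD : Summable fun x => r h x * (f x * (u h x + u 0 x)) :=
      summable_mul_of_summable_sq (hrsum h) hp.1
    have hE : Summable fun x => (⟪h, S x⟫ / 2 * u 0 x) * (f x * (u h x - u 0 x)) :=
      summable_mul_of_summable_sq (hShalf h) hm1
    -- Write u_h² - u_0² = (u_h - u_0)(u_h + u_0) and insert u_h - u_0 = r + ⟪h, S⟫ u_0 / 2. The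
    -- linear term cancels; what remains is o(‖h‖) because of `r`, and ‖h‖ times a quantity that
    -- tends to zero by `hW`.
    have hsplit : (∑' x, (P h).real {x} * f x) - (∑' x, (P 0).real {x} * f x) -
        (∑' x, (P 0).real {x} * (f x * ⟪h, S x⟫)) =
        (∑' x, r h x * (f x * (u h x + u 0 x))) +
          ∑' x, (⟪h, S x⟫ / 2 * u 0 x) * (f x * (u h x - u 0 x)) := by
      rw [← hA.tsum_sub hB, ← (hA.sub hB).tsum_sub hC, ← hD.tsum_add hE]
      refine tsum_congr fun x => ?_
      have e1 : (P h).real {x} = u h x ^ 2 := (Real.sq_sqrt measureReal_nonneg).symm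
      have e0 : (P 0).real {x} = u 0 x ^ 2 := (Real.sq_sqrt measureReal_nonneg).symm
      rw [e1, e0, hrdef]
      ring
    rw [hsplit]
    have hG : Summable fun x => (‖S x‖ * u 0 x) * |f x * (u h x - u 0 x)| :=
      summable_mul_of_summable_sq (summable_mass_mul_sq hSn) (by simpa only [sq_abs] using hm1)
    refine le_trans ?_ (Real.le_norm_self _)
    refine (norm_add_le _ _).trans (add_le_add ?_ ?_)
    · refine (abs_tsum_mul_le_sqrt (hrsum h) hp.1).trans ?_
      gcongr
      exact hp.2
    · rw [← tsum_mul_left, ← tsum_mul_left]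
      refine (norm_tsum_le_tsum_norm hE.norm).trans ?_
      refine hE.norm.tsum_le_tsum (fun x => ?_) ((hG.mul_left _).mul_left _)
      rw [norm_mul, Real.norm_eq_abs, Real.norm_eq_abs, abs_mul, abs_div,
        abs_of_nonneg (show 0 ≤ u 0 x from Real.sqrt_nonneg _)]
      have := abs_real_inner_le_norm h (S x)
      have h0 : 0 ≤ u 0 x := Real.sqrt_nonneg _
      have h1 : |(2 : ℝ)| = 2 := by norm_num
      rw [h1]
      calc |⟪h, S x⟫| / 2 * u 0 x * |f x * (u h x - u 0 x)|
          ≤ ‖h‖ * ‖S x‖ / 2 * u 0 x * |f x * (u h x - u 0 x)| := by gcongr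
        _ = _ := by ring
  rw [hasGradientAt_iff_isLittleO]
  simp only [sub_zero]
  refine IsLittleO.trans_isBigO ?_ (isBigO_refl (fun h : EuclideanSpace ℝ (Fin k) => h) (𝓝 0))
  refine IsBigO.trans_isLittleO (IsBigO.of_norm_eventuallyLE hbound) ?_
  refine IsLittleO.of_norm_right (IsLittleO.norm_left (IsLittleO.add ?_ ?_))
  · have := hsqrt.const_mul_left (√(4 * K))
    simpa [mul_comm] using this
  · have h1 : (fun h => (1 / 2) * ∑' x, (‖S x‖ * u 0 x) * |f x * (u h x - u 0 x)|) =o[𝓝 0]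
        fun _ : EuclideanSpace ℝ (Fin k) => (1 : ℝ) := by
      rw [isLittleO_one_iff]
      have := hW.const_mul (1 / 2)
      rwa [mul_zero] at this
    simpa using (isBigO_refl (fun h : EuclideanSpace ℝ (Fin k) => ‖h‖) (𝓝 0)).mul_isLittleO h1

end dqm

/-! ### Conditional means given discrete variables -/

section condMean

variable {X γ δ : Type*} [MeasurableSpace X]

/-- The conditional mean of `f` given `V = v`. -/
def condMean (P : Measure X) (V : X → γ) (f : X → ℝ) (v : γ) : ℝ := ∫ x, f x ∂P[|V ⁻¹' {v}]

theorem condMean_eq_setIntegral (P : Measure X) (V : X → γ) (f : X → ℝ) (v : γ) :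
    condMean P V f v = (P.real (V ⁻¹' {v}))⁻¹ * ∫ x in V ⁻¹' {v}, f x ∂P := by
  rw [condMean, ProbabilityTheory.cond, integral_smul_measure, ENNReal.toReal_inv]
  rfl

variable [MeasurableSingletonClass X] [Countable X]

theorem ae_of_forall_mass_ne_zero {P : Measure X} {p : X → Prop} (h : ∀ x, P {x} ≠ 0 → p x) :
    ∀ᵐ x ∂P, p x := by
  rw [ae_iff_of_countable]
  exact h

theorem condMean_congr {P : Measure X} {V : X → γ} {f g : X → ℝ} {v : γ}
    (h : ∀ x, V x = v → f x = g x) : condMean P V f v = condMean P V g v := by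
  rw [condMean_eq_setIntegral, condMean_eq_setIntegral]
  congr 1
  exact setIntegral_congr_fun (.of_discrete) fun x hx => h x hx

/-- No integrability is required, since a constant factor leaves a Bochner integral even when the
latter takes its default value. Thus `integral_mul_comp` can ask for the integrability of the
product alone. -/
theorem condMean_mul_right (P : Measure X) (V : X → γ) (f : X → ℝ) (g : γ → ℝ) (v : γ) :
    condMean P V (fun x => f x * g (V x)) v = condMean P V f v * g v := by
  rw [condMean_congr (g := fun x => f x * g v) fun x hx => by rw [hx]]
  exact integral_mul_const _ _

variable {P : Measure X} [IsProbabilityMeasure P]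

theorem condMean_comp_self {V : X → γ} {v : γ} (hv : P (V ⁻¹' {v}) ≠ 0) (g : γ → ℝ) :
    condMean P V (fun x => g (V x)) v = g v := by
  have := cond_isProbabilityMeasure hv
  rw [condMean_congr (g := fun _ => g v) fun x hx => by rw [hx]]
  simp [condMean]

/-- A function measurable with respect to `V`, where every subset of `γ` counts as measurable, is
constant on the fibres of `V`, and its integral over a fibre is that of `f`. The link to the
abstract conditional expectation provides the L² contraction and the tower property. -/
theorem condExp_ae_eq_condMean (V : X → γ) {f : X → ℝ} (hf : Integrable f P) :
    P[f | MeasurableSpace.comap V ⊤] =ᵐ[P] fun x => condMean P V f (V x) := by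
  have hm : MeasurableSpace.comap V ⊤ ≤ ‹MeasurableSpace X› := fun s _ => .of_discrete
  have hfac : ∀ x x', V x = V x' →
      P[f | MeasurableSpace.comap V ⊤] x = P[f | MeasurableSpace.comap V ⊤] x' :=
    fun x x' h => StronglyMeasurable.factorsThrough (mY := ⊤) (f := V)
      (stronglyMeasurable_condExp (m := MeasurableSpace.comap V ⊤)) h
  refine ae_of_forall_mass_ne_zero fun x hx => ?_
  have hpos : P.real (V ⁻¹' {V x}) ≠ 0 := by
    rw [measureReal_ne_zero_iff]
    exact fun h => hx (measure_mono_null (by simp) h)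
  have h1 := setIntegral_condExp (m := MeasurableSpace.comap V ⊤) hm hf
    (s := V ⁻¹' {V x}) ⟨{V x}, trivial, rfl⟩
  rw [setIntegral_congr_fun (s := V ⁻¹' {V x})
    (g := fun _ => P[f | MeasurableSpace.comap V ⊤] x) (.of_discrete)
    fun x' hx' => hfac x' x hx', setIntegral_const] at h1
  beta_reduce
  rw [condMean_eq_setIntegral, ← h1, smul_eq_mul]
  field_simp

theorem integrable_condMean (V : X → γ) {f : X → ℝ} (hf : Integrable f P) :
    Integrable (fun x => condMean P V f (V x)) P :=
  integrable_condExp.congr (condExp_ae_eq_condMean V hf)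

theorem memLp_condMean (V : X → γ) {f : X → ℝ} (hf : MemLp f 2 P) :
    MemLp (fun x => condMean P V f (V x)) 2 P :=
  (MemLp.condExp (by norm_num) hf).ae_eq
    (condExp_ae_eq_condMean V (hf.integrable (by norm_num)))

/-- The pull-out property. -/
theorem integral_mul_comp (V : X → γ) {f : X → ℝ} {g : γ → ℝ}
    (hfg : Integrable (fun x => f x * g (V x)) P) :
    ∫ x, f x * g (V x) ∂P = ∫ x, condMean P V f (V x) * g (V x) ∂P := by
  have hm : MeasurableSpace.comap V ⊤ ≤ ‹MeasurableSpace X› := fun s _ => .of_discrete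
  have h1 := condExp_ae_eq_condMean V hfg
  rw [← integral_condExp hm]
  refine integral_congr_ae (h1.trans ?_)
  filter_upwards with x
  exact condMean_mul_right P V f g (V x)

theorem integral_condMean (V : X → γ) {f : X → ℝ} (hf : Integrable f P) :
    ∫ x, condMean P V f (V x) ∂P = ∫ x, f x ∂P := by
  have := integral_mul_comp V (f := f) (g := fun _ => 1) (by simpa using hf)
  simpa using this.symm

/-- The tower property. -/
theorem condMean_condMean (W : X → γ) (q : γ → δ) {f : X → ℝ} (hf : Integrable f P) (v : δ) :
    condMean P (fun x => q (W x)) (fun x => condMean P W f (W x)) v =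
      condMean P (fun x => q (W x)) f v := by
  have hm : MeasurableSpace.comap W ⊤ ≤ ‹MeasurableSpace X› := fun s _ => .of_discrete
  rw [condMean_eq_setIntegral, condMean_eq_setIntegral]
  congr 1
  have h := setIntegral_condExp (m := MeasurableSpace.comap W ⊤) hm hf
    (s := (fun x => q (W x)) ⁻¹' {v}) ⟨q ⁻¹' {v}, trivial, rfl⟩
  rw [← h]
  refine setIntegral_congr_ae .of_discrete ?_
  filter_upwards [condExp_ae_eq_condMean W hf] with x hx _
  exact hx.symm

variable [MeasurableSpace δ] [MeasurableSingletonClass δ] [Countable δ]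

theorem measure_eq_tsum_inter_preimage (J : Measure X) (W : X → δ) (s : Set X) :
    J s = ∑' w, J (s ∩ W ⁻¹' {w}) := by
  rw [← measure_iUnion]
  · congr 1; ext x; simp
  · intro w w' hw
    rw [Function.onFun, Set.disjoint_left]
    rintro x ⟨_, hx⟩ ⟨_, hx'⟩
    exact hw (hx.symm.trans hx')
  · exact fun _ => .of_discrete

theorem map_cond_eq {J : Measure X} [IsFiniteMeasure J] {V : X → γ} {W : X → δ} {v : γ}
    {l : Measure δ} (hv : J (V ⁻¹' {v}) ≠ 0)
    (h : ∀ w, J (V ⁻¹' {v} ∩ W ⁻¹' {w}) = J (V ⁻¹' {v}) * l {w}) :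
    (J[|V ⁻¹' {v}]).map W = l := by
  refine Measure.ext_of_singleton fun w => ?_
  rw [Measure.map_apply .of_discrete (measurableSet_singleton w), cond_apply .of_discrete, h,
    ← mul_assoc, ENNReal.inv_mul_cancel hv (measure_ne_top _ _), one_mul]

/-- The conditional mean given `V = v` when the conditional law of `W` is `l`. -/
theorem condMean_eq_integral {J : Measure X} [IsFiniteMeasure J] {V : X → γ} {W : X → δ} {v : γ}
    {l : Measure δ} (hv : J (V ⁻¹' {v}) ≠ 0)
    (h : ∀ w, J (V ⁻¹' {v} ∩ W ⁻¹' {w}) = J (V ⁻¹' {v}) * l {w}) (F : γ → δ → ℝ) :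
    condMean J V (fun x => F (V x) (W x)) v = ∫ w, F v w ∂l := by
  rw [condMean_congr (g := fun x => F v (W x)) fun x hx => by rw [hx], condMean,
    ← map_cond_eq hv h]
  exact (integral_map (Measurable.of_discrete (f := W)).aemeasurable
    (Measurable.of_discrete (f := F v)).aestronglyMeasurable).symm

end condMean

/-! ### Laws of `(C, A, Z, Y)` in which the mediator does not depend on the covariates -/

section assembled

variable {𝒞 𝒜 𝒵 𝒴 : Type*} [MeasurableSpace 𝒞] [MeasurableSpace 𝒜] [MeasurableSpace 𝒵]
  [MeasurableSpace 𝒴]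

/-- The law `J` has the mass function `π(c, a) κ_a(z) ρ_{c,a,z}(y)`. -/
def IsAssembled (J : Measure (𝒞 × 𝒜 × 𝒵 × 𝒴)) (π : Measure (𝒞 × 𝒜)) (κ : 𝒜 → Measure 𝒵)
    (ρ : 𝒞 × 𝒜 × 𝒵 → Measure 𝒴) : Prop :=
  ∀ c a z y, J {(c, a, z, y)} = π {(c, a)} * κ a {z} * ρ (c, a, z) {y}

abbrev projCAZ (x : 𝒞 × 𝒜 × 𝒵 × 𝒴) : 𝒞 × 𝒜 × 𝒵 := (x.1, x.2.1, x.2.2.1)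
abbrev projCA (x : 𝒞 × 𝒜 × 𝒵 × 𝒴) : 𝒞 × 𝒜 := (x.1, x.2.1)
abbrev projAZ (x : 𝒞 × 𝒜 × 𝒵 × 𝒴) : 𝒜 × 𝒵 := (x.2.1, x.2.2.1)
abbrev projA (x : 𝒞 × 𝒜 × 𝒵 × 𝒴) : 𝒜 := x.2.1
abbrev projZ (x : 𝒞 × 𝒜 × 𝒵 × 𝒴) : 𝒵 := x.2.2.1

variable [MeasurableSingletonClass 𝒞] [MeasurableSingletonClass 𝒜] [MeasurableSingletonClass 𝒵]
  [MeasurableSingletonClass 𝒴] [Countable 𝒞] [Countable 𝒜] [Countable 𝒵] [Countable 𝒴]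

theorem tsum_measure_singleton' {δ : Type*} [MeasurableSpace δ] [MeasurableSingletonClass δ]
    [Countable δ] (l : Measure δ) [IsProbabilityMeasure l] : ∑' w, l {w} = 1 := by
  have := measure_eq_tsum_inter_preimage l id Set.univ
  simpa using this.symm

namespace IsAssembled

variable {J : Measure (𝒞 × 𝒜 × 𝒵 × 𝒴)} {π : Measure (𝒞 × 𝒜)} {κ : 𝒜 → Measure 𝒵}
    {ρ : 𝒞 × 𝒜 × 𝒵 → Measure 𝒴}

theorem measure_projCAZ [∀ v, IsProbabilityMeasure (ρ v)] (h : IsAssembled J π κ ρ)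
    (c : 𝒞) (a : 𝒜) (z : 𝒵) :
    J (projCAZ ⁻¹' {(c, a, z)}) = π {(c, a)} * κ a {z} := by
  rw [measure_eq_tsum_inter_preimage J (fun x => x.2.2.2)]
  have : ∀ y, (projCAZ ⁻¹' {(c, a, z)}) ∩ (fun x : 𝒞 × 𝒜 × 𝒵 × 𝒴 => x.2.2.2) ⁻¹' {y} =
      {(c, a, z, y)} := fun y => by
    ext ⟨c', a', z', y'⟩; simp [and_assoc]
  simp only [this, h c a z, ENNReal.tsum_mul_left, tsum_measure_singleton', mul_one]

theorem measure_projCA [∀ v, IsProbabilityMeasure (ρ v)] [∀ a, IsProbabilityMeasure (κ a)]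
    (h : IsAssembled J π κ ρ) (v : 𝒞 × 𝒜) : J (projCA ⁻¹' {v}) = π {v} := by
  obtain ⟨c, a⟩ := v
  rw [measure_eq_tsum_inter_preimage J projZ]
  have : ∀ z, (projCA ⁻¹' {(c, a)}) ∩ (projZ : 𝒞 × 𝒜 × 𝒵 × 𝒴 → 𝒵) ⁻¹' {z} =
      projCAZ ⁻¹' {(c, a, z)} := fun z => by
    ext ⟨c', a', z', y'⟩; simp [and_assoc]
  simp only [this, h.measure_projCAZ, ENNReal.tsum_mul_left, tsum_measure_singleton', mul_one]

theorem measure_projAZ [∀ v, IsProbabilityMeasure (ρ v)] (h : IsAssembled J π κ ρ)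
    (a : 𝒜) (z : 𝒵) : J (projAZ ⁻¹' {(a, z)}) = π (Prod.snd ⁻¹' {a}) * κ a {z} := by
  rw [measure_eq_tsum_inter_preimage J Prod.fst,
    measure_eq_tsum_inter_preimage π (Prod.fst : 𝒞 × 𝒜 → 𝒞) (Prod.snd ⁻¹' {a})]
  have h1 : ∀ c, (projAZ ⁻¹' {(a, z)}) ∩ (Prod.fst : 𝒞 × 𝒜 × 𝒵 × 𝒴 → 𝒞) ⁻¹' {c} =
      projCAZ ⁻¹' {(c, a, z)} := fun c => by
    ext ⟨c', a', z', y'⟩; simp [and_comm]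
  have h2 : ∀ c, (Prod.snd ⁻¹' {a}) ∩ (Prod.fst : 𝒞 × 𝒜 → 𝒞) ⁻¹' {c} = {(c, a)} := fun c => by
    ext ⟨c', a'⟩; simp [and_comm]
  simp only [h1, h2, h.measure_projCAZ, ENNReal.tsum_mul_right]

theorem measure_projA [∀ v, IsProbabilityMeasure (ρ v)] [∀ a, IsProbabilityMeasure (κ a)]
    (h : IsAssembled J π κ ρ) (a : 𝒜) : J (projA ⁻¹' {a}) = π (Prod.snd ⁻¹' {a}) := by
  rw [measure_eq_tsum_inter_preimage J projZ]
  have : ∀ z, (projA ⁻¹' {a}) ∩ (projZ : 𝒞 × 𝒜 × 𝒵 × 𝒴 → 𝒵) ⁻¹' {z} =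
      projAZ ⁻¹' {(a, z)} := fun z => by
    ext ⟨c', a', z', y'⟩; simp
  simp only [this, h.measure_projAZ, ENNReal.tsum_mul_left, tsum_measure_singleton', mul_one]

/-- If the mediator law does not depend on the treatment, as under the potential laws, then `Z` is
independent of `(C, A)`. Conditioning on `Z` alone then leaves the law `π` of `(C, A)`, which is
what `condMean_projZ_of_const` uses. -/
theorem measure_projZ_of_const [IsProbabilityMeasure π] [∀ v, IsProbabilityMeasure (ρ v)]
    {l : Measure 𝒵} (h : IsAssembled J π (fun _ => l) ρ) (z : 𝒵) :
    J (projZ ⁻¹' {z}) = l {z} := by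
  rw [measure_eq_tsum_inter_preimage J projCA]
  have : ∀ v : 𝒞 × 𝒜, (projZ ⁻¹' {z}) ∩ (projCA : 𝒞 × 𝒜 × 𝒵 × 𝒴 → 𝒞 × 𝒜) ⁻¹' {v} =
      projCAZ ⁻¹' {(v.1, v.2, z)} := fun v => by
    ext ⟨c', a', z', y'⟩; simp [Prod.ext_iff, and_comm, and_assoc]
  simp only [this, h.measure_projCAZ, ENNReal.tsum_mul_right, Prod.mk.eta,
    tsum_measure_singleton', one_mul]

variable [IsProbabilityMeasure J]

theorem condMean_projCAZ [∀ v, IsProbabilityMeasure (ρ v)] (h : IsAssembled J π κ ρ)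
    {v : 𝒞 × 𝒜 × 𝒵} (hv : J (projCAZ ⁻¹' {v}) ≠ 0) (f : 𝒞 × 𝒜 × 𝒵 × 𝒴 → ℝ) :
    condMean J projCAZ f v = ∫ y, f (v.1, v.2.1, v.2.2, y) ∂ρ v := by
  refine condMean_eq_integral (W := fun x => x.2.2.2) hv (fun y => ?_)
    (fun v y => f (v.1, v.2.1, v.2.2, y))
  obtain ⟨c, a, z⟩ := v
  rw [h.measure_projCAZ, ← h]
  congr 1
  ext ⟨c', a', z', y'⟩; simp [and_assoc]

theorem condMean_projCA [∀ v, IsProbabilityMeasure (ρ v)] [∀ a, IsProbabilityMeasure (κ a)]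
    (h : IsAssembled J π κ ρ) {v : 𝒞 × 𝒜} (hv : J (projCA ⁻¹' {v}) ≠ 0)
    (f : 𝒞 × 𝒜 × 𝒵 → ℝ) :
    condMean J projCA (fun x => f (projCAZ x)) v = ∫ z, f (v.1, v.2, z) ∂κ v.2 := by
  refine condMean_eq_integral (W := projZ) hv (fun z => ?_) (fun v z => f (v.1, v.2, z))
  obtain ⟨c, a⟩ := v
  rw [h.measure_projCA, ← h.measure_projCAZ]
  congr 1
  ext ⟨c', a', z', y'⟩; simp [and_assoc]

theorem condMean_projA [∀ v, IsProbabilityMeasure (ρ v)] [∀ a, IsProbabilityMeasure (κ a)]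
    (h : IsAssembled J π κ ρ) {a : 𝒜} (hv : J (projA ⁻¹' {a}) ≠ 0) (f : 𝒜 × 𝒵 → ℝ) :
    condMean J projA (fun x => f (projAZ x)) a = ∫ z, f (a, z) ∂κ a := by
  refine condMean_eq_integral (W := projZ) hv (fun z => ?_) (fun v z => f (v, z))
  rw [h.measure_projA, ← h.measure_projAZ]
  congr 1
  ext ⟨c', a', z', y'⟩; simp

theorem condMean_projZ_of_const [IsProbabilityMeasure π] [∀ v, IsProbabilityMeasure (ρ v)]
    {l : Measure 𝒵} (h : IsAssembled J π (fun _ => l) ρ) {z : 𝒵}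
    (hv : J (projZ ⁻¹' {z}) ≠ 0) (f : 𝒞 × 𝒜 × 𝒵 → ℝ) :
    condMean J projZ (fun x => f (projCAZ x)) z = ∫ w, f (w.1, w.2, z) ∂π := by
  refine condMean_eq_integral (W := projCA) hv (fun w => ?_) (fun z w => f (w.1, w.2, z))
  rw [h.measure_projZ_of_const, mul_comm, ← Prod.mk.eta (p := w), ← h.measure_projCAZ]
  congr 1
  ext ⟨c', a', z', y'⟩; simp [Prod.ext_iff, and_comm, and_assoc]

theorem map_projCA [∀ v, IsProbabilityMeasure (ρ v)] [∀ a, IsProbabilityMeasure (κ a)]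
    (h : IsAssembled J π κ ρ) : J.map projCA = π :=
  Measure.ext_of_singleton fun v => by
    rw [Measure.map_apply .of_discrete (measurableSet_singleton v), h.measure_projCA]

theorem map_projZ_of_const [IsProbabilityMeasure π] [∀ v, IsProbabilityMeasure (ρ v)]
    {l : Measure 𝒵} (h : IsAssembled J π (fun _ => l) ρ) : J.map projZ = l :=
  Measure.ext_of_singleton fun z => by
    rw [Measure.map_apply .of_discrete (measurableSet_singleton z), h.measure_projZ_of_const]

end IsAssembled

end assembled

/-! ### Factorization of the laws of the observed and potential data -/

/-- Conditional independence with denominators cleared; in this form it also holds for a null event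
`s`. -/
theorem ProbabilityTheory.IndepFun.measure_inter_mul {Ω α β : Type*} [MeasurableSpace Ω]
    [MeasurableSpace α] [MeasurableSpace β] {μ : Measure Ω} [IsFiniteMeasure μ] {s : Set Ω}
    (hs : MeasurableSet s) {X : Ω → α} {W : Ω → β} (h : IndepFun X W (μ[|s])) {a : Set α}
    {b : Set β} (ha : MeasurableSet a) (hb : MeasurableSet b) :
    μ (s ∩ (X ⁻¹' a ∩ W ⁻¹' b)) * μ s = μ (s ∩ X ⁻¹' a) * μ (s ∩ W ⁻¹' b) := by
  by_cases h0 : μ s = 0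
  · have h1 : μ (s ∩ X ⁻¹' a) = 0 := measure_mono_null Set.inter_subset_left h0
    rw [h0, h1]; simp
  have h2 := h.measure_inter_preimage_eq_mul a b ha hb
  rw [cond_apply hs, cond_apply hs, cond_apply hs] at h2
  have ht := measure_ne_top μ s
  have e1 : ∀ x : ENNReal, μ s * ((μ s)⁻¹ * x) = x := fun x => by
    rw [← mul_assoc, ENNReal.mul_inv_cancel h0 ht, one_mul]
  calc μ (s ∩ (X ⁻¹' a ∩ W ⁻¹' b)) * μ s
      = μ s * (μ s * ((μ s)⁻¹ * μ (s ∩ (X ⁻¹' a ∩ W ⁻¹' b)))) := by rw [e1, mul_comm]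
    _ = μ s * ((μ s)⁻¹ * μ (s ∩ X ⁻¹' a)) * (μ s * ((μ s)⁻¹ * μ (s ∩ W ⁻¹' b))) := by
        rw [h2]; ring
    _ = _ := by rw [e1, e1]

namespace CausalModel

variable {𝒞 𝒜 𝒵 : Type u} {𝒴 : Set ℝ} [MeasurableSpace 𝒞] [MeasurableSpace 𝒜] [MeasurableSpace 𝒵]

/-- The law of `(C, A)`. -/
def lawCA (M : CausalModel 𝒞 𝒜 𝒵 𝒴) : Measure (𝒞 × 𝒜) := M.μ.map fun ω => (M.C ω, M.A ω)

/-- The law of the potential mediator `Z(b)`. -/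
def lawZ (M : CausalModel 𝒞 𝒜 𝒵 𝒴) (b : 𝒜) : Measure 𝒵 := M.μ.map (M.Zpot b)

/-- The conditional law of the outcome given `C`, `A`, `Z`. -/
def lawY (M : CausalModel 𝒞 𝒜 𝒵 𝒴) (v : 𝒞 × 𝒜 × 𝒵) : Measure 𝒴 :=
  (M.μ[|{ω | M.A ω = v.2.1 ∧ M.Z ω = v.2.2 ∧ M.C ω = v.1}]).map M.Y

variable (M : CausalModel 𝒞 𝒜 𝒵 𝒴)

theorem measurable_CA : Measurable fun ω => (M.C ω, M.A ω) :=
  M.measurable_C.prodMk M.measurable_A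

theorem measurable_obs : Measurable fun ω => (M.C ω, M.A ω, M.Z ω, M.Y ω) :=
  M.measurable_C.prodMk (M.measurable_A.prodMk (M.measurable_Z.prodMk M.measurable_Y))

instance : IsProbabilityMeasure M.lawCA :=
  Measure.isProbabilityMeasure_map M.measurable_CA.aemeasurable

instance (b : 𝒜) : IsProbabilityMeasure (M.lawZ b) :=
  Measure.isProbabilityMeasure_map (M.measurable_Zpot b).aemeasurable

instance : IsProbabilityMeasure M.obsLaw :=
  Measure.isProbabilityMeasure_map M.measurable_obs.aemeasurable

variable [MeasurableSingletonClass 𝒞] [MeasurableSingletonClass 𝒜] [MeasurableSingletonClass 𝒵]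

theorem measurableSet_C (c : 𝒞) : MeasurableSet {ω | M.C ω = c} :=
  M.measurable_C (measurableSet_singleton c)

theorem measurableSet_A (a : 𝒜) : MeasurableSet {ω | M.A ω = a} :=
  M.measurable_A (measurableSet_singleton a)

theorem measurableSet_Z (z : 𝒵) : MeasurableSet {ω | M.Z ω = z} :=
  M.measurable_Z (measurableSet_singleton z)

theorem measurableSet_AZC (a : 𝒜) (z : 𝒵) (c : 𝒞) :
    MeasurableSet {ω | M.A ω = a ∧ M.Z ω = z ∧ M.C ω = c} :=
  (M.measurableSet_A a).inter ((M.measurableSet_Z z).inter (M.measurableSet_C c))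

variable [Countable 𝒵]

theorem measurable_Yout (b : 𝒜) : Measurable (M.Yout b) := by
  intro s hs
  have : M.Yout b ⁻¹' s = ⋃ z, {ω | M.Zpot b ω = z} ∩ M.Ypot b z ⁻¹' s := by
    ext ω; simp [Yout]
  rw [this]
  exact MeasurableSet.iUnion fun z =>
    (M.measurable_Zpot b (measurableSet_singleton z)).inter (M.measurable_Ypot b z hs)

theorem measurable_pot (b : 𝒜) : Measurable fun ω => (M.C ω, M.A ω, M.Zpot b ω, M.Yout b ω) :=
  M.measurable_C.prodMk (M.measurable_A.prodMk ((M.measurable_Zpot b).prodMk (M.measurable_Yout b)))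

instance (b : 𝒜) : IsProbabilityMeasure (M.potLaw b) :=
  Measure.isProbabilityMeasure_map (M.measurable_pot b).aemeasurable

omit [Countable 𝒵]

theorem lawCA_singleton (c : 𝒞) (a : 𝒜) :
    M.lawCA {(c, a)} = M.μ {ω | M.A ω = a ∧ M.C ω = c} := by
  rw [lawCA, Measure.map_apply M.measurable_CA (measurableSet_singleton _)]
  congr 1; ext ω; simp [and_comm]

theorem lawZ_singleton (b : 𝒜) (z : 𝒵) : M.lawZ b {z} = M.μ {ω | M.Zpot b ω = z} := by
  rw [lawZ, Measure.map_apply (M.measurable_Zpot b) (measurableSet_singleton _)]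
  rfl

theorem obsLaw_singleton (c : 𝒞) (a : 𝒜) (z : 𝒵) (y : 𝒴) :
    M.obsLaw {(c, a, z, y)} =
      M.μ ({ω | M.A ω = a ∧ M.Z ω = z ∧ M.C ω = c} ∩ M.Y ⁻¹' {y}) := by
  rw [obsLaw, Measure.map_apply M.measurable_obs (measurableSet_singleton _)]
  congr 1; ext ω; simp; tauto

namespace IsFrontTwoDoor

variable {M} (hM : M.IsFrontTwoDoor)
include hM

/-- Positivity speaks of `Y(a)`; taken at `a' = a`, consistency turns it into a statement about the
observed outcome. -/
theorem obsLaw_ne_zero (x : 𝒞 × 𝒜 × 𝒵 × 𝒴) : M.obsLaw {x} ≠ 0 := by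
  obtain ⟨c, a, z, y⟩ := x
  rw [obsLaw_singleton]
  refine ((hM.positivity a y a z c).trans_le (measure_mono_ae ?_)).ne'
  filter_upwards [hM.consistency.outcome a] with ω hω h
  obtain ⟨h1, h2, h3, h4⟩ := h
  exact ⟨⟨h2, h3, h4⟩, (hω h2).trans h1⟩

theorem measure_AZC_ne_zero (a : 𝒜) (z : 𝒵) (c : 𝒞) :
    M.μ {ω | M.A ω = a ∧ M.Z ω = z ∧ M.C ω = c} ≠ 0 := by
  -- A sample point supplies an outcome value, without which positivity would say nothing.
  obtain ⟨ω⟩ : Nonempty M.Ω := nonempty_of_isProbabilityMeasure M.μ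
  have h := hM.obsLaw_ne_zero (c, a, z, M.Y ω)
  rw [obsLaw_singleton] at h
  exact fun h0 => h (measure_mono_null Set.inter_subset_left h0)

theorem isProbabilityMeasure_lawY (v : 𝒞 × 𝒜 × 𝒵) : IsProbabilityMeasure (M.lawY v) :=
  have := cond_isProbabilityMeasure (hM.measure_AZC_ne_zero v.2.1 v.2.2 v.1)
  Measure.isProbabilityMeasure_map M.measurable_Y.aemeasurable

theorem lawCA_ne_zero (v : 𝒞 × 𝒜) : M.lawCA {v} ≠ 0 := by
  obtain ⟨c, a⟩ := v
  obtain ⟨ω⟩ : Nonempty M.Ω := nonempty_of_isProbabilityMeasure M.μ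
  rw [lawCA_singleton]
  exact fun h0 => hM.measure_AZC_ne_zero a (M.Z ω) c
    (measure_mono_null (fun _ h => ⟨h.1, h.2.2⟩ : _ ⊆ {ω | M.A ω = a ∧ M.C ω = c}) h0)

theorem measure_A_ne_zero (a : 𝒜) : M.μ {ω | M.A ω = a} ≠ 0 := by
  obtain ⟨ω⟩ : Nonempty M.Ω := nonempty_of_isProbabilityMeasure M.μ
  exact fun h0 => hM.measure_AZC_ne_zero a (M.Z ω) (M.C ω)
    (measure_mono_null (fun _ h => h.1 : _ ⊆ {ω | M.A ω = a}) h0)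

theorem measure_A_inter_Zpot (a b : 𝒜) (z : 𝒵) :
    M.μ ({ω | M.A ω = a} ∩ M.Zpot b ⁻¹' {z}) = M.μ {ω | M.A ω = a} * M.lawZ b {z} := by
  have := (hM.frontDoor.mediator_indep b).measure_inter_preimage_eq_mul {z} {a}
    (measurableSet_singleton _) (measurableSet_singleton _)
  rw [Set.inter_comm, lawZ_singleton, mul_comm]
  exact this

/-- Contraction of independences: `Z(b)` is independent of `A`, and of `C` given `A`, hence of the
pair. -/
theorem measure_CA_inter_Zpot (c : 𝒞) (a b : 𝒜) (z : 𝒵) :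
    M.μ ({ω | M.A ω = a ∧ M.C ω = c} ∩ M.Zpot b ⁻¹' {z}) = M.lawCA {(c, a)} * M.lawZ b {z} := by
  have h1 := (hM.mediator_covariates b a).measure_inter_mul (M.measurableSet_A a)
    (measurableSet_singleton z) (measurableSet_singleton c)
  have h2 := hM.measure_A_inter_Zpot a b z
  have e2 : {ω | M.A ω = a} ∩ (M.Zpot b ⁻¹' {z} ∩ M.C ⁻¹' {c}) =
      {ω | M.A ω = a ∧ M.C ω = c} ∩ M.Zpot b ⁻¹' {z} := by ext ω; simp; tauto
  have e3 : {ω | M.A ω = a} ∩ M.C ⁻¹' {c} = {ω | M.A ω = a ∧ M.C ω = c} := rfl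
  rw [h2, e2, e3, ← lawCA_singleton, mul_comm, mul_assoc] at h1
  rw [(ENNReal.mul_right_inj (hM.measure_A_ne_zero a) (measure_ne_top _ _)).1 h1, mul_comm]

theorem measure_AZC (a : 𝒜) (z : 𝒵) (c : 𝒞) :
    M.μ {ω | M.A ω = a ∧ M.Z ω = z ∧ M.C ω = c} = M.lawCA {(c, a)} * M.lawZ a {z} := by
  rw [← hM.measure_CA_inter_Zpot]
  refine measure_congr ?_
  filter_upwards [hM.consistency.mediator a] with ω hω
  refine propext (?_ : (M.A ω = a ∧ M.Z ω = z ∧ M.C ω = c) ↔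
    ((M.A ω = a ∧ M.C ω = c) ∧ M.Zpot a ω = z))
  constructor
  · rintro ⟨h1, h2, h3⟩; exact ⟨⟨h1, h3⟩, (hω h1).symm.trans h2⟩
  · rintro ⟨⟨h1, h3⟩, h2⟩; exact ⟨h1, (hω h1).trans h2, h3⟩

theorem lawZ_ne_zero (b : 𝒜) (z : 𝒵) : M.lawZ b {z} ≠ 0 := by
  obtain ⟨ω⟩ : Nonempty M.Ω := nonempty_of_isProbabilityMeasure M.μ
  have := hM.measure_AZC_ne_zero b z (M.C ω)
  rw [hM.measure_AZC] at this
  exact right_ne_zero_of_mul this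

theorem obsLaw_isAssembled : IsAssembled M.obsLaw M.lawCA M.lawZ M.lawY := by
  intro c a z y
  have ht := measure_ne_top M.μ {ω | M.A ω = a ∧ M.Z ω = z ∧ M.C ω = c}
  rw [obsLaw_singleton, ← hM.measure_AZC, lawY,
    Measure.map_apply M.measurable_Y (measurableSet_singleton y),
    cond_apply (M.measurableSet_AZC a z c), ← mul_assoc,
    ENNReal.mul_inv_cancel (hM.measure_AZC_ne_zero a z c) ht, one_mul]

/-- Given `A = a, C = c`, the outcome `Y(b, z)` equals `Y(a, z)`, which is independent of `Z(a)`; so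
the event `Z(a) = z` may be added to the conditioning, where by consistency `Y(a, z)` is the
observed outcome. -/
theorem measure_CA_inter_Ypot (c : 𝒞) (a b : 𝒜) (z : 𝒵) (y : 𝒴) :
    M.μ ({ω | M.A ω = a ∧ M.C ω = c} ∩ M.Ypot b z ⁻¹' {y}) =
      M.lawCA {(c, a)} * M.lawY (c, a, z) {y} := by
  have h0 : M.μ ({ω | M.A ω = a ∧ M.C ω = c} ∩ M.Ypot b z ⁻¹' {y}) =
      M.μ ({ω | M.A ω = a ∧ M.C ω = c} ∩ M.Ypot a z ⁻¹' {y}) := by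
    refine measure_congr ?_
    filter_upwards [hM.frontDoor.no_direct_effect b a z] with ω hω
    refine propext (?_ : (_ ∧ M.Ypot b z ω = y) ↔ (_ ∧ M.Ypot a z ω = y))
    rw [hω]
  have hs : MeasurableSet ((fun ω => (M.A ω, M.C ω)) ⁻¹' {(a, c)}) :=
    (M.measurable_A.prodMk M.measurable_C) (measurableSet_singleton _)
  have e1 : (fun ω => (M.A ω, M.C ω)) ⁻¹' {(a, c)} = {ω | M.A ω = a ∧ M.C ω = c} := by
    ext ω; simp
  have h1 := (hM.twoDoor.outcome_indep a a z (a, c)).measure_inter_mul hs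
    (measurableSet_singleton y) (measurableSet_singleton z)
  rw [e1, ← lawCA_singleton, hM.measure_CA_inter_Zpot] at h1
  have h2 : M.μ ({ω | M.A ω = a ∧ M.C ω = c} ∩ (M.Ypot a z ⁻¹' {y} ∩ M.Zpot a ⁻¹' {z})) =
      M.obsLaw {(c, a, z, y)} := by
    rw [obsLaw_singleton]
    refine measure_congr ?_
    filter_upwards [hM.consistency.mediator a, hM.consistency.joint a z] with ω hω hω'
    refine propext (?_ : ((M.A ω = a ∧ M.C ω = c) ∧ (M.Ypot a z ω = y ∧ M.Zpot a ω = z)) ↔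
      ((M.A ω = a ∧ M.Z ω = z ∧ M.C ω = c) ∧ M.Y ω = y))
    constructor
    · rintro ⟨⟨h1, h2⟩, h3, h4⟩
      have h5 := (hω h1).trans h4
      exact ⟨⟨h1, h5, h2⟩, (hω' h1 h5).trans h3⟩
    · rintro ⟨⟨h1, h2, h3⟩, h4⟩
      exact ⟨⟨h1, h3⟩, (hω' h1 h2).symm.trans h4, (hω h1).symm.trans h2⟩
  rw [h2, hM.obsLaw_isAssembled] at h1
  rw [h0]
  have hne : M.lawCA {(c, a)} * M.lawZ a {z} ≠ 0 :=
    mul_ne_zero (hM.lawCA_ne_zero _) (hM.lawZ_ne_zero _ _)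
  refine (ENNReal.mul_right_inj hne
    (ENNReal.mul_ne_top (measure_ne_top _ _) (measure_ne_top _ _))).1 ?_
  rw [mul_comm, ← h1]
  ring

/-- The identification of the causal effect. On `Z(b) = z` the outcome `Y(b)` is `Y(b, z)`,
independent of `Z(b)` given `(A, C)`. The outcome law is thus the observed one at the actual
treatment `a`, not at `b`; only the mediator factor refers to `b`. -/
theorem potLaw_isAssembled [Countable 𝒵] (b : 𝒜) :
    IsAssembled (M.potLaw b) M.lawCA (fun _ => M.lawZ b) M.lawY := by
  intro c a z y
  rw [potLaw, Measure.map_apply (M.measurable_pot b) (measurableSet_singleton _)]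
  have hs : MeasurableSet ((fun ω => (M.A ω, M.C ω)) ⁻¹' {(a, c)}) :=
    (M.measurable_A.prodMk M.measurable_C) (measurableSet_singleton _)
  have e1 : (fun ω => (M.A ω, M.C ω)) ⁻¹' {(a, c)} = {ω | M.A ω = a ∧ M.C ω = c} := by
    ext ω; simp
  have h1 := (hM.twoDoor.outcome_indep b b z (a, c)).measure_inter_mul hs
    (measurableSet_singleton y) (measurableSet_singleton z)
  rw [e1, ← lawCA_singleton, hM.measure_CA_inter_Zpot, hM.measure_CA_inter_Ypot] at h1
  have e2 : (fun ω => (M.C ω, M.A ω, M.Zpot b ω, M.Yout b ω)) ⁻¹' {(c, a, z, y)} =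
      {ω | M.A ω = a ∧ M.C ω = c} ∩ (M.Ypot b z ⁻¹' {y} ∩ M.Zpot b ⁻¹' {z}) := by
    ext ω
    simp only [Set.mem_preimage, Set.mem_singleton_iff, Prod.mk.injEq, Yout, Set.mem_inter_iff,
      Set.mem_ofPred_eq]
    constructor
    · rintro ⟨rfl, rfl, rfl, rfl⟩; exact ⟨⟨rfl, rfl⟩, rfl, rfl⟩
    · rintro ⟨⟨rfl, rfl⟩, rfl, rfl⟩; exact ⟨rfl, rfl, rfl, rfl⟩
  rw [e2]
  refine (ENNReal.mul_right_inj (hM.lawCA_ne_zero (c, a)) (measure_ne_top _ _)).1 ?_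
  rw [mul_comm, h1]
  ring

theorem lawY_ne_zero (v : 𝒞 × 𝒜 × 𝒵) (y : 𝒴) : M.lawY v {y} ≠ 0 := by
  obtain ⟨c, a, z⟩ := v
  have := hM.obsLaw_ne_zero (c, a, z, y)
  rw [hM.obsLaw_isAssembled] at this
  exact right_ne_zero_of_mul this

theorem potLaw_ne_zero [Countable 𝒵] (b : 𝒜) (x : 𝒞 × 𝒜 × 𝒵 × 𝒴) : M.potLaw b {x} ≠ 0 := by
  obtain ⟨c, a, z, y⟩ := x
  rw [hM.potLaw_isAssembled]
  exact mul_ne_zero (mul_ne_zero (hM.lawCA_ne_zero _) (hM.lawZ_ne_zero _ _)) (hM.lawY_ne_zero _ _)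

end IsFrontTwoDoor

/-! ### The probabilities and conditional moments of the observed data in terms of these laws -/

theorem pAC_eq (a : 𝒜) (c : 𝒞) : M.pAC a c = M.lawCA.real {(c, a)} := by
  rw [pAC, measureReal_def, measureReal_def, lawCA_singleton]

theorem pC_eq (c : 𝒞) : M.pC c = M.lawCA.real (Prod.fst ⁻¹' {c}) := by
  rw [pC, measureReal_def, measureReal_def, lawCA,
    Measure.map_apply M.measurable_CA (measurable_fst (measurableSet_singleton c))]
  rfl

theorem pA_eq (a : 𝒜) : M.pA a = M.lawCA.real (Prod.snd ⁻¹' {a}) := by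
  rw [pA, measureReal_def, measureReal_def, lawCA,
    Measure.map_apply M.measurable_CA (measurable_snd (measurableSet_singleton a))]
  rfl

theorem pAgivenC_eq (a : 𝒜) (c : 𝒞) : M.pAgivenC a c = M.pAC a c / M.pC c := by
  rw [pAgivenC, measureReal_def, cond_apply (M.measurableSet_C c), ENNReal.toReal_mul,
    ENNReal.toReal_inv, pAC, pC, measureReal_def, measureReal_def, div_eq_inv_mul]
  congr 3
  ext ω; simp [and_comm]

namespace IsFrontTwoDoor

variable {M} (hM : M.IsFrontTwoDoor)
include hM

theorem pZgivenA_eq (z : 𝒵) (a : 𝒜) : M.pZgivenA z a = (M.lawZ a).real {z} := by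
  rw [pZgivenA, measureReal_def, cond_apply (M.measurableSet_A a), measureReal_def]
  congr 1
  have : M.μ ({ω | M.A ω = a} ∩ {ω | M.Z ω = z}) =
      M.μ ({ω | M.A ω = a} ∩ M.Zpot a ⁻¹' {z}) := by
    refine measure_congr ?_
    filter_upwards [hM.consistency.mediator a] with ω hω
    refine propext (?_ : (M.A ω = a ∧ M.Z ω = z) ↔ (M.A ω = a ∧ M.Zpot a ω = z))
    exact and_congr_right fun h => by rw [hω h]
  rw [this, hM.measure_A_inter_Zpot, ← mul_assoc,
    ENNReal.inv_mul_cancel (hM.measure_A_ne_zero a) (measure_ne_top _ _), one_mul]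

/-- Together with `pZgivenA_eq`: the covariates drop out of the mediator law, which is why φ_td and
φ_{fd,td} share their outcome component and their component in `(C, A)`. -/
theorem pZgivenAC_eq (z : 𝒵) (a : 𝒜) (c : 𝒞) : M.pZgivenAC z a c = (M.lawZ a).real {z} := by
  rw [pZgivenAC, measureReal_def,
    cond_apply (show MeasurableSet {ω | M.A ω = a ∧ M.C ω = c} from
      (M.measurableSet_A a).inter (M.measurableSet_C c)), measureReal_def]
  congr 1
  have : {ω | M.A ω = a ∧ M.C ω = c} ∩ {ω | M.Z ω = z} =
      {ω | M.A ω = a ∧ M.Z ω = z ∧ M.C ω = c} := by ext ω; simp; tauto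
  rw [← lawCA_singleton, this, hM.measure_AZC, ← mul_assoc,
    ENNReal.inv_mul_cancel (hM.lawCA_ne_zero _) (measure_ne_top _ _), one_mul]

omit hM in
omit [MeasurableSingletonClass 𝒞] [MeasurableSingletonClass 𝒜] [MeasurableSingletonClass 𝒵] in
theorem _root_.CausalModel.pYgivenAZC_eq (y : 𝒴) (a : 𝒜) (z : 𝒵) (c : 𝒞) :
    M.pYgivenAZC y a z c = (M.lawY (c, a, z)).real {y} := by
  rw [pYgivenAZC, measureReal_def, measureReal_def, lawY,
    Measure.map_apply M.measurable_Y (measurableSet_singleton y)]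
  rfl

omit hM in
omit [MeasurableSingletonClass 𝒞] [MeasurableSingletonClass 𝒜] [MeasurableSingletonClass 𝒵] in
theorem _root_.CausalModel.EY_eq (a : 𝒜) (z : 𝒵) (c : 𝒞) :
    M.EY a z c = ∫ y, (y : ℝ) ∂M.lawY (c, a, z) := by
  rw [EY, lawY, integral_map M.measurable_Y.aemeasurable
    measurable_subtype_coe.aestronglyMeasurable]

omit hM in
omit [MeasurableSingletonClass 𝒞] [MeasurableSingletonClass 𝒜] [MeasurableSingletonClass 𝒵] in
theorem _root_.CausalModel.varY_eq (a : 𝒜) (z : 𝒵) (c : 𝒞) :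
    M.varY a z c = variance (fun y : 𝒴 => (y : ℝ)) (M.lawY (c, a, z)) := by
  rw [varY, lawY, variance_map measurable_subtype_coe.aemeasurable M.measurable_Y.aemeasurable]
  rfl

theorem obsLaw_real_eq (c : 𝒞) (a : 𝒜) (z : 𝒵) (y : 𝒴) : M.obsLaw.real {(c, a, z, y)} =
    M.pYgivenAZC y a z c * M.pZgivenA z a * M.pAgivenC a c * M.pC c := by
  have hC : M.pC c ≠ 0 := by
    rw [pC_eq, measureReal_ne_zero_iff]
    exact fun h => hM.lawCA_ne_zero (c, a) (measure_mono_null (by simp) h)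
  rw [pYgivenAZC_eq, hM.pZgivenA_eq, pAgivenC_eq, pAC_eq, measureReal_def, hM.obsLaw_isAssembled,
    ENNReal.toReal_mul, ENNReal.toReal_mul, ← measureReal_def, ← measureReal_def,
    ← measureReal_def]
  field_simp

end IsFrontTwoDoor

end CausalModel

/-! ### Transfer of moments to conditional laws -/

section condLaw

variable {X γ δ : Type*} [MeasurableSpace X] [MeasurableSingletonClass X] [Countable X]
  [MeasurableSpace δ] [MeasurableSingletonClass δ] [Countable δ]

theorem memLp_of_condLaw {J : Measure X} [IsFiniteMeasure J] {V : X → γ} {W : X → δ} {v : γ}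
    {l : Measure δ} (hv : J (V ⁻¹' {v}) ≠ 0)
    (h : ∀ w, J (V ⁻¹' {v} ∩ W ⁻¹' {w}) = J (V ⁻¹' {v}) * l {w}) {F : γ → δ → ℝ} {p : ENNReal}
    (hF : MemLp (fun x => F (V x) (W x)) p J) : MemLp (F v) p l := by
  rw [← map_cond_eq hv h, memLp_map_measure_iff
    (Measurable.of_discrete (f := F v)).aestronglyMeasurable
    (Measurable.of_discrete (f := W)).aemeasurable]
  have h1 : MemLp (fun x => F (V x) (W x)) p (J[|V ⁻¹' {v}]) :=
    (hF.restrict _).smul_measure (ENNReal.inv_ne_top.2 hv)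
  refine h1.ae_eq ?_
  filter_upwards [ae_cond_mem (μ := J) (s := V ⁻¹' {v}) .of_discrete] with x hx
  simp only [Set.mem_preimage, Set.mem_singleton_iff] at hx
  simp [hx]

theorem integrable_of_summable_mass {P : Measure X} [IsFiniteMeasure P] {f : X → ℝ}
    (h : Summable fun x => P.real {x} * f x) : Integrable f P := by
  refine ⟨(Measurable.of_discrete (f := f)).aestronglyMeasurable, ?_⟩
  rw [hasFiniteIntegral_iff_norm, lintegral_countable']
  have h1 : ∀ x, ENNReal.ofReal ‖f x‖ * P {x} = ENNReal.ofReal ‖P.real {x} * f x‖ := fun x => by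
    rw [norm_mul, Real.norm_of_nonneg measureReal_nonneg, mul_comm,
      ENNReal.ofReal_mul measureReal_nonneg, ofReal_measureReal]
  simp_rw [h1]
  rw [← ENNReal.ofReal_tsum_of_nonneg (fun _ => norm_nonneg _) h.norm]
  exact ENNReal.ofReal_lt_top

end condLaw

section assembledMoments

variable {𝒞 𝒜 𝒵 𝒴 : Type*} [MeasurableSpace 𝒞] [MeasurableSpace 𝒜] [MeasurableSpace 𝒵]
  [MeasurableSpace 𝒴]
  [MeasurableSingletonClass 𝒞] [MeasurableSingletonClass 𝒜] [MeasurableSingletonClass 𝒵]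
  [MeasurableSingletonClass 𝒴] [Countable 𝒞] [Countable 𝒜] [Countable 𝒵] [Countable 𝒴]

namespace IsAssembled

variable {J : Measure (𝒞 × 𝒜 × 𝒵 × 𝒴)} {π : Measure (𝒞 × 𝒜)} {κ : 𝒜 → Measure 𝒵}
    {ρ : 𝒞 × 𝒜 × 𝒵 → Measure 𝒴} [IsProbabilityMeasure J] {p : ENNReal}

theorem memLp_lawY [∀ v, IsProbabilityMeasure (ρ v)] (h : IsAssembled J π κ ρ)
    {v : 𝒞 × 𝒜 × 𝒵} (hv : J (projCAZ ⁻¹' {v}) ≠ 0) {f : 𝒞 × 𝒜 × 𝒵 × 𝒴 → ℝ} (hf : MemLp f p J) :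
    MemLp (fun y => f (v.1, v.2.1, v.2.2, y)) p (ρ v) := by
  refine memLp_of_condLaw (W := fun x : 𝒞 × 𝒜 × 𝒵 × 𝒴 => x.2.2.2) hv (fun y => ?_)
    (F := fun v y => f (v.1, v.2.1, v.2.2, y)) hf
  obtain ⟨c, a, z⟩ := v
  rw [h.measure_projCAZ, ← h]
  congr 1
  ext ⟨c', a', z', y'⟩; simp [and_assoc]

theorem memLp_lawZ [∀ v, IsProbabilityMeasure (ρ v)] [∀ a, IsProbabilityMeasure (κ a)]
    (h : IsAssembled J π κ ρ) {v : 𝒞 × 𝒜} (hv : J (projCA ⁻¹' {v}) ≠ 0)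
    {f : 𝒞 × 𝒜 × 𝒵 → ℝ} (hf : MemLp (fun x => f (projCAZ x)) p J) :
    MemLp (fun z => f (v.1, v.2, z)) p (κ v.2) := by
  refine memLp_of_condLaw (W := projZ) hv (fun z => ?_) (F := fun v z => f (v.1, v.2, z)) hf
  obtain ⟨c, a⟩ := v
  rw [h.measure_projCA, ← h.measure_projCAZ]
  congr 1
  ext ⟨c', a', z', y'⟩; simp [and_assoc]

theorem memLp_lawZ_of_projAZ [∀ v, IsProbabilityMeasure (ρ v)] [∀ a, IsProbabilityMeasure (κ a)]
    (h : IsAssembled J π κ ρ) {a : 𝒜} (hv : J (projA ⁻¹' {a}) ≠ 0) {f : 𝒜 × 𝒵 → ℝ}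
    (hf : MemLp (fun x => f (projAZ x)) p J) : MemLp (fun z => f (a, z)) p (κ a) := by
  refine memLp_of_condLaw (W := projZ) hv (fun z => ?_) (F := fun v z => f (v, z)) hf
  rw [h.measure_projA, ← h.measure_projAZ]
  congr 1
  ext ⟨c', a', z', y'⟩; simp

theorem memLp_lawCA_of_const [IsProbabilityMeasure π] [∀ v, IsProbabilityMeasure (ρ v)]
    {l : Measure 𝒵} (h : IsAssembled J π (fun _ => l) ρ) {z : 𝒵}
    (hv : J (projZ ⁻¹' {z}) ≠ 0) {f : 𝒞 × 𝒜 × 𝒵 → ℝ}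
    (hf : MemLp (fun x => f (projCAZ x)) p J) : MemLp (fun w => f (w.1, w.2, z)) p π := by
  refine memLp_of_condLaw (W := projCA) hv (fun w => ?_) (F := fun z w => f (w.1, w.2, z)) hf
  rw [h.measure_projZ_of_const, mul_comm, ← Prod.mk.eta (p := w), ← h.measure_projCAZ]
  congr 1
  ext ⟨c', a', z', y'⟩; simp [Prod.ext_iff, and_comm, and_assoc]

theorem integral_projCA [∀ v, IsProbabilityMeasure (ρ v)] [∀ a, IsProbabilityMeasure (κ a)]
    (h : IsAssembled J π κ ρ) (f : 𝒞 × 𝒜 → ℝ) : ∫ x, f (projCA x) ∂J = ∫ w, f w ∂π := by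
  rw [← h.map_projCA]
  exact (integral_map (Measurable.of_discrete (f := projCA)).aemeasurable
    (Measurable.of_discrete (f := f)).aestronglyMeasurable).symm

theorem memLp_projCA_iff [∀ v, IsProbabilityMeasure (ρ v)] [∀ a, IsProbabilityMeasure (κ a)]
    (h : IsAssembled J π κ ρ) {f : 𝒞 × 𝒜 → ℝ} :
    MemLp (fun x => f (projCA x)) p J ↔ MemLp f p π := by
  rw [← h.map_projCA]
  exact (memLp_map_measure_iff (Measurable.of_discrete (f := f)).aestronglyMeasurable
    (Measurable.of_discrete (f := projCA)).aemeasurable).symm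

theorem integral_projZ_of_const [IsProbabilityMeasure π] [∀ v, IsProbabilityMeasure (ρ v)]
    {l : Measure 𝒵} (h : IsAssembled J π (fun _ => l) ρ) (f : 𝒵 → ℝ) :
    ∫ x, f (projZ x) ∂J = ∫ z, f z ∂l := by
  rw [← h.map_projZ_of_const]
  exact (integral_map (Measurable.of_discrete (f := projZ)).aemeasurable
    (Measurable.of_discrete (f := f)).aestronglyMeasurable).symm

theorem memLp_projZ_of_const_iff [IsProbabilityMeasure π] [∀ v, IsProbabilityMeasure (ρ v)]
    {l : Measure 𝒵} (h : IsAssembled J π (fun _ => l) ρ) {f : 𝒵 → ℝ} :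
    MemLp (fun x => f (projZ x)) p J ↔ MemLp f p l := by
  rw [← h.map_projZ_of_const]
  exact (memLp_map_measure_iff (Measurable.of_discrete (f := f)).aestronglyMeasurable
    (Measurable.of_discrete (f := projZ)).aemeasurable).symm

/-- The integral of a function of `(C, A, Z)` as a sum. -/
theorem integral_projCAZ [∀ v, IsProbabilityMeasure (ρ v)] (h : IsAssembled J π κ ρ)
    {f : 𝒞 × 𝒜 × 𝒵 → ℝ} (hf : Integrable (fun x => f (projCAZ x)) J) :
    (Summable fun v : 𝒞 × 𝒜 × 𝒵 => π.real {(v.1, v.2.1)} * (κ v.2.1).real {v.2.2} * f v) ∧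
    ∫ x, f (projCAZ x) ∂J =
      ∑' v : 𝒞 × 𝒜 × 𝒵, π.real {(v.1, v.2.1)} * (κ v.2.1).real {v.2.2} * f v := by
  have hmeas : AEMeasurable (projCAZ : 𝒞 × 𝒜 × 𝒵 × 𝒴 → 𝒞 × 𝒜 × 𝒵) J :=
    (Measurable.of_discrete (f := projCAZ)).aemeasurable
  have hfm : AEStronglyMeasurable f (J.map projCAZ) :=
    (Measurable.of_discrete (f := f)).aestronglyMeasurable
  have hf' : Integrable f (J.map projCAZ) := (integrable_map_measure hfm hmeas).2 hf
  have hmass : ∀ v : 𝒞 × 𝒜 × 𝒵, (J.map projCAZ).real {v} =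
      π.real {(v.1, v.2.1)} * (κ v.2.1).real {v.2.2} := fun ⟨c, a, z⟩ => by
    rw [measureReal_def, Measure.map_apply .of_discrete (measurableSet_singleton _),
      h.measure_projCAZ, ENNReal.toReal_mul]
    rfl
  have h1 := summable_mass_mul hf'
  have h2 := integral_eq_tsum_mass hf'
  rw [integral_map hmeas hfm] at h2
  simp only [hmass] at h1 h2
  exact ⟨h1, h2⟩

end IsAssembled

end assembledMoments

namespace CausalModel

variable {𝒞 𝒜 𝒵 : Type u} {𝒴 : Set ℝ} [MeasurableSpace 𝒞] [MeasurableSpace 𝒜] [MeasurableSpace 𝒵]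

/-! ### Outcome regressions -/

section regressions

variable (M : CausalModel 𝒞 𝒜 𝒵 𝒴)

/-- The mean of the outcome given `C`, `A`, `Z`. -/
def outReg (v : 𝒞 × 𝒜 × 𝒵) : ℝ := ∫ y, (y : ℝ) ∂M.lawY v

/-- The mean of the outcome when the mediator is set to `z`. -/
def medReg (z : 𝒵) : ℝ := ∫ w : 𝒞 × 𝒜, M.outReg (w.1, w.2, z) ∂M.lawCA

/-- The mean of the outcome given `C`, `A`, when the mediator is drawn as under treatment `b`. -/
def trtReg (b : 𝒜) (w : 𝒞 × 𝒜) : ℝ := ∫ z, M.outReg (w.1, w.2, z) ∂M.lawZ b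

/-- The mean of `Y(b)`. -/
def potMean (b : 𝒜) : ℝ := ∫ ω, (M.Yout b ω : ℝ) ∂M.μ

/-- The probability of the treatment level `a`. -/
def massA (a : 𝒜) : ℝ := M.lawCA.real (Prod.snd ⁻¹' {a})

theorem ACE_eq (a₁ a₀ : 𝒜) : M.ACE a₁ a₀ = M.potMean a₁ - M.potMean a₀ := rfl

variable [MeasurableSingletonClass 𝒞] [MeasurableSingletonClass 𝒜] [MeasurableSingletonClass 𝒵]
  [Countable 𝒞] [Countable 𝒜] [Countable 𝒵] [Countable 𝒴]

theorem integral_potLaw_outcome (b : 𝒜) : ∫ x, (x.2.2.2 : ℝ) ∂M.potLaw b = M.potMean b := by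
  rw [potLaw, integral_map (M.measurable_pot b).aemeasurable
    (Measurable.aestronglyMeasurable (by fun_prop))]
  rfl

theorem integral_potLaw_outcome_sq (b : 𝒜) :
    ∫ x, (x.2.2.2 : ℝ) ^ 2 ∂M.potLaw b = ∫ ω, (M.Yout b ω : ℝ) ^ 2 ∂M.μ := by
  rw [potLaw, integral_map (M.measurable_pot b).aemeasurable
    (Measurable.aestronglyMeasurable (by fun_prop))]

theorem memLp_potLaw_outcome_iff {b : 𝒜} {p : ENNReal} :
    MemLp (fun x : 𝒞 × 𝒜 × 𝒵 × 𝒴 => (x.2.2.2 : ℝ)) p (M.potLaw b) ↔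
      MemLp (fun ω => (M.Yout b ω : ℝ)) p M.μ := by
  rw [potLaw, memLp_map_measure_iff (Measurable.aestronglyMeasurable (by fun_prop))
    (M.measurable_pot b).aemeasurable]
  rfl

namespace IsFrontTwoDoor

variable {M} (hM : M.IsFrontTwoDoor)
include hM

theorem obs_projCAZ_ne (v : 𝒞 × 𝒜 × 𝒵) : M.obsLaw (projCAZ ⁻¹' {v}) ≠ 0 := by
  have := hM.isProbabilityMeasure_lawY
  obtain ⟨c, a, z⟩ := v
  rw [hM.obsLaw_isAssembled.measure_projCAZ]
  exact mul_ne_zero (hM.lawCA_ne_zero _) (hM.lawZ_ne_zero _ _)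

theorem obs_projCA_ne (v : 𝒞 × 𝒜) : M.obsLaw (projCA ⁻¹' {v}) ≠ 0 := by
  have := hM.isProbabilityMeasure_lawY
  rw [hM.obsLaw_isAssembled.measure_projCA]
  exact hM.lawCA_ne_zero _

theorem lawCA_snd_ne (a : 𝒜) : M.lawCA (Prod.snd ⁻¹' {a}) ≠ 0 := by
  obtain ⟨ω⟩ : Nonempty M.Ω := nonempty_of_isProbabilityMeasure M.μ
  exact fun h => hM.lawCA_ne_zero (M.C ω, a) (measure_mono_null (by simp) h)

theorem massA_pos (a : 𝒜) : 0 < M.massA a :=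
  measureReal_nonneg.lt_of_ne' ((measureReal_ne_zero_iff).2 (hM.lawCA_snd_ne a))

theorem lawZ_real_pos (a : 𝒜) (z : 𝒵) : 0 < (M.lawZ a).real {z} :=
  measureReal_nonneg.lt_of_ne' ((measureReal_ne_zero_iff).2 (hM.lawZ_ne_zero a z))

theorem lawCA_real_pos (w : 𝒞 × 𝒜) : 0 < M.lawCA.real {w} :=
  measureReal_nonneg.lt_of_ne' ((measureReal_ne_zero_iff).2 (hM.lawCA_ne_zero w))

theorem pC_pos (c : 𝒞) : 0 < M.pC c := by
  obtain ⟨ω⟩ : Nonempty M.Ω := nonempty_of_isProbabilityMeasure M.μ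
  rw [pC_eq]
  refine measureReal_nonneg.lt_of_ne' ((measureReal_ne_zero_iff).2 ?_)
  exact fun h => hM.lawCA_ne_zero (c, M.A ω) (measure_mono_null (by simp) h)

theorem obs_projA_ne (a : 𝒜) : M.obsLaw (projA ⁻¹' {a}) ≠ 0 := by
  have := hM.isProbabilityMeasure_lawY
  rw [hM.obsLaw_isAssembled.measure_projA]
  exact hM.lawCA_snd_ne a

theorem obs_projAZ_ne (v : 𝒜 × 𝒵) : M.obsLaw (projAZ ⁻¹' {v}) ≠ 0 := by
  have := hM.isProbabilityMeasure_lawY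
  rw [← Prod.mk.eta (p := v), hM.obsLaw_isAssembled.measure_projAZ]
  exact mul_ne_zero (hM.lawCA_snd_ne _) (hM.lawZ_ne_zero _ _)

theorem pot_projCAZ_ne (b : 𝒜) (v : 𝒞 × 𝒜 × 𝒵) : M.potLaw b (projCAZ ⁻¹' {v}) ≠ 0 := by
  have := hM.isProbabilityMeasure_lawY
  obtain ⟨c, a, z⟩ := v
  rw [(hM.potLaw_isAssembled b).measure_projCAZ]
  exact mul_ne_zero (hM.lawCA_ne_zero _) (hM.lawZ_ne_zero _ _)

theorem pot_projCA_ne (b : 𝒜) (v : 𝒞 × 𝒜) : M.potLaw b (projCA ⁻¹' {v}) ≠ 0 := by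
  have := hM.isProbabilityMeasure_lawY
  rw [(hM.potLaw_isAssembled b).measure_projCA]
  exact hM.lawCA_ne_zero _

theorem pot_projZ_ne (b : 𝒜) (z : 𝒵) : M.potLaw b (projZ ⁻¹' {z}) ≠ 0 := by
  have := hM.isProbabilityMeasure_lawY
  rw [(hM.potLaw_isAssembled b).measure_projZ_of_const]
  exact hM.lawZ_ne_zero _ _

/-- The two laws differ in the mediator factor only, so the density is p(z | b) / p(z | a). It need
not be bounded. -/
theorem potLaw_real_eq (b : 𝒜) (x : 𝒞 × 𝒜 × 𝒵 × 𝒴) : (M.potLaw b).real {x} =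
    M.obsLaw.real {x} * ((M.lawZ b).real {x.2.2.1} / (M.lawZ x.2.1).real {x.2.2.1}) := by
  obtain ⟨c, a, z, y⟩ := x
  rw [measureReal_def, measureReal_def, hM.potLaw_isAssembled, hM.obsLaw_isAssembled]
  have := (hM.lawZ_real_pos a z).ne'
  simp only [ENNReal.toReal_mul, ← measureReal_def]
  field_simp

variable {b : 𝒜} (hb : MemLp (fun ω => (M.Yout b ω : ℝ)) 2 M.μ)
include hb

theorem memLp_outcome_lawY (v : 𝒞 × 𝒜 × 𝒵) : MemLp (fun y : 𝒴 => (y : ℝ)) 2 (M.lawY v) :=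
  have := hM.isProbabilityMeasure_lawY
  (hM.potLaw_isAssembled b).memLp_lawY (f := fun x => (x.2.2.2 : ℝ)) (hM.pot_projCAZ_ne b v)
    (M.memLp_potLaw_outcome_iff.2 hb)

theorem integrable_outcome_lawY (v : 𝒞 × 𝒜 × 𝒵) :
    Integrable (fun y : 𝒴 => (y : ℝ)) (M.lawY v) :=
  have := hM.isProbabilityMeasure_lawY
  (hM.memLp_outcome_lawY hb v).integrable (by norm_num)

omit hb in
theorem condMean_outcome_projCAZ (b : 𝒜) (v : 𝒞 × 𝒜 × 𝒵) :
    condMean (M.potLaw b) projCAZ (fun x => (x.2.2.2 : ℝ)) v = M.outReg v :=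
  have := hM.isProbabilityMeasure_lawY
  (hM.potLaw_isAssembled b).condMean_projCAZ (hM.pot_projCAZ_ne b v) _

theorem memLp_outReg : MemLp (fun x => M.outReg (projCAZ x)) 2 (M.potLaw b) := by
  have := memLp_condMean projCAZ (M.memLp_potLaw_outcome_iff.2 hb)
  simpa only [hM.condMean_outcome_projCAZ] using this

theorem integrable_outReg : Integrable (fun x => M.outReg (projCAZ x)) (M.potLaw b) :=
  (hM.memLp_outReg hb).integrable (by norm_num)

theorem integrable_potLaw_outcome :
    Integrable (fun x : 𝒞 × 𝒜 × 𝒵 × 𝒴 => (x.2.2.2 : ℝ)) (M.potLaw b) :=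
  (M.memLp_potLaw_outcome_iff.2 hb).integrable (by norm_num)

theorem condMean_outcome_projZ (z : 𝒵) :
    condMean (M.potLaw b) projZ (fun x => (x.2.2.2 : ℝ)) z = M.medReg z := by
  have := hM.isProbabilityMeasure_lawY
  -- Average over the outcome given `(C, A, Z)`, then over `(C, A)`, whose law is unaffected by
  -- `Z(b) = z`.
  rw [← condMean_condMean projCAZ (fun v => v.2.2) (hM.integrable_potLaw_outcome hb)]
  simp only [hM.condMean_outcome_projCAZ]
  exact (hM.potLaw_isAssembled b).condMean_projZ_of_const (hM.pot_projZ_ne b z) M.outReg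

theorem condMean_outcome_projCA (w : 𝒞 × 𝒜) :
    condMean (M.potLaw b) projCA (fun x => (x.2.2.2 : ℝ)) w = M.trtReg b w := by
  have := hM.isProbabilityMeasure_lawY
  rw [← condMean_condMean projCAZ (fun v => (v.1, v.2.1)) (hM.integrable_potLaw_outcome hb)]
  simp only [hM.condMean_outcome_projCAZ]
  exact (hM.potLaw_isAssembled b).condMean_projCA (hM.pot_projCA_ne b w) M.outReg

/-- `medReg` is a conditional mean of the outcome under `potLaw b`, so the L² contraction bounds its
second moment by that of `Y(b)`. This is available only for a treatment `b` with `E Y(b)² < ∞`. -/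
theorem memLp_medReg : MemLp M.medReg 2 (M.lawZ b) := by
  have := hM.isProbabilityMeasure_lawY
  have h := memLp_condMean projZ (M.memLp_potLaw_outcome_iff.2 hb)
  simp only [hM.condMean_outcome_projZ hb] at h
  exact (hM.potLaw_isAssembled b).memLp_projZ_of_const_iff.1 h

theorem memLp_trtReg : MemLp (M.trtReg b) 2 M.lawCA := by
  have := hM.isProbabilityMeasure_lawY
  have h := memLp_condMean projCA (M.memLp_potLaw_outcome_iff.2 hb)
  simp only [hM.condMean_outcome_projCA hb] at h
  exact (hM.potLaw_isAssembled b).memLp_projCA_iff.1 h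

theorem integral_medReg : ∫ z, M.medReg z ∂M.lawZ b = M.potMean b := by
  have := hM.isProbabilityMeasure_lawY
  have h := integral_condMean projZ (hM.integrable_potLaw_outcome hb)
  simp only [hM.condMean_outcome_projZ hb] at h
  rw [(hM.potLaw_isAssembled b).integral_projZ_of_const, integral_potLaw_outcome] at h
  exact h

theorem integral_trtReg : ∫ w, M.trtReg b w ∂M.lawCA = M.potMean b := by
  have := hM.isProbabilityMeasure_lawY
  have h := integral_condMean projCA (hM.integrable_potLaw_outcome hb)
  simp only [hM.condMean_outcome_projCA hb] at h
  rw [(hM.potLaw_isAssembled b).integral_projCA, integral_potLaw_outcome] at h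
  exact h

theorem integrable_outReg_lawCA (z : 𝒵) :
    Integrable (fun w : 𝒞 × 𝒜 => M.outReg (w.1, w.2, z)) M.lawCA := by
  have := hM.isProbabilityMeasure_lawY
  exact ((hM.potLaw_isAssembled b).memLp_lawCA_of_const (hM.pot_projZ_ne b z)
    (hM.memLp_outReg hb)).integrable (by norm_num)

theorem integrable_outReg_lawZ (w : 𝒞 × 𝒜) :
    Integrable (fun z => M.outReg (w.1, w.2, z)) (M.lawZ b) := by
  have := hM.isProbabilityMeasure_lawY
  exact ((hM.potLaw_isAssembled b).memLp_lawZ (hM.pot_projCA_ne b w)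
    (hM.memLp_outReg hb)).integrable (by norm_num)

theorem summable_outReg : Summable fun v : 𝒞 × 𝒜 × 𝒵 =>
    M.lawCA.real {(v.1, v.2.1)} * (M.lawZ b).real {v.2.2} * M.outReg v :=
  have := hM.isProbabilityMeasure_lawY
  ((hM.potLaw_isAssembled b).integral_projCAZ (hM.integrable_outReg hb)).1

theorem tsum_outReg : ∑' v : 𝒞 × 𝒜 × 𝒵,
    M.lawCA.real {(v.1, v.2.1)} * (M.lawZ b).real {v.2.2} * M.outReg v = M.potMean b := by
  have := hM.isProbabilityMeasure_lawY
  rw [← ((hM.potLaw_isAssembled b).integral_projCAZ (hM.integrable_outReg hb)).2]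
  have h := integral_condMean projCAZ (hM.integrable_potLaw_outcome hb)
  simp only [hM.condMean_outcome_projCAZ] at h
  rw [h, integral_potLaw_outcome]

end IsFrontTwoDoor

end regressions

/-! ### The three components of the influence functions -/

section components

variable (M : CausalModel 𝒞 𝒜 𝒵 𝒴) (a₁ a₀ : 𝒜)

/-- The component of the influence functions that belongs to the outcome given the rest. -/
def phiY (x : 𝒞 × 𝒜 × 𝒵 × 𝒴) : ℝ :=
  ((x.2.2.2 : ℝ) - M.outReg (projCAZ x)) *
    (((M.lawZ a₁).real {x.2.2.1} - (M.lawZ a₀).real {x.2.2.1}) / (M.lawZ x.2.1).real {x.2.2.1})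

/-- The component of the efficient influence function that belongs to the mediator given the
treatment. -/
def phiZ (u : 𝒜 × 𝒵) : ℝ :=
  contrast a₁ a₀ u.1 / M.massA u.1 * (M.medReg u.2 - M.potMean u.1)

/-- The component of the influence functions that belongs to the treatment and the covariates. -/
def phiCA (w : 𝒞 × 𝒜) : ℝ := M.trtReg a₁ w - M.trtReg a₀ w - M.ACE a₁ a₀

/-- The centred outcome regression given the covariates, at the mediator value `z`. -/
def covReg (v : 𝒞 × 𝒜 × 𝒵) : ℝ :=
  (∑' a' : 𝒜, M.EY a' v.2.2 v.1 * M.pAgivenC a' v.1)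
    - ∑' w : 𝒜 × 𝒵, M.EY w.1 w.2 v.1 * M.pZgivenA w.2 v.2.1 * M.pAgivenC w.1 v.1

/-- The component of `φ_td` that belongs to the mediator given treatment and covariates. -/
def phiZC (v : 𝒞 × 𝒜 × 𝒵) : ℝ := M.covReg v * (contrast a₁ a₀ v.2.1 / M.pAgivenC v.2.1 v.1)

theorem contrast_eq_zero {a : 𝒜} (h₁ : a ≠ a₁) (h₀ : a ≠ a₀) : contrast a₁ a₀ a = 0 := by
  simp [contrast, h₁, h₀]

theorem contrast_left (hne : a₁ ≠ a₀) : contrast a₁ a₀ a₁ = 1 := by simp [contrast, hne]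

theorem contrast_right (hne : a₁ ≠ a₀) : contrast a₁ a₀ a₀ = -1 := by simp [contrast, hne.symm]

variable [MeasurableSingletonClass 𝒞] [MeasurableSingletonClass 𝒜] [MeasurableSingletonClass 𝒵]
  [Countable 𝒞] [Countable 𝒜] [Countable 𝒵] [Countable 𝒴]

namespace IsFrontTwoDoor

variable {M a₁ a₀} (hM : M.IsFrontTwoDoor)
include hM

section single

variable {b : 𝒜} (hb : MemLp (fun ω => (M.Yout b ω : ℝ)) 2 M.μ)
include hb

theorem summable_outReg_section (c : 𝒞) : Summable fun u : 𝒜 × 𝒵 =>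
    M.EY u.1 u.2 c * M.pZgivenA u.2 b * M.pAgivenC u.1 c := by
  have h := (hM.summable_outReg hb).comp_injective
    (i := fun u : 𝒜 × 𝒵 => (c, u.1, u.2)) fun u u' h => by simpa [Prod.ext_iff] using h
  refine (h.mul_left (M.pC c)⁻¹).congr fun u => ?_
  simp only [Function.comp_apply, EY_eq, hM.pZgivenA_eq, pAgivenC_eq, pAC_eq, outReg]
  ring

/-- Since p(a | c) p(c) = p(c, a), averaging over the covariates turns the first part of `covReg`
into an integral against the law of `(C, A)`, and its centring into `E Y(b)`. Through this identity
`phiZ` arises both as the middle line of φ_{fd,td} and as a conditional mean of `phiZC`. -/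
theorem tsum_covReg (z : 𝒵) :
    ∑' c, M.covReg (c, b, z) * M.pC c = M.medReg z - M.potMean b := by
  -- both parts of `covReg`, weighted with `p(c)`, are sums of the regression function
  have hpc : ∀ c, M.pC c ≠ 0 := fun c => (hM.pC_pos c).ne'
  have hI := hM.integrable_outReg_lawCA hb z
  have e1 : ∀ w : 𝒞 × 𝒜, M.lawCA.real {w} * M.outReg (w.1, w.2, z) =
      M.EY w.2 z w.1 * M.pAgivenC w.2 w.1 * M.pC w.1 := fun w => by
    have := hpc w.1
    simp only [EY_eq, pAgivenC_eq, pAC_eq, outReg]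
    field_simp
  have e2 : ∀ v : 𝒞 × 𝒜 × 𝒵, M.lawCA.real {(v.1, v.2.1)} * (M.lawZ b).real {v.2.2} * M.outReg v =
      M.EY v.2.1 v.2.2 v.1 * M.pZgivenA v.2.2 b * M.pAgivenC v.2.1 v.1 * M.pC v.1 := fun v => by
    have := hpc v.1
    simp only [EY_eq, pAgivenC_eq, pAC_eq, outReg, hM.pZgivenA_eq]
    field_simp
  have s1 := (summable_mass_mul hI).congr e1
  have s2 := (hM.summable_outReg hb).congr e2
  have t1 : M.medReg z = ∑' c, (∑' a', M.EY a' z c * M.pAgivenC a' c) * M.pC c := by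
    rw [medReg, integral_eq_tsum_mass hI, tsum_congr e1, s1.tsum_prod]
    exact tsum_congr fun c => by rw [← tsum_mul_right]
  have t2 : M.potMean b = ∑' c, (∑' u : 𝒜 × 𝒵,
      M.EY u.1 u.2 c * M.pZgivenA u.2 b * M.pAgivenC u.1 c) * M.pC c := by
    rw [← hM.tsum_outReg hb, tsum_congr e2, s2.tsum_prod]
    exact tsum_congr fun c => by rw [← tsum_mul_right]
  have s1' : Summable fun c => (∑' a', M.EY a' z c * M.pAgivenC a' c) * M.pC c :=
    s1.prod.congr fun c => by rw [← tsum_mul_right]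
  have s2' : Summable fun c => (∑' u : 𝒜 × 𝒵,
      M.EY u.1 u.2 c * M.pZgivenA u.2 b * M.pAgivenC u.1 c) * M.pC c :=
    s2.prod.congr fun c => by rw [← tsum_mul_right]
  rw [t1, t2, ← s1'.tsum_sub s2']
  exact tsum_congr fun c => by rw [covReg]; ring

/-- Averaging the first part over the law of `Z(b)` reproduces the second part; the interchange of
the sums over treatments and mediator values is justified by the absolute convergence of the double
sum. -/
theorem integral_covReg (c : 𝒞) : ∫ z, M.covReg (c, b, z) ∂M.lawZ b = 0 := by
  have s1 := hM.summable_outReg_section hb c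
  have s2 : Summable fun u : 𝒵 × 𝒜 =>
      (M.lawZ b).real {u.1} * (M.EY u.2 u.1 c * M.pAgivenC u.2 c) := by
    refine ((Equiv.prodComm 𝒵 𝒜).summable_iff.2 s1).congr fun u => ?_
    simp only [Function.comp_apply, Equiv.prodComm_apply, Prod.fst_swap, Prod.snd_swap,
      hM.pZgivenA_eq]
    ring
  have s3 : Summable fun z => (M.lawZ b).real {z} * ∑' a', M.EY a' z c * M.pAgivenC a' c :=
    s2.prod.congr fun z => by rw [← tsum_mul_left]
  have hI := integrable_of_summable_mass s3
  simp only [covReg]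
  rw [integral_sub hI (integrable_const _), integral_const, probReal_univ, one_smul,
    integral_eq_tsum_mass hI, sub_eq_zero, ← (Equiv.prodComm 𝒵 𝒜).tsum_eq]
  rw [tsum_congr (fun z => tsum_mul_left.symm : ∀ z, (M.lawZ b).real {z} *
    ∑' a', M.EY a' z c * M.pAgivenC a' c = _), ← s2.tsum_prod]
  refine tsum_congr fun u => ?_
  simp only [Equiv.prodComm_apply, Prod.fst_swap, Prod.snd_swap, hM.pZgivenA_eq]
  ring

end single

variable (h₁ : MemLp (fun ω => (M.Yout a₁ ω : ℝ)) 2 M.μ)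
  (h₀ : MemLp (fun ω => (M.Yout a₀ ω : ℝ)) 2 M.μ)
include h₁ h₀

theorem memLp_Yout_of_contrast_ne {a : 𝒜} (ha : contrast a₁ a₀ a ≠ 0) :
    MemLp (fun ω => (M.Yout a ω : ℝ)) 2 M.μ := by
  by_cases h1 : a = a₁
  · rwa [h1]
  by_cases h0 : a = a₀
  · rwa [h0]
  exact absurd (contrast_eq_zero a₁ a₀ h1 h0) ha

theorem tsum_trtReg (c : 𝒞) (a : 𝒜) :
    ∑' z, M.EY a z c * (M.pZgivenA z a₁ - M.pZgivenA z a₀) =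
      M.trtReg a₁ (c, a) - M.trtReg a₀ (c, a) := by
  have i1 := hM.integrable_outReg_lawZ h₁ (c, a)
  have i0 := hM.integrable_outReg_lawZ h₀ (c, a)
  rw [trtReg, trtReg, integral_eq_tsum_mass i1, integral_eq_tsum_mass i0,
    ← (summable_mass_mul i1).tsum_sub (summable_mass_mul i0)]
  refine tsum_congr fun z => ?_
  rw [EY_eq, hM.pZgivenA_eq, hM.pZgivenA_eq, outReg]
  ring

theorem phiFDTD_eq (x : 𝒞 × 𝒜 × 𝒵 × 𝒴) : M.phiFDTD a₁ a₀ x =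
    M.phiY a₁ a₀ x + M.phiZ a₁ a₀ (projAZ x) + M.phiCA a₁ a₀ (projCA x) := by
  obtain ⟨c, a, z, y⟩ := x
  have h2 : ∑' c', M.covReg (c', a, z) * (contrast a₁ a₀ a * M.pC c' / M.pA a) =
      M.phiZ a₁ a₀ (a, z) := by
    rw [phiZ]
    -- Away from the two levels no moment of `Y(a)` is assumed and the sums may fail to converge,
    -- but the factor `contrast` vanishes there.
    by_cases ha : contrast a₁ a₀ a = 0
    · simp [ha]
    · rw [← hM.tsum_covReg (hM.memLp_Yout_of_contrast_ne h₁ h₀ ha), ← tsum_mul_left]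
      refine tsum_congr fun c' => ?_
      rw [massA, ← pA_eq]
      ring
  have h3 := hM.tsum_trtReg h₁ h₀ c a
  rw [phiFDTD]
  simp only [projAZ, projCA, phiCA, phiY, projCAZ, ← h2, ← h3, covReg, EY_eq, hM.pZgivenA_eq, outReg]
  ring

theorem phiTD_eq (x : 𝒞 × 𝒜 × 𝒵 × 𝒴) : M.phiTD a₁ a₀ x =
    M.phiY a₁ a₀ x + M.phiZC a₁ a₀ (projCAZ x) + M.phiCA a₁ a₀ (projCA x) := by
  obtain ⟨c, a, z, y⟩ := x
  have h3 := hM.tsum_trtReg h₁ h₀ c a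
  rw [phiTD]
  simp only [projCA, phiCA, phiY, projCAZ, phiZC, ← h3, covReg, EY_eq, hM.pZgivenA_eq,
    hM.pZgivenAC_eq, outReg]
  ring

theorem integral_phiY (v : 𝒞 × 𝒜 × 𝒵) :
    ∫ y, M.phiY a₁ a₀ (v.1, v.2.1, v.2.2, y) ∂M.lawY v = 0 := by
  have := hM.isProbabilityMeasure_lawY
  have e : ∀ y, M.phiY a₁ a₀ (v.1, v.2.1, v.2.2, y) = ((y : ℝ) - M.outReg v) *
    (((M.lawZ a₁).real {v.2.2} - (M.lawZ a₀).real {v.2.2}) / (M.lawZ v.2.1).real {v.2.2}) :=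
    fun y => rfl
  simp only [e]
  rw [integral_mul_const, integral_sub (hM.integrable_outcome_lawY h₁ v) (integrable_const _)]
  simp [outReg]

theorem integral_phiZ (a : 𝒜) : ∫ z, M.phiZ a₁ a₀ (a, z) ∂M.lawZ a = 0 := by
  simp only [phiZ]
  rw [integral_const_mul]
  by_cases ha : contrast a₁ a₀ a = 0
  · simp [ha]
  have hb := hM.memLp_Yout_of_contrast_ne h₁ h₀ ha
  rw [integral_sub ((hM.memLp_medReg hb).integrable (by norm_num)) (integrable_const _),
    hM.integral_medReg hb]
  simp

theorem integral_phiZC (c : 𝒞) (a : 𝒜) : ∫ z, M.phiZC a₁ a₀ (c, a, z) ∂M.lawZ a = 0 := by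
  simp only [phiZC]
  rw [integral_mul_const]
  by_cases ha : contrast a₁ a₀ a = 0
  · simp [ha]
  rw [hM.integral_covReg (hM.memLp_Yout_of_contrast_ne h₁ h₀ ha), zero_mul]

theorem memLp_phiCA : MemLp (M.phiCA a₁ a₀) 2 M.lawCA :=
  ((hM.memLp_trtReg h₁).sub (hM.memLp_trtReg h₀)).sub (memLp_const _)

theorem integral_phiCA : ∫ w, M.phiCA a₁ a₀ w ∂M.lawCA = 0 := by
  have i1 := (hM.memLp_trtReg h₁).integrable (by norm_num)
  have i0 := (hM.memLp_trtReg h₀).integrable (by norm_num)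
  have e : ∫ w, M.phiCA a₁ a₀ w ∂M.lawCA =
      (∫ w, (M.trtReg a₁ w - M.trtReg a₀ w) ∂M.lawCA) - ∫ _, M.ACE a₁ a₀ ∂M.lawCA :=
    integral_sub (i1.sub i0) (integrable_const _)
  rw [e, integral_sub i1 i0, hM.integral_trtReg h₁,
    hM.integral_trtReg h₀]
  simp [ACE_eq]

/-- A square integrable function splits into square integrable components. -/
theorem memLp_phiY_of_add {g : 𝒞 × 𝒜 × 𝒵 → ℝ}
    (h : MemLp (fun x => M.phiY a₁ a₀ x + g (projCAZ x)) 2 M.obsLaw) :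
    MemLp (M.phiY a₁ a₀) 2 M.obsLaw ∧ MemLp (fun x => g (projCAZ x)) 2 M.obsLaw := by
  have := hM.isProbabilityMeasure_lawY
  -- As `phiY` is centred given `(C, A, Z)`, the conditional mean of the sum is `g`; the L²
  -- contraction yields `g`, and subtraction yields `phiY`.
  have h1 := memLp_condMean projCAZ h
  have h2 : ∀ v, condMean M.obsLaw projCAZ (fun x => M.phiY a₁ a₀ x + g (projCAZ x)) v = g v := by
    intro v
    rw [hM.obsLaw_isAssembled.condMean_projCAZ (hM.obs_projCAZ_ne v)]
    have hi : Integrable (fun y => M.phiY a₁ a₀ (v.1, v.2.1, v.2.2, y)) (M.lawY v) :=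
      ((hM.integrable_outcome_lawY h₁ v).sub (integrable_const (M.outReg v))).mul_const
        (((M.lawZ a₁).real {v.2.2} - (M.lawZ a₀).real {v.2.2}) / (M.lawZ v.2.1).real {v.2.2})
    have e : ∀ y : 𝒴, g (projCAZ (v.1, v.2.1, v.2.2, y)) = g v := fun _ => rfl
    simp only [e]
    rw [integral_add hi (integrable_const _), hM.integral_phiY h₁ h₀]
    simp
  simp only [h2] at h1
  refine ⟨(h.sub h1).ae_eq ?_, h1⟩
  filter_upwards with x
  simp

theorem memLp_phiFDTD_components (hφ : MemLp (M.phiFDTD a₁ a₀) 2 M.obsLaw) :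
    MemLp (M.phiY a₁ a₀) 2 M.obsLaw ∧ MemLp (fun x => M.phiZ a₁ a₀ (projAZ x)) 2 M.obsLaw ∧
      MemLp (fun x => M.phiCA a₁ a₀ (projCA x)) 2 M.obsLaw := by
  have := hM.isProbabilityMeasure_lawY
  have h3 := hM.obsLaw_isAssembled.memLp_projCA_iff.2 (hM.memLp_phiCA h₁ h₀)
  obtain ⟨h4, h5⟩ := hM.memLp_phiY_of_add h₁ h₀
    (g := fun v => M.phiZ a₁ a₀ (v.2.1, v.2.2) + M.phiCA a₁ a₀ (v.1, v.2.1)) (hφ.ae_eq (by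
      filter_upwards with x
      rw [hM.phiFDTD_eq h₁ h₀, add_assoc]))
  refine ⟨h4, (h5.sub h3).ae_eq ?_, h3⟩
  filter_upwards with x
  simp [projCA, projAZ]

theorem memLp_phiTD_components (hφ : MemLp (M.phiTD a₁ a₀) 2 M.obsLaw) :
    MemLp (M.phiY a₁ a₀) 2 M.obsLaw ∧ MemLp (fun x => M.phiZC a₁ a₀ (projCAZ x)) 2 M.obsLaw ∧
      MemLp (fun x => M.phiCA a₁ a₀ (projCA x)) 2 M.obsLaw := by
  have := hM.isProbabilityMeasure_lawY
  have h3 := hM.obsLaw_isAssembled.memLp_projCA_iff.2 (hM.memLp_phiCA h₁ h₀)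
  obtain ⟨h4, h5⟩ := hM.memLp_phiY_of_add h₁ h₀
    (g := fun v => M.phiZC a₁ a₀ v + M.phiCA a₁ a₀ (v.1, v.2.1)) (hφ.ae_eq (by
      filter_upwards with x
      rw [hM.phiTD_eq h₁ h₀, add_assoc]))
  refine ⟨h4, (h5.sub h3).ae_eq ?_, h3⟩
  filter_upwards with x
  simp [projCAZ, projCA]

/-- The mean of the mediator component of `φ_td` given treatment and mediator. -/
theorem condMean_phiZC (h : Integrable (fun x => M.phiZC a₁ a₀ (projCAZ x)) M.obsLaw)
    (u : 𝒜 × 𝒵) :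
    condMean M.obsLaw projAZ (fun x => M.phiZC a₁ a₀ (projCAZ x)) u = M.phiZ a₁ a₀ u := by
  have := hM.isProbabilityMeasure_lawY
  obtain ⟨a, z⟩ := u
  -- The law of `C` given `A = a`. By the product form it is also the law of `C` given `A = a, Z =
  -- z`.
  set l : Measure 𝒞 := (M.lawCA[|Prod.snd ⁻¹' {a}]).map Prod.fst with hl
  have hlc : ∀ c, l {c} = (M.lawCA (Prod.snd ⁻¹' {a}))⁻¹ * M.lawCA {(c, a)} := fun c => by
    rw [hl, Measure.map_apply .of_discrete (measurableSet_singleton c), cond_apply .of_discrete]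
    congr 2
    ext ⟨c', a'⟩
    simp only [Set.mem_inter_iff, Set.mem_preimage, Set.mem_singleton_iff, Prod.mk.injEq]
    tauto
  have hcond : ∀ c, M.obsLaw (projAZ ⁻¹' {(a, z)} ∩ Prod.fst ⁻¹' {c}) =
      M.obsLaw (projAZ ⁻¹' {(a, z)}) * l {c} := fun c => by
    rw [hM.obsLaw_isAssembled.measure_projAZ, hlc, mul_right_comm, ← mul_assoc,
      ENNReal.mul_inv_cancel (hM.lawCA_snd_ne a) (measure_ne_top _ _), one_mul,
      ← hM.obsLaw_isAssembled.measure_projCAZ]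
    congr 1
    ext ⟨c', a', z', y'⟩
    simp only [Set.mem_inter_iff, Set.mem_preimage, Set.mem_singleton_iff, Prod.mk.injEq, projAZ,
      projCAZ]
    tauto
  have := cond_isProbabilityMeasure (hM.lawCA_snd_ne a)
  have hlp : IsProbabilityMeasure l := Measure.isProbabilityMeasure_map (by fun_prop)
  have hF : MemLp (fun x : 𝒞 × 𝒜 × 𝒵 × 𝒴 =>
      (fun (u : 𝒜 × 𝒵) c => M.phiZC a₁ a₀ (c, u.1, u.2)) (projAZ x) x.1) 1 M.obsLaw :=
    memLp_one_iff_integrable.2 h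
  have hI := memLp_one_iff_integrable.1 (memLp_of_condLaw (hM.obs_projAZ_ne (a, z)) hcond
    (F := fun (u : 𝒜 × 𝒵) c => M.phiZC a₁ a₀ (c, u.1, u.2)) hF)
  have h1 := condMean_eq_integral (hM.obs_projAZ_ne (a, z)) hcond
    (fun (u : 𝒜 × 𝒵) c => M.phiZC a₁ a₀ (c, u.1, u.2))
  refine h1.trans ?_
  rw [integral_eq_tsum_mass hI, phiZ]
  by_cases ha : contrast a₁ a₀ a = 0
  · simp [ha, phiZC]
  -- The weights combine as p(c | a) / p(a | c) = p(c) / p(a), which is the weighting in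
  -- `tsum_covReg`.
  rw [← hM.tsum_covReg (hM.memLp_Yout_of_contrast_ne h₁ h₀ ha), ← tsum_mul_left]
  refine tsum_congr fun c => ?_
  have e1 : l.real {c} = M.lawCA.real {(c, a)} / M.massA a := by
    rw [measureReal_def, hlc, ENNReal.toReal_mul, ENNReal.toReal_inv, massA, measureReal_def,
      measureReal_def]
    ring
  have e2 := (hM.lawCA_real_pos (c, a)).ne'
  have e3 := (hM.pC_pos c).ne'
  have e4 := (hM.massA_pos a).ne'
  rw [e1]
  simp only [phiZC, pAgivenC_eq, pAC_eq]
  field_simp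

end IsFrontTwoDoor

end components

end CausalModel

namespace CausalModel

variable {𝒞 𝒜 𝒵 : Type u} {𝒴 : Set ℝ} [MeasurableSpace 𝒞] [MeasurableSpace 𝒜] [MeasurableSpace 𝒵]

/-! ### Centred components of functions of the observed data -/

/-- Square integrable functions `s₁`, `s₂(a, z)`, `s₃(c, a)` that are centred given `(C, A, Z)`,
given `A`, and unconditionally. -/
structure IsCentredTriple (M : CausalModel 𝒞 𝒜 𝒵 𝒴) (s₁ : 𝒞 × 𝒜 × 𝒵 × 𝒴 → ℝ) (s₂ : 𝒜 × 𝒵 → ℝ)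
    (s₃ : 𝒞 × 𝒜 → ℝ) : Prop where
  memLp_fst : MemLp s₁ 2 M.obsLaw
  memLp_snd : MemLp (fun x => s₂ (projAZ x)) 2 M.obsLaw
  memLp_trd : MemLp (fun x => s₃ (projCA x)) 2 M.obsLaw
  centred_fst : ∀ v : 𝒞 × 𝒜 × 𝒵, ∫ y, s₁ (v.1, v.2.1, v.2.2, y) ∂M.lawY v = 0
  centred_snd : ∀ a, ∫ z, s₂ (a, z) ∂M.lawZ a = 0
  centred_trd : ∫ w, s₃ w ∂M.lawCA = 0

variable {M : CausalModel 𝒞 𝒜 𝒵 𝒴} {a₁ a₀ : 𝒜}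
variable [MeasurableSingletonClass 𝒞] [MeasurableSingletonClass 𝒜] [MeasurableSingletonClass 𝒵]
  [Countable 𝒞] [Countable 𝒜] [Countable 𝒵] [Countable 𝒴]

namespace IsFrontTwoDoor

variable (hM : M.IsFrontTwoDoor)
include hM

theorem integral_mul_projCAZ_eq_zero {f : 𝒞 × 𝒜 × 𝒵 × 𝒴 → ℝ} (hf : MemLp f 2 M.obsLaw)
    (h0 : ∀ v : 𝒞 × 𝒜 × 𝒵, ∫ y, f (v.1, v.2.1, v.2.2, y) ∂M.lawY v = 0) {g : 𝒞 × 𝒜 × 𝒵 → ℝ}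
    (hg : MemLp (fun x => g (projCAZ x)) 2 M.obsLaw) :
    ∫ x, f x * g (projCAZ x) ∂M.obsLaw = 0 := by
  have := hM.isProbabilityMeasure_lawY
  rw [integral_mul_comp projCAZ (hf.integrable_mul hg)]
  simp [hM.obsLaw_isAssembled.condMean_projCAZ (hM.obs_projCAZ_ne _), h0]

theorem integral_mul_projCA_eq_zero {f : 𝒞 × 𝒜 × 𝒵 → ℝ}
    (hf : MemLp (fun x => f (projCAZ x)) 2 M.obsLaw)
    (h0 : ∀ c a, ∫ z, f (c, a, z) ∂M.lawZ a = 0) {g : 𝒞 × 𝒜 → ℝ}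
    (hg : MemLp (fun x => g (projCA x)) 2 M.obsLaw) :
    ∫ x, f (projCAZ x) * g (projCA x) ∂M.obsLaw = 0 := by
  have := hM.isProbabilityMeasure_lawY
  rw [integral_mul_comp projCA (hf.integrable_mul hg)]
  simp [hM.obsLaw_isAssembled.condMean_projCA (hM.obs_projCA_ne _), h0]

/-- All cross terms vanish by the successive centrings. The middle function `g` may depend on the
covariates while `s₂` does not, so `g` enters only through its mean given `(A, Z)`: this is why φ_td
and φ_{fd,td} have the same inner products with scores. -/
theorem integral_mul_triple {f₁ : 𝒞 × 𝒜 × 𝒵 × 𝒴 → ℝ} {g : 𝒞 × 𝒜 × 𝒵 → ℝ} {f₃ : 𝒞 × 𝒜 → ℝ}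
    (hf₁ : MemLp f₁ 2 M.obsLaw)
    (hf₁0 : ∀ v : 𝒞 × 𝒜 × 𝒵, ∫ y, f₁ (v.1, v.2.1, v.2.2, y) ∂M.lawY v = 0)
    (hg : MemLp (fun x => g (projCAZ x)) 2 M.obsLaw)
    (hg0 : ∀ c a, ∫ z, g (c, a, z) ∂M.lawZ a = 0)
    (hf₃ : MemLp (fun x => f₃ (projCA x)) 2 M.obsLaw)
    {s₁ : 𝒞 × 𝒜 × 𝒵 × 𝒴 → ℝ} {s₂ : 𝒜 × 𝒵 → ℝ} {s₃ : 𝒞 × 𝒜 → ℝ}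
    (hs : M.IsCentredTriple s₁ s₂ s₃) :
    ∫ x, (f₁ x + g (projCAZ x) + f₃ (projCA x)) * (s₁ x + s₂ (projAZ x) + s₃ (projCA x)) ∂M.obsLaw
      = (∫ x, f₁ x * s₁ x ∂M.obsLaw)
        + (∫ x, condMean M.obsLaw projAZ (fun x => g (projCAZ x)) (projAZ x) * s₂ (projAZ x)
            ∂M.obsLaw)
        + ∫ w, f₃ w * s₃ w ∂M.lawCA := by
  have := hM.isProbabilityMeasure_lawY
  obtain ⟨h1, h2, h3, c1, c2, c3⟩ := hs
  have hgf : MemLp (fun x => g (projCAZ x) + f₃ (projCA x)) 2 M.obsLaw := hg.add hf₃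
  have hss : MemLp (fun x => s₂ (projAZ x) + s₃ (projCA x)) 2 M.obsLaw := h2.add h3
  have z1 : ∫ x, f₁ x * (s₂ (projAZ x) + s₃ (projCA x)) ∂M.obsLaw = 0 :=
    hM.integral_mul_projCAZ_eq_zero hf₁ hf₁0 (g := fun v => s₂ (v.2.1, v.2.2) + s₃ (v.1, v.2.1)) hss
  have z2 : ∫ x, s₁ x * (g (projCAZ x) + f₃ (projCA x)) ∂M.obsLaw = 0 :=
    hM.integral_mul_projCAZ_eq_zero h1 c1 (g := fun v => g v + f₃ (v.1, v.2.1)) hgf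
  have z3 : ∫ x, g (projCAZ x) * s₃ (projCA x) ∂M.obsLaw = 0 :=
    hM.integral_mul_projCA_eq_zero hg hg0 h3
  have z4 : ∫ x, s₂ (projAZ x) * f₃ (projCA x) ∂M.obsLaw = 0 :=
    hM.integral_mul_projCA_eq_zero (f := fun v => s₂ (v.2.1, v.2.2)) h2 (fun _ a => c2 a) hf₃
  have z5 := integral_mul_comp (P := M.obsLaw) projAZ (f := fun x => g (projCAZ x)) (g := s₂)
    (hg.integrable_mul h2)
  have z6 : ∫ x, f₃ (projCA x) * s₃ (projCA x) ∂M.obsLaw = ∫ w, f₃ w * s₃ w ∂M.lawCA :=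
    hM.obsLaw_isAssembled.integral_projCA fun w => f₃ w * s₃ w
  have i11 : Integrable (fun x => f₁ x * s₁ x) M.obsLaw := hf₁.integrable_mul h1
  have i1 : Integrable (fun x => f₁ x * (s₂ (projAZ x) + s₃ (projCA x))) M.obsLaw :=
    hf₁.integrable_mul hss
  have i2 : Integrable (fun x => s₁ x * (g (projCAZ x) + f₃ (projCA x))) M.obsLaw :=
    h1.integrable_mul hgf
  have i3 : Integrable (fun x => g (projCAZ x) * s₃ (projCA x)) M.obsLaw := hg.integrable_mul h3
  have i4 : Integrable (fun x => s₂ (projAZ x) * f₃ (projCA x)) M.obsLaw := h2.integrable_mul hf₃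
  have i5 : Integrable (fun x => g (projCAZ x) * s₂ (projAZ x)) M.obsLaw := hg.integrable_mul h2
  have i6 : Integrable (fun x => f₃ (projCA x) * s₃ (projCA x)) M.obsLaw := hf₃.integrable_mul h3
  have e : ∀ x : 𝒞 × 𝒜 × 𝒵 × 𝒴,
      (f₁ x + g (projCAZ x) + f₃ (projCA x)) * (s₁ x + s₂ (projAZ x) + s₃ (projCA x)) =
      f₁ x * s₁ x + (g (projCAZ x) * s₂ (projAZ x) + (f₃ (projCA x) * s₃ (projCA x) +
        (f₁ x * (s₂ (projAZ x) + s₃ (projCA x)) + (s₁ x * (g (projCAZ x) + f₃ (projCA x)) +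
          (g (projCAZ x) * s₃ (projCA x) + s₂ (projAZ x) * f₃ (projCA x)))))) := fun x => by ring
  simp only [e]
  rw [integral_add i11 (by exact i5.add (i6.add (i1.add (i2.add (i3.add i4))))),
    integral_add i5 (by exact i6.add (i1.add (i2.add (i3.add i4)))),
    integral_add i6 (by exact i1.add (i2.add (i3.add i4))),
    integral_add i1 (by exact i2.add (i3.add i4)), integral_add i2 (by exact i3.add i4), integral_add i3 i4, z1, z2, z3, z4, z5, z6]
  ring

/-- The expectation of a function of the treatment that vanishes off two levels. -/
theorem integral_projA_of_two_levels (hne : a₁ ≠ a₀) {G : 𝒜 → ℝ}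
    (hG : ∀ a, a ≠ a₁ → a ≠ a₀ → G a = 0) :
    ∫ x, G (projA x) ∂M.obsLaw = M.massA a₁ * G a₁ + M.massA a₀ * G a₀ := by
  have := hM.isProbabilityMeasure_lawY
  have hmass : ∀ b, M.obsLaw.real (projA ⁻¹' {b}) = M.massA b := fun b => by
    rw [measureReal_def, hM.obsLaw_isAssembled.measure_projA, massA, measureReal_def]
  have e : ∀ x : 𝒞 × 𝒜 × 𝒵 × 𝒴, G (projA x) =
      (projA ⁻¹' {a₁}).indicator (fun _ => G a₁) x + (projA ⁻¹' {a₀}).indicator (fun _ => G a₀) x := by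
    intro x
    by_cases h1 : projA x = a₁
    · have h0 : projA x ≠ a₀ := fun h => hne (h1.symm.trans h)
      rw [Set.indicator_of_mem (by exact h1), Set.indicator_of_notMem (by exact h0), h1, add_zero]
    by_cases h0 : projA x = a₀
    · rw [Set.indicator_of_notMem (by exact h1), Set.indicator_of_mem (by exact h0), h0, zero_add]
    · rw [Set.indicator_of_notMem (by exact h1), Set.indicator_of_notMem (by exact h0), hG _ h1 h0,
        add_zero]
  simp only [e]
  rw [integral_add ((integrable_const _).indicator .of_discrete)
    ((integrable_const _).indicator .of_discrete), integral_indicator_const _ .of_discrete,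
    integral_indicator_const _ .of_discrete, hmass, hmass, smul_eq_mul, smul_eq_mul]

variable (h₁ : MemLp (fun ω => (M.Yout a₁ ω : ℝ)) 2 M.μ)
  (h₀ : MemLp (fun ω => (M.Yout a₀ ω : ℝ)) 2 M.μ)

include h₁ h₀ in
theorem isCentredTriple_phi (hφ : MemLp (M.phiFDTD a₁ a₀) 2 M.obsLaw) :
    M.IsCentredTriple (M.phiY a₁ a₀) (M.phiZ a₁ a₀) (M.phiCA a₁ a₀) :=
  have h := hM.memLp_phiFDTD_components h₁ h₀ hφ
  ⟨h.1, h.2.1, h.2.2, hM.integral_phiY h₁ h₀, hM.integral_phiZ h₁ h₀, hM.integral_phiCA h₁ h₀⟩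

theorem memLp_lawZ_of_obs {f : 𝒜 × 𝒵 → ℝ} (hf : MemLp (fun x => f (projAZ x)) 2 M.obsLaw) (a : 𝒜) :
    MemLp (fun z => f (a, z)) 2 (M.lawZ a) :=
  have := hM.isProbabilityMeasure_lawY
  hM.obsLaw_isAssembled.memLp_lawZ_of_projAZ (hM.obs_projA_ne a) hf

include h₁ h₀ in
-- Condition on `A`: the constant `potMean` drops out because `s₂` is centred, and the mass of each
-- of the two levels cancels the factor 1 / p(a) in `phiZ`.
theorem integral_phiZ_mul (hne : a₁ ≠ a₀) {s₁ : 𝒞 × 𝒜 × 𝒵 × 𝒴 → ℝ} {s₂ : 𝒜 × 𝒵 → ℝ}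
    {s₃ : 𝒞 × 𝒜 → ℝ} (hs : M.IsCentredTriple s₁ s₂ s₃)
    (hφ : MemLp (fun x => M.phiZ a₁ a₀ (projAZ x)) 2 M.obsLaw) :
    ∫ x, M.phiZ a₁ a₀ (projAZ x) * s₂ (projAZ x) ∂M.obsLaw =
      (∫ z, M.medReg z * s₂ (a₁, z) ∂M.lawZ a₁) - ∫ z, M.medReg z * s₂ (a₀, z) ∂M.lawZ a₀ := by
  have := hM.isProbabilityMeasure_lawY
  have hI : Integrable (fun x => M.phiZ a₁ a₀ (projAZ x) * s₂ (projAZ x)) M.obsLaw :=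
    hφ.integrable_mul hs.memLp_snd
  rw [← integral_condMean projA hI]
  have hc : ∀ a, condMean M.obsLaw projA (fun x => M.phiZ a₁ a₀ (projAZ x) * s₂ (projAZ x)) a =
      contrast a₁ a₀ a / M.massA a * ∫ z, M.medReg z * s₂ (a, z) ∂M.lawZ a := fun a => by
    rw [hM.obsLaw_isAssembled.condMean_projA (hM.obs_projA_ne a)
      (fun u => M.phiZ a₁ a₀ u * s₂ u)]
    simp only [phiZ, mul_assoc]
    rw [integral_const_mul]
    by_cases ha : contrast a₁ a₀ a = 0
    · simp [ha]
    have hb := hM.memLp_Yout_of_contrast_ne h₁ h₀ ha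
    have h2 := hM.memLp_lawZ_of_obs hs.memLp_snd a
    have i1 : Integrable (fun z => M.medReg z * s₂ (a, z)) (M.lawZ a) :=
      (hM.memLp_medReg hb).integrable_mul h2
    simp only [sub_mul]
    rw [integral_sub i1 ((h2.integrable (by norm_num)).const_mul _), integral_const_mul,
      hs.centred_snd, mul_zero, sub_zero]
  simp only [hc]
  rw [hM.integral_projA_of_two_levels hne
    (G := fun a => contrast a₁ a₀ a / M.massA a * ∫ z, M.medReg z * s₂ (a, z) ∂M.lawZ a)
    fun a h1 h0 => by simp [contrast_eq_zero a₁ a₀ h1 h0]]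
  have p1 := (hM.massA_pos a₁).ne'
  have p0 := (hM.massA_pos a₀).ne'
  rw [contrast_left a₁ a₀ hne, contrast_right a₁ a₀ hne]
  field_simp
  ring

include h₁ h₀ in
theorem integral_phiCA_mul {s₁ : 𝒞 × 𝒜 × 𝒵 × 𝒴 → ℝ} {s₂ : 𝒜 × 𝒵 → ℝ}
    {s₃ : 𝒞 × 𝒜 → ℝ} (hs : M.IsCentredTriple s₁ s₂ s₃) :
    ∫ w, M.phiCA a₁ a₀ w * s₃ w ∂M.lawCA =
      (∫ w, M.trtReg a₁ w * s₃ w ∂M.lawCA) - ∫ w, M.trtReg a₀ w * s₃ w ∂M.lawCA := by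
  have := hM.isProbabilityMeasure_lawY
  have h3 := hM.obsLaw_isAssembled.memLp_projCA_iff.1 hs.memLp_trd
  have i1 : Integrable (fun w => M.trtReg a₁ w * s₃ w) M.lawCA :=
    (hM.memLp_trtReg h₁).integrable_mul h3
  have i0 : Integrable (fun w => M.trtReg a₀ w * s₃ w) M.lawCA :=
    (hM.memLp_trtReg h₀).integrable_mul h3
  have i2 : Integrable (fun w => M.ACE a₁ a₀ * s₃ w) M.lawCA :=
    (h3.integrable (by norm_num)).const_mul _
  simp only [phiCA, sub_mul]
  rw [integral_sub (by exact i1.sub i0) i2, integral_sub i1 i0, integral_const_mul, hs.centred_trd]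
  ring

include h₁ h₀ in
-- The weight in `phiY` is the difference of the densities of the two potential laws with respect to
-- the observed law. As these densities may be unbounded, square integrability of `s` under the
-- potential laws has to be required separately.
theorem integral_phiY_mul {s : 𝒞 × 𝒜 × 𝒵 × 𝒴 → ℝ} (hφ : MemLp (M.phiY a₁ a₀) 2 M.obsLaw)
    (hs : MemLp s 2 M.obsLaw) (hs₁ : MemLp s 2 (M.potLaw a₁)) (hs₀ : MemLp s 2 (M.potLaw a₀)) :
    ∫ x, M.phiY a₁ a₀ x * s x ∂M.obsLaw =
      (∫ x, ((x.2.2.2 : ℝ) - M.outReg (projCAZ x)) * s x ∂M.potLaw a₁)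
        - ∫ x, ((x.2.2.2 : ℝ) - M.outReg (projCAZ x)) * s x ∂M.potLaw a₀ := by
  have i1 : Integrable (fun x => ((x.2.2.2 : ℝ) - M.outReg (projCAZ x)) * s x) (M.potLaw a₁) :=
    ((M.memLp_potLaw_outcome_iff.2 h₁).sub (hM.memLp_outReg h₁)).integrable_mul hs₁
  have i0 : Integrable (fun x => ((x.2.2.2 : ℝ) - M.outReg (projCAZ x)) * s x) (M.potLaw a₀) :=
    ((M.memLp_potLaw_outcome_iff.2 h₀).sub (hM.memLp_outReg h₀)).integrable_mul hs₀
  have i : Integrable (fun x => M.phiY a₁ a₀ x * s x) M.obsLaw := hφ.integrable_mul hs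
  rw [integral_eq_tsum_mass i, integral_eq_tsum_mass i1, integral_eq_tsum_mass i0,
    ← (summable_mass_mul i1).tsum_sub (summable_mass_mul i0)]
  refine tsum_congr fun x => ?_
  rw [hM.potLaw_real_eq, hM.potLaw_real_eq, phiY]
  have := (hM.lawZ_real_pos x.2.1 x.2.2.1).ne'
  field_simp

/-- The right factor is the form of a score of the law of `(C, A, Z(b), Y(b))`. Each of its
components sees the outcome only through the matching part: the residual, the regression on `Z(b)`,
the regression on `(C, A)`. -/
theorem integral_outcome_mul {b : 𝒜} (hb : MemLp (fun ω => (M.Yout b ω : ℝ)) 2 M.μ)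
    {s₁ : 𝒞 × 𝒜 × 𝒵 × 𝒴 → ℝ} {s₂ : 𝒜 × 𝒵 → ℝ}
    {s₃ : 𝒞 × 𝒜 → ℝ} (hs : M.IsCentredTriple s₁ s₂ s₃) (hs₁ : MemLp s₁ 2 (M.potLaw b)) :
    ∫ x, (x.2.2.2 : ℝ) * (s₁ x + s₂ (b, projZ x) + s₃ (projCA x)) ∂M.potLaw b =
      (∫ x, ((x.2.2.2 : ℝ) - M.outReg (projCAZ x)) * s₁ x ∂M.potLaw b)
        + (∫ z, M.medReg z * s₂ (b, z) ∂M.lawZ b) + ∫ w, M.trtReg b w * s₃ w ∂M.lawCA := by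
  have := hM.isProbabilityMeasure_lawY
  have hR := hM.potLaw_isAssembled b
  have hY := M.memLp_potLaw_outcome_iff.2 hb
  have hm := hM.memLp_outReg hb
  have m2 : MemLp (fun x => s₂ (b, projZ x)) 2 (M.potLaw b) :=
    (hR.memLp_projZ_of_const_iff (f := fun z => s₂ (b, z))).2 (hM.memLp_lawZ_of_obs hs.memLp_snd b)
  have m3 : MemLp (fun x => s₃ (projCA x)) 2 (M.potLaw b) :=
    hR.memLp_projCA_iff.2 (hM.obsLaw_isAssembled.memLp_projCA_iff.1 hs.memLp_trd)
  have j0 : Integrable (fun x => ((x.2.2.2 : ℝ) - M.outReg (projCAZ x)) * s₁ x) (M.potLaw b) :=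
    (hY.sub hm).integrable_mul hs₁
  have j1 : Integrable (fun x => s₁ x * M.outReg (projCAZ x)) (M.potLaw b) := hs₁.integrable_mul hm
  have j2 : Integrable (fun x : 𝒞 × 𝒜 × 𝒵 × 𝒴 => (x.2.2.2 : ℝ) * s₂ (b, projZ x)) (M.potLaw b) :=
    hY.integrable_mul m2
  have j3 : Integrable (fun x : 𝒞 × 𝒜 × 𝒵 × 𝒴 => (x.2.2.2 : ℝ) * s₃ (projCA x)) (M.potLaw b) :=
    hY.integrable_mul m3
  have z1 : ∫ x, s₁ x * M.outReg (projCAZ x) ∂M.potLaw b = 0 := by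
    rw [integral_mul_comp projCAZ j1]
    simp [hR.condMean_projCAZ (hM.pot_projCAZ_ne b _), hs.centred_fst]
  have z2 : ∫ x, (x.2.2.2 : ℝ) * s₂ (b, projZ x) ∂M.potLaw b =
      ∫ z, M.medReg z * s₂ (b, z) ∂M.lawZ b := by
    rw [integral_mul_comp projZ (g := fun z => s₂ (b, z)) j2]
    simp only [hM.condMean_outcome_projZ hb]
    exact hR.integral_projZ_of_const fun z => M.medReg z * s₂ (b, z)
  have z3 : ∫ x, (x.2.2.2 : ℝ) * s₃ (projCA x) ∂M.potLaw b =
      ∫ w, M.trtReg b w * s₃ w ∂M.lawCA := by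
    rw [integral_mul_comp projCA j3]
    simp only [hM.condMean_outcome_projCA hb]
    exact hR.integral_projCA fun w => M.trtReg b w * s₃ w
  have e : ∀ x : 𝒞 × 𝒜 × 𝒵 × 𝒴, (x.2.2.2 : ℝ) * (s₁ x + s₂ (b, projZ x) + s₃ (projCA x)) =
      ((x.2.2.2 : ℝ) - M.outReg (projCAZ x)) * s₁ x + (s₁ x * M.outReg (projCAZ x) +
        ((x.2.2.2 : ℝ) * s₂ (b, projZ x) + (x.2.2.2 : ℝ) * s₃ (projCA x))) := fun x => by ring
  simp only [e]
  rw [integral_add j0 (by exact j1.add (j2.add j3)), integral_add j1 (by exact j2.add j3),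
    integral_add j2 j3, z1, z2, z3]
  ring

end IsFrontTwoDoor

end CausalModel

/-! ### Derivatives along quadratic mean differentiable families -/

section derivatives

variable {X : Type*} [MeasurableSpace X]

theorem inner_integral_smul {k : ℕ} {P : Measure X} {f : X → ℝ}
    {S : X → EuclideanSpace ℝ (Fin k)} (hf : MemLp f 2 P) (hS : MemLp S 2 P)
    (v : EuclideanSpace ℝ (Fin k)) :
    ⟪∫ x, f x • S x ∂P, v⟫ = ∫ x, f x * ⟪S x, v⟫ ∂P := by
  have hi : Integrable (fun x => f x • S x) P :=
    memLp_one_iff_integrable.1 (hS.smul hf (r := 1))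
  rw [real_inner_comm, ← integral_inner hi]
  simp only [inner_smul_right, real_inner_comm]

theorem memLp_inner_const {k : ℕ} {P : Measure X} {S : X → EuclideanSpace ℝ (Fin k)}
    (hS : MemLp S 2 P) (v : EuclideanSpace ℝ (Fin k)) : MemLp (fun x => ⟪S x, v⟫) 2 P := by
  have := hS.const_inner (𝕜 := ℝ) v
  simpa only [real_inner_comm] using this

theorem measureReal_ne_zero_of {P : Measure X} [IsFiniteMeasure P] {s : Set X} (h : P s ≠ 0) :
    P.real s ≠ 0 := (measureReal_ne_zero_iff).2 h

variable [MeasurableSingletonClass X] [Countable X]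

/-- The case of indicator functions along a line. It says that the logarithmic derivative of the
mass of an event is the mean of the score on it, so polynomial identities between masses become
linear relations between conditional means of scores. -/
theorem DiffQuadraticMean.hasDerivAt_measure {k : ℕ} {P : EuclideanSpace ℝ (Fin k) → Measure X}
    [∀ h, IsProbabilityMeasure (P h)] {S : X → EuclideanSpace ℝ (Fin k)}
    (hS : CausalModel.DiffQuadraticMean P S) (v : EuclideanSpace ℝ (Fin k)) (B : Set X) :
    HasDerivAt (fun t : ℝ => (P (t • v)).real B) (∫ x in B, ⟪S x, v⟫ ∂P 0) 0 := by
  have hB : MeasurableSet B := .of_discrete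
  have hmem : ∀ h, MemLp (B.indicator fun _ => (1 : ℝ)) 2 (P h) := fun h =>
    (memLp_const 1).indicator hB
  have h1 := DiffQuadraticMean.hasGradientAt hS (f := B.indicator fun _ => 1) (K := 1)
    (Eventually.of_forall fun h => ⟨hmem h, by
      have e : (fun x => (B.indicator (fun _ => (1 : ℝ)) x) ^ 2) = B.indicator fun _ => (1 : ℝ) := by
        ext x; by_cases hx : x ∈ B <;> simp [hx]
      rw [e, integral_indicator_const _ hB]
      simp⟩)
  have h2 : HasDerivAt (fun t : ℝ => t • v) v 0 := by
    simpa using (hasDerivAt_id (0 : ℝ)).smul_const v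
  have h3 := (hasGradientAt_iff_hasFDerivAt.1 h1)
  rw [← zero_smul ℝ v] at h3
  have h4 := h3.comp_hasDerivAt (0 : ℝ) h2
  have e1 : ((fun h => ∫ x, B.indicator (fun _ => (1 : ℝ)) x ∂P h) ∘ fun t : ℝ => t • v) =
      fun t : ℝ => (P (t • v)).real B := by
    ext t
    simp [integral_indicator_const _ hB]
  rw [e1] at h4
  rw [zero_smul, InnerProductSpace.toDual_apply_apply, inner_integral_smul (hmem 0) hS.1 v] at h4
  have e2 : ∫ x, B.indicator (fun _ => (1 : ℝ)) x * ⟪S x, v⟫ ∂P 0 = ∫ x in B, ⟪S x, v⟫ ∂P 0 := by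
    rw [← integral_indicator hB]
    refine integral_congr_ae (Eventually.of_forall fun x => ?_)
    by_cases hx : x ∈ B <;> simp [hx]
  rwa [e2] at h4

end derivatives

namespace CausalModel

variable {𝒞 𝒜 𝒵 : Type u} {𝒴 : Set ℝ} [MeasurableSpace 𝒞] [MeasurableSpace 𝒜] [MeasurableSpace 𝒵]
variable [MeasurableSingletonClass 𝒞] [MeasurableSingletonClass 𝒜] [MeasurableSingletonClass 𝒵]
  [Countable 𝒞] [Countable 𝒜] [Countable 𝒵] [Countable 𝒴]

/-! ### Constraints on the masses of the observed data -/

namespace IsFrontTwoDoor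

variable {M : CausalModel 𝒞 𝒜 𝒵 𝒴} (hM : M.IsFrontTwoDoor)
include hM

theorem obs_real_projCAZ (c : 𝒞) (a : 𝒜) (z : 𝒵) : M.obsLaw.real (projCAZ ⁻¹' {(c, a, z)}) =
    M.lawCA.real {(c, a)} * (M.lawZ a).real {z} := by
  have := hM.isProbabilityMeasure_lawY
  rw [measureReal_def, hM.obsLaw_isAssembled.measure_projCAZ, ENNReal.toReal_mul]
  rfl

theorem obs_real_projAZ (a : 𝒜) (z : 𝒵) : M.obsLaw.real (projAZ ⁻¹' {(a, z)}) =
    M.massA a * (M.lawZ a).real {z} := by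
  have := hM.isProbabilityMeasure_lawY
  rw [measureReal_def, hM.obsLaw_isAssembled.measure_projAZ, ENNReal.toReal_mul]
  rfl

theorem obs_real_projCA (w : 𝒞 × 𝒜) : M.obsLaw.real (projCA ⁻¹' {w}) = M.lawCA.real {w} := by
  have := hM.isProbabilityMeasure_lawY
  rw [measureReal_def, hM.obsLaw_isAssembled.measure_projCA]
  rfl

theorem obs_real_projA (a : 𝒜) : M.obsLaw.real (projA ⁻¹' {a}) = M.massA a := by
  have := hM.isProbabilityMeasure_lawY
  rw [measureReal_def, hM.obsLaw_isAssembled.measure_projA]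
  rfl

/-- Independence of `Z` and `C` given `A`, as a polynomial identity between masses, to be
differentiated along submodels. -/
theorem obs_constraint (c : 𝒞) (a : 𝒜) (z : 𝒵) :
    M.obsLaw.real (projCAZ ⁻¹' {(c, a, z)}) * M.obsLaw.real (projA ⁻¹' {a}) =
      M.obsLaw.real (projAZ ⁻¹' {(a, z)}) * M.obsLaw.real (projCA ⁻¹' {(c, a)}) := by
  rw [hM.obs_real_projCAZ, hM.obs_real_projAZ, hM.obs_real_projCA, hM.obs_real_projA]
  ring

/-- The likelihood ratio of `potLaw_real_eq` with both mediator probabilities written as quotients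
of observed masses and the denominators cleared. It determines the potential law from the observed
one and relates their scores. -/
theorem pot_constraint (b : 𝒜) (x : 𝒞 × 𝒜 × 𝒵 × 𝒴) :
    (M.potLaw b).real {x} *
        (M.obsLaw.real (projAZ ⁻¹' {projAZ x}) * M.obsLaw.real (projA ⁻¹' {b})) =
      M.obsLaw.real {x} *
        (M.obsLaw.real (projAZ ⁻¹' {(b, projZ x)}) * M.obsLaw.real (projA ⁻¹' {projA x})) := by
  obtain ⟨c, a, z, y⟩ := x
  rw [hM.potLaw_real_eq, hM.obs_real_projAZ, hM.obs_real_projAZ, hM.obs_real_projA,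
    hM.obs_real_projA]
  have := (hM.lawZ_real_pos a z).ne'
  simp only [projA, projZ]
  field_simp

/-- The laws of the potential data are determined by the law of the observed data. -/
theorem potLaw_congr {N : CausalModel 𝒞 𝒜 𝒵 𝒴} (hN : N.IsFrontTwoDoor)
    (h : N.obsLaw = M.obsLaw) (b : 𝒜) : N.potLaw b = M.potLaw b := by
  refine Measure.ext_of_singleton fun x => ?_
  have h1 := hM.pot_constraint b x
  have h2 := hN.pot_constraint b x
  rw [h] at h2
  have p1 : M.obsLaw.real (projAZ ⁻¹' {projAZ x}) * M.obsLaw.real (projA ⁻¹' {b}) ≠ 0 :=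
    mul_ne_zero (measureReal_ne_zero_of (hM.obs_projAZ_ne _))
      (measureReal_ne_zero_of (hM.obs_projA_ne _))
  have h3 := mul_right_cancel₀ p1 (h2.trans h1.symm)
  exact (measureReal_eq_measureReal_iff).1 h3

end IsFrontTwoDoor

/-! ### Scores of regular submodels -/

namespace IsRegularSubmodel

variable {M : CausalModel 𝒞 𝒜 𝒵 𝒴} {a₁ a₀ : 𝒜} {k : ℕ}
  {Q : EuclideanSpace ℝ (Fin k) → CausalModel 𝒞 𝒜 𝒵 𝒴}
  {S : 𝒞 × 𝒜 × 𝒵 × 𝒴 → EuclideanSpace ℝ (Fin k)}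

theorem eventually_line (hQ : IsRegularSubmodel M a₁ a₀ Q S) (v : EuclideanSpace ℝ (Fin k)) :
    ∀ᶠ t : ℝ in 𝓝 0, (Q (t • v)).IsFrontTwoDoor := by
  have : Tendsto (fun t : ℝ => t • v) (𝓝 0) (𝓝 0) := by
    have h : Continuous fun t : ℝ => t • v := by fun_prop
    simpa using h.tendsto 0
  exact this.eventually hQ.inModel

theorem memLp_score (hQ : IsRegularSubmodel M a₁ a₀ Q S) : MemLp S 2 M.obsLaw := by
  rw [← hQ.truth]; exact hQ.score.1

theorem hasDerivAt_obs (hQ : IsRegularSubmodel M a₁ a₀ Q S) (v : EuclideanSpace ℝ (Fin k))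
    (B : Set (𝒞 × 𝒜 × 𝒵 × 𝒴)) :
    HasDerivAt (fun t : ℝ => (Q (t • v)).obsLaw.real B) (∫ x in B, ⟪S x, v⟫ ∂M.obsLaw) 0 := by
  have := DiffQuadraticMean.hasDerivAt_measure hQ.score v B
  rwa [hQ.truth] at this

variable (hM : M.IsFrontTwoDoor)
include hM

/-- The logarithmic derivative of `obs_constraint`. -/
theorem score_constraint (hQ : IsRegularSubmodel M a₁ a₀ Q S) (v : EuclideanSpace ℝ (Fin k))
    (c : 𝒞) (a : 𝒜) (z : 𝒵) :
    condMean M.obsLaw projCAZ (fun x => ⟪S x, v⟫) (c, a, z) +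
        condMean M.obsLaw projA (fun x => ⟪S x, v⟫) a =
      condMean M.obsLaw projAZ (fun x => ⟪S x, v⟫) (a, z) +
        condMean M.obsLaw projCA (fun x => ⟪S x, v⟫) (c, a) := by
  have d1 := (hQ.hasDerivAt_obs v (projCAZ ⁻¹' {(c, a, z)})).mul
    (hQ.hasDerivAt_obs v (projA ⁻¹' {a}))
  have d2 := (hQ.hasDerivAt_obs v (projAZ ⁻¹' {(a, z)})).mul
    (hQ.hasDerivAt_obs v (projCA ⁻¹' {(c, a)}))
  have d3 := d2.congr_of_eventuallyEq (f₁ := _) (by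
    filter_upwards [hQ.eventually_line v] with t ht
    exact ht.obs_constraint c a z)
  have h := d1.unique d3
  simp only [zero_smul, hQ.truth] at h
  have h0 := hM.obs_constraint c a z
  have p1 : M.obsLaw.real (projCAZ ⁻¹' {(c, a, z)}) ≠ 0 :=
    measureReal_ne_zero_of (hM.obs_projCAZ_ne _)
  have p2 : M.obsLaw.real (projA ⁻¹' {a}) ≠ 0 := measureReal_ne_zero_of (hM.obs_projA_ne _)
  have p3 : M.obsLaw.real (projAZ ⁻¹' {(a, z)}) ≠ 0 := measureReal_ne_zero_of (hM.obs_projAZ_ne _)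
  have p4 : M.obsLaw.real (projCA ⁻¹' {(c, a)}) ≠ 0 := measureReal_ne_zero_of (hM.obs_projCA_ne _)
  simp only [condMean_eq_setIntegral]
  refine mul_left_cancel₀ (mul_ne_zero p1 p2) ?_
  calc _ = (∫ x in projCAZ ⁻¹' {(c, a, z)}, ⟪S x, v⟫ ∂M.obsLaw) * M.obsLaw.real (projA ⁻¹' {a}) +
        M.obsLaw.real (projCAZ ⁻¹' {(c, a, z)}) * ∫ x in projA ⁻¹' {a}, ⟪S x, v⟫ ∂M.obsLaw := by
        field_simp
    _ = _ := by
        rw [h, h0]; field_simp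

/-- The logarithmic derivative of `pot_constraint`; for the mass of a single point this derivative
is the score itself. -/
theorem pot_score_constraint (hQ : IsRegularSubmodel M a₁ a₀ Q S)
    (v : EuclideanSpace ℝ (Fin k)) {b : 𝒜} {T : 𝒞 × 𝒜 × 𝒵 × 𝒴 → EuclideanSpace ℝ (Fin k)}
    (hT : DiffQuadraticMean (fun t => (Q t).potLaw b) T) (x : 𝒞 × 𝒜 × 𝒵 × 𝒴) :
    ⟪T x, v⟫ + (condMean M.obsLaw projAZ (fun x => ⟪S x, v⟫) (projAZ x) +
        condMean M.obsLaw projA (fun x => ⟪S x, v⟫) b) =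
      ⟪S x, v⟫ + (condMean M.obsLaw projAZ (fun x => ⟪S x, v⟫) (b, projZ x) +
        condMean M.obsLaw projA (fun x => ⟪S x, v⟫) (projA x)) := by
  have d0 := DiffQuadraticMean.hasDerivAt_measure hT v {x}
  have d1 := d0.mul ((hQ.hasDerivAt_obs v (projAZ ⁻¹' {projAZ x})).mul
    (hQ.hasDerivAt_obs v (projA ⁻¹' {b})))
  have d2 := (hQ.hasDerivAt_obs v {x}).mul ((hQ.hasDerivAt_obs v (projAZ ⁻¹' {(b, projZ x)})).mul
    (hQ.hasDerivAt_obs v (projA ⁻¹' {projA x})))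
  have d3 := d2.congr_of_eventuallyEq (f₁ := _) (by
    filter_upwards [hQ.eventually_line v] with t ht
    exact ht.pot_constraint b x)
  have h := d1.unique d3
  -- `Q 0` need not be `M`; only their observed laws agree, and these determine the potential laws.
  have hp := hM.potLaw_congr hQ.inModel.self_of_nhds hQ.truth b
  simp only [Pi.mul_apply, zero_smul, hQ.truth, hp, integral_singleton, smul_eq_mul] at h
  have h0 := hM.pot_constraint b x
  have p0 : (M.potLaw b).real {x} ≠ 0 := measureReal_ne_zero_of (hM.potLaw_ne_zero _ _)
  have p1 : M.obsLaw.real {x} ≠ 0 := measureReal_ne_zero_of (hM.obsLaw_ne_zero _)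
  have p2 : M.obsLaw.real (projA ⁻¹' {b}) ≠ 0 := measureReal_ne_zero_of (hM.obs_projA_ne _)
  have p2' : M.obsLaw.real (projA ⁻¹' {projA x}) ≠ 0 :=
    measureReal_ne_zero_of (hM.obs_projA_ne _)
  have p3 : M.obsLaw.real (projAZ ⁻¹' {projAZ x}) ≠ 0 :=
    measureReal_ne_zero_of (hM.obs_projAZ_ne _)
  have p3' : M.obsLaw.real (projAZ ⁻¹' {(b, projZ x)}) ≠ 0 :=
    measureReal_ne_zero_of (hM.obs_projAZ_ne _)
  simp only [condMean_eq_setIntegral]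
  generalize (M.potLaw b).real {x} = r at *
  generalize M.obsLaw.real {x} = p at *
  generalize M.obsLaw.real (projA ⁻¹' {b}) = qb at *
  generalize M.obsLaw.real (projA ⁻¹' {projA x}) = qa at *
  generalize M.obsLaw.real (projAZ ⁻¹' {projAZ x}) = qaz at *
  generalize M.obsLaw.real (projAZ ⁻¹' {(b, projZ x)}) = qbz at *
  refine mul_left_cancel₀ (mul_ne_zero p0 (mul_ne_zero p3 p2)) ?_
  have h' : r * (qaz * qb) * (⟪T x, v⟫ + (qaz⁻¹ * (∫ x in projAZ ⁻¹' {projAZ x}, ⟪S x, v⟫ ∂M.obsLaw)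
      + qb⁻¹ * ∫ x in projA ⁻¹' {b}, ⟪S x, v⟫ ∂M.obsLaw)) =
      r * ⟪T x, v⟫ * (qaz * qb) + r * ((∫ x in projAZ ⁻¹' {projAZ x}, ⟪S x, v⟫ ∂M.obsLaw) * qb
      + qaz * ∫ x in projA ⁻¹' {b}, ⟪S x, v⟫ ∂M.obsLaw) := by
    field_simp
  rw [h', h, h0]
  field_simp

/-- The centred components of a score, together with the scores of the potential data. -/
theorem exists_centredTriple (hQ : IsRegularSubmodel M a₁ a₀ Q S)
    (v : EuclideanSpace ℝ (Fin k)) :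
    ∃ s₁ s₂ s₃, M.IsCentredTriple s₁ s₂ s₃ ∧
      (∀ x, ⟪S x, v⟫ = s₁ x + s₂ (projAZ x) + s₃ (projCA x)) ∧
      ∀ b T, DiffQuadraticMean (fun t => (Q t).potLaw b) T →
        MemLp s₁ 2 (M.potLaw b) ∧
        ∀ x, ⟪T x, v⟫ = s₁ x + s₂ (b, projZ x) + s₃ (projCA x) := by
  have := hM.isProbabilityMeasure_lawY
  have hs : MemLp (fun x => ⟪S x, v⟫) 2 M.obsLaw := memLp_inner_const hQ.memLp_score v
  have hsi := hs.integrable (by norm_num : (1 : ENNReal) ≤ 2)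
  set s : 𝒞 × 𝒜 × 𝒵 × 𝒴 → ℝ := fun x => ⟪S x, v⟫ with hsdef
  have hA := hM.obsLaw_isAssembled
  have i1 := memLp_condMean projCAZ hs
  have i2 := memLp_condMean projAZ hs
  have i3 := memLp_condMean projA hs
  have i4 := memLp_condMean projCA hs
  -- The components are s - E(s | C, A, Z), E(s | A, Z) - E(s | A) and E(s | C, A). That they add up
  -- to `s` is the relation `score_constraint`.
  have hdec : ∀ x, s x = (s x - condMean M.obsLaw projCAZ s (projCAZ x)) +
      (condMean M.obsLaw projAZ s (projAZ x) - condMean M.obsLaw projA s (projA x)) +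
      condMean M.obsLaw projCA s (projCA x) := fun x => by
    have := hQ.score_constraint hM v x.1 x.2.1 x.2.2.1
    simp only [projCAZ, projAZ, projA, projCA, ← hsdef] at this ⊢
    linarith
  have htrip : M.IsCentredTriple (fun x => s x - condMean M.obsLaw projCAZ s (projCAZ x))
      (fun u => condMean M.obsLaw projAZ s u - condMean M.obsLaw projA s u.1)
      (condMean M.obsLaw projCA s) := by
    refine ⟨hs.sub i1, i2.sub i3, i4, fun w => ?_, fun a => ?_, ?_⟩
    · have hm := (hA.memLp_lawY (hM.obs_projCAZ_ne w) hs).integrable (by norm_num)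
      have e : ∀ y : 𝒴, projCAZ (w.1, w.2.1, w.2.2, y) = w := fun _ => rfl
      simp only [e]
      rw [integral_sub hm (integrable_const _), hA.condMean_projCAZ (hM.obs_projCAZ_ne _)]
      simp
    · have hm := (hA.memLp_lawZ_of_projAZ (hM.obs_projA_ne a) (f := condMean M.obsLaw projAZ s)
        i2).integrable (by norm_num)
      dsimp only
      rw [integral_sub hm (integrable_const _),
        ← condMean_condMean projAZ (fun u : 𝒜 × 𝒵 => u.1) hsi,
        hA.condMean_projA (hM.obs_projA_ne a)]
      simp
    · rw [← hA.integral_projCA, integral_condMean projCA hsi]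
      -- The score has mean zero because the total mass is constantly one.
      have h := hQ.hasDerivAt_obs v Set.univ
      simp only [probReal_univ, Measure.restrict_univ] at h
      exact h.unique (hasDerivAt_const _ _)
  have htau : ∀ b T, DiffQuadraticMean (fun t => (Q t).potLaw b) T →
      ∀ x, ⟪T x, v⟫ = (s x - condMean M.obsLaw projCAZ s (projCAZ x)) +
        (condMean M.obsLaw projAZ s (b, projZ x) - condMean M.obsLaw projA s b) +
        condMean M.obsLaw projCA s (projCA x) := fun b T hT x => by
    have h1 := hdec x
    have h2 := hQ.pot_score_constraint hM v hT x
    simp only [← hsdef] at h2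
    linarith
  refine ⟨_, _, _, htrip, hdec, fun b T hT => ⟨?_, htau b T hT⟩⟩
  have hR := hM.potLaw_isAssembled b
  have hp := hM.potLaw_congr hQ.inModel.self_of_nhds hQ.truth b
  -- Square integrability of `s₁` does not pass from the observed law to the potential law. It is
  -- recovered from that of the score `T`, by subtracting the other two components.
  have hT2 : MemLp (fun x => ⟪T x, v⟫) 2 (M.potLaw b) := by
    rw [← hp]; exact memLp_inner_const hT.1 v
  have j2 := (hR.memLp_projZ_of_const_iff (f := fun z => condMean M.obsLaw projAZ s (b, z) -
    condMean M.obsLaw projA s b)).2 (hM.memLp_lawZ_of_obs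
      (f := fun u => condMean M.obsLaw projAZ s u - condMean M.obsLaw projA s u.1)
      htrip.memLp_snd b)
  have j3 := hR.memLp_projCA_iff.2 (hA.memLp_projCA_iff.1 htrip.memLp_trd)
  refine ((hT2.sub j2).sub j3).ae_eq (Eventually.of_forall fun x => ?_)
  have := htau b T hT x
  simp only [Pi.sub_apply]
  linarith

omit hM in
/-- The mean of a potential outcome is differentiable along a regular submodel. -/
theorem hasGradientAt_potMean (hQ : IsRegularSubmodel M a₁ a₀ Q S) {b : 𝒜}
    (hb : b ∈ ({a₁, a₀} : Set 𝒜)) {T : 𝒞 × 𝒜 × 𝒵 × 𝒴 → EuclideanSpace ℝ (Fin k)}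
    (hT : DiffQuadraticMean (fun t => (Q t).potLaw b) T) :
    HasGradientAt (fun t => (Q t).potMean b)
      (∫ x : 𝒞 × 𝒜 × 𝒵 × 𝒴, (x.2.2.2 : ℝ) • T x ∂(Q 0).potLaw b) 0 := by
  obtain ⟨K, hK⟩ := hQ.moment b hb
  have := DiffQuadraticMean.hasGradientAt hT (f := fun x => (x.2.2.2 : ℝ)) (K := K) (by
    filter_upwards [hK] with t ht
    rw [memLp_potLaw_outcome_iff, integral_potLaw_outcome_sq]
    exact ht)
  simpa only [integral_potLaw_outcome] using this

end IsRegularSubmodel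

/-! ### Influence functions -/

namespace IsFrontTwoDoor

variable {M : CausalModel 𝒞 𝒜 𝒵 𝒴} {a₁ a₀ : 𝒜} (hM : M.IsFrontTwoDoor)
include hM

/-- A function with the outcome and treatment components of `φ_td` is an influence function if its
mediator component is centred and has the right mean given treatment and mediator. -/
theorem isInfluenceFunction_of_components (hne : a₁ ≠ a₀)
    (h₁ : MemLp (fun ω => (M.Yout a₁ ω : ℝ)) 2 M.μ)
    (h₀ : MemLp (fun ω => (M.Yout a₀ ω : ℝ)) 2 M.μ) {φ : 𝒞 × 𝒜 × 𝒵 × 𝒴 → ℝ}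
    {g : 𝒞 × 𝒜 × 𝒵 → ℝ}
    (hφ : ∀ x, φ x = M.phiY a₁ a₀ x + g (projCAZ x) + M.phiCA a₁ a₀ (projCA x))
    (hY : MemLp (M.phiY a₁ a₀) 2 M.obsLaw)
    (hg : MemLp (fun x => g (projCAZ x)) 2 M.obsLaw)
    (hg0 : ∀ c a, ∫ z, g (c, a, z) ∂M.lawZ a = 0)
    (hgZ : ∀ u, condMean M.obsLaw projAZ (fun x => g (projCAZ x)) u = M.phiZ a₁ a₀ u) :
    IsInfluenceFunction M a₁ a₀ φ := by
  have := hM.isProbabilityMeasure_lawY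
  have hCA : MemLp (fun x => M.phiCA a₁ a₀ (projCA x)) 2 M.obsLaw :=
    hM.obsLaw_isAssembled.memLp_projCA_iff.2 (hM.memLp_phiCA h₁ h₀)
  have hφ2 : MemLp φ 2 M.obsLaw :=
    ((hY.add hg).add hCA).ae_eq (Eventually.of_forall fun x => (hφ x).symm)
  have hZ : MemLp (fun x => M.phiZ a₁ a₀ (projAZ x)) 2 M.obsLaw := by
    have := memLp_condMean projAZ hg
    simpa only [hgZ] using this
  refine ⟨hφ2, fun k Q S hQ => ?_⟩
  obtain ⟨T₁, hT₁⟩ := hQ.smooth_pot a₁ (by simp)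
  obtain ⟨T₀, hT₀⟩ := hQ.smooth_pot a₀ (by simp)
  have g₁ := hQ.hasGradientAt_potMean (by simp) hT₁
  have g₀ := hQ.hasGradientAt_potMean (by simp) hT₀
  have p₁ := hM.potLaw_congr hQ.inModel.self_of_nhds hQ.truth a₁
  have p₀ := hM.potLaw_congr hQ.inModel.self_of_nhds hQ.truth a₀
  have m₁ : MemLp T₁ 2 (M.potLaw a₁) := by rw [← p₁]; exact hT₁.1
  have m₀ : MemLp T₀ 2 (M.potLaw a₀) := by rw [← p₀]; exact hT₀.1
  rw [p₁, hasGradientAt_iff_hasFDerivAt] at g₁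
  rw [p₀, hasGradientAt_iff_hasFDerivAt] at g₀
  have h := g₁.sub g₀
  rw [← map_sub, ← hasGradientAt_iff_hasFDerivAt] at h
  -- The right side is the gradient computed from the potential laws. Tested against `v`, both sides
  -- split into an outcome, a mediator and a `(C, A)` term, which agree one by one.
  suffices hgrad : ∫ x, φ x • S x ∂M.obsLaw =
      (∫ x : 𝒞 × 𝒜 × 𝒵 × 𝒴, (x.2.2.2 : ℝ) • T₁ x ∂M.potLaw a₁) -
        ∫ x : 𝒞 × 𝒜 × 𝒵 × 𝒴, (x.2.2.2 : ℝ) • T₀ x ∂M.potLaw a₀ by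
    rw [hgrad]; exact h
  refine ext_inner_right ℝ fun v => ?_
  rw [inner_sub_left, inner_integral_smul hφ2 hQ.memLp_score,
    inner_integral_smul (M.memLp_potLaw_outcome_iff.2 h₁) m₁,
    inner_integral_smul (M.memLp_potLaw_outcome_iff.2 h₀) m₀]
  obtain ⟨s₁, s₂, s₃, hs, hdec, hpot⟩ := hQ.exists_centredTriple hM v
  obtain ⟨n₁, t₁⟩ := hpot a₁ T₁ hT₁
  obtain ⟨n₀, t₀⟩ := hpot a₀ T₀ hT₀
  simp only [hφ, hdec, t₁, t₀]
  rw [hM.integral_mul_triple hY (hM.integral_phiY h₁ h₀) hg hg0 hCA hs,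
    hM.integral_outcome_mul h₁ hs n₁, hM.integral_outcome_mul h₀ hs n₀,
    hM.integral_phiCA_mul h₁ h₀ hs, hM.integral_phiY_mul h₁ h₀ hY hs.memLp_fst n₁ n₀]
  simp only [hgZ]
  rw [hM.integral_phiZ_mul h₁ h₀ hne hs hZ]
  ring

variable (hne : a₁ ≠ a₀)
  (h₁ : MemLp (fun ω => (M.Yout a₁ ω : ℝ)) 2 M.μ)
  (h₀ : MemLp (fun ω => (M.Yout a₀ ω : ℝ)) 2 M.μ)
include h₁ h₀

theorem condMean_phiZ (u : 𝒜 × 𝒵) :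
    condMean M.obsLaw projAZ (fun x => M.phiZ a₁ a₀ (projAZ x)) u = M.phiZ a₁ a₀ u :=
  condMean_comp_self (hM.obs_projAZ_ne u) _

include hne

theorem isInfluenceFunction_phiFDTD (hφ : MemLp (M.phiFDTD a₁ a₀) 2 M.obsLaw) :
    IsInfluenceFunction M a₁ a₀ (M.phiFDTD a₁ a₀) :=
  have h := hM.memLp_phiFDTD_components h₁ h₀ hφ
  hM.isInfluenceFunction_of_components hne h₁ h₀ (g := fun v => M.phiZ a₁ a₀ (v.2.1, v.2.2))
    (hM.phiFDTD_eq h₁ h₀) h.1 h.2.1 (fun _ a => hM.integral_phiZ h₁ h₀ a)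
    (hM.condMean_phiZ h₁ h₀)

theorem isInfluenceFunction_phiTD (hφ : MemLp (M.phiTD a₁ a₀) 2 M.obsLaw) :
    IsInfluenceFunction M a₁ a₀ (M.phiTD a₁ a₀) :=
  have h := hM.memLp_phiTD_components h₁ h₀ hφ
  hM.isInfluenceFunction_of_components hne h₁ h₀ (g := M.phiZC a₁ a₀)
    (hM.phiTD_eq h₁ h₀) h.1 h.2.1 (hM.integral_phiZC h₁ h₀)
    (hM.condMean_phiZC h₁ h₀ (h.2.1.integrable (by norm_num)))

end IsFrontTwoDoor

end CausalModel

namespace CausalModel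

variable {𝒞 𝒜 𝒵 : Type u} {𝒴 : Set ℝ} [MeasurableSpace 𝒞] [MeasurableSpace 𝒜] [MeasurableSpace 𝒵]
variable [MeasurableSingletonClass 𝒞] [MeasurableSingletonClass 𝒜] [MeasurableSingletonClass 𝒵]
  [Countable 𝒞] [Countable 𝒜] [Countable 𝒵] [Countable 𝒴]

/-! ### The variance of the efficient influence function -/

namespace IsFrontTwoDoor

variable {M : CausalModel 𝒞 𝒜 𝒵 𝒴} {a₁ a₀ : 𝒜} (hM : M.IsFrontTwoDoor)
include hM

theorem medReg_eq_tsum {b : 𝒜} (hb : MemLp (fun ω => (M.Yout b ω : ℝ)) 2 M.μ) (z : 𝒵) :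
    M.medReg z = ∑' w : 𝒜 × 𝒞, M.EY w.1 z w.2 * M.pAgivenC w.1 w.2 * M.pC w.2 := by
  rw [medReg, integral_eq_tsum_mass (hM.integrable_outReg_lawCA hb z),
    ← (Equiv.prodComm 𝒜 𝒞).tsum_eq]
  refine tsum_congr fun w => ?_
  have := (hM.pC_pos w.2).ne'
  simp only [Equiv.prodComm_apply, EY_eq, pAgivenC_eq, pAC_eq, outReg,
    Prod.swap]
  field_simp

/-- The reordering of a triple of values. -/
def _root_.tripleEquiv (α β γ : Type*) : α × β × γ ≃ γ × α × β where
  toFun u := (u.2.2, u.1, u.2.1)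
  invFun u := (u.2.1, u.2.2, u.1)
  left_inv _ := rfl
  right_inv _ := rfl

theorem potMean_eq_tsum {b : 𝒜} (hb : MemLp (fun ω => (M.Yout b ω : ℝ)) 2 M.μ) :
    M.potMean b = ∑' w : 𝒜 × 𝒵 × 𝒞,
      M.EY w.1 w.2.1 w.2.2 * M.pZgivenA w.2.1 b * M.pAgivenC w.1 w.2.2 * M.pC w.2.2 := by
  rw [← hM.tsum_outReg hb, ← (tripleEquiv 𝒜 𝒵 𝒞).tsum_eq]
  refine tsum_congr fun w => ?_
  have := (hM.pC_pos w.2.2).ne'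
  simp only [tripleEquiv, Equiv.coe_fn_mk, EY_eq, pAgivenC_eq, pAC_eq, outReg, hM.pZgivenA_eq]
  field_simp

/-- The two sums form the variance of `medReg` under the law of `Z(b)`, divided by p(b). -/
theorem boundTerm_eq {b : 𝒜} (hb : MemLp (fun ω => (M.Yout b ω : ℝ)) 2 M.μ) :
    M.boundTerm b = ((∫ z, M.medReg z ^ 2 ∂M.lawZ b) - M.potMean b ^ 2) / M.massA b := by
  rw [boundTerm, ← hM.potMean_eq_tsum hb, integral_eq_tsum_mass (hM.memLp_medReg hb).integrable_sq,
    sub_div, ← tsum_div_const, massA, ← pA_eq]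
  congr 1
  refine tsum_congr fun z => ?_
  rw [← hM.medReg_eq_tsum hb, hM.pZgivenA_eq]
  ring

variable (hne : a₁ ≠ a₀)
  (h₁ : MemLp (fun ω => (M.Yout a₁ ω : ℝ)) 2 M.μ)
  (h₀ : MemLp (fun ω => (M.Yout a₀ ω : ℝ)) 2 M.μ)

include h₁ h₀ in
-- Given `(C, A, Z)` the mean of `phiY²` is the squared weight times the conditional variance; p(c,
-- a) p(z | a) against p(z | a)² in the denominator leaves p(c, a) / p(z | a).
theorem integral_phiY_sq (hφ : MemLp (M.phiY a₁ a₀) 2 M.obsLaw) :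
    ∫ x, M.phiY a₁ a₀ x * M.phiY a₁ a₀ x ∂M.obsLaw =
      ∑' z : 𝒵, (M.pZgivenA z a₁ - M.pZgivenA z a₀) ^ 2
      * ∑' w : 𝒜 × 𝒞, M.pAC w.1 w.2 / M.pZgivenA z w.1 * M.varY w.1 z w.2 := by
  have := hM.isProbabilityMeasure_lawY
  have hI : Integrable (fun x => M.phiY a₁ a₀ x * M.phiY a₁ a₀ x) M.obsLaw :=
    hφ.integrable_mul hφ
  rw [← integral_condMean projCAZ hI]
  have hI2 := integrable_condMean projCAZ hI
  have hc : ∀ v, condMean M.obsLaw projCAZ (fun x => M.phiY a₁ a₀ x * M.phiY a₁ a₀ x) v =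
      (((M.lawZ a₁).real {v.2.2} - (M.lawZ a₀).real {v.2.2}) / (M.lawZ v.2.1).real {v.2.2}) ^ 2 *
        M.varY v.2.1 v.2.2 v.1 := fun v => by
    rw [hM.obsLaw_isAssembled.condMean_projCAZ (hM.obs_projCAZ_ne v), varY_eq,
      variance_eq_integral measurable_subtype_coe.aemeasurable, ← integral_const_mul]
    refine integral_congr_ae (Eventually.of_forall fun y => ?_)
    simp only [phiY, outReg, projCAZ]
    ring
  obtain ⟨hs, ht⟩ := hM.obsLaw_isAssembled.integral_projCAZ hI2
  let e : 𝒵 × 𝒜 × 𝒞 ≃ 𝒞 × 𝒜 × 𝒵 := ⟨fun u => (u.2.2, u.2.1, u.1), fun u => (u.2.2, u.2.1, u.1),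
    fun _ => rfl, fun _ => rfl⟩
  rw [← e.summable_iff] at hs
  simp only [Function.comp_def] at hs
  rw [ht, ← e.tsum_eq, hs.tsum_prod]
  refine tsum_congr fun z => ?_
  rw [← tsum_mul_left]
  refine tsum_congr fun w => ?_
  have := (hM.lawZ_real_pos w.1 z).ne'
  simp only [e, Equiv.coe_fn_mk, hc, hM.pZgivenA_eq, pAC_eq]
  field_simp

include hne h₁ h₀ in
-- `integral_phiZ_mul` with `phiZ` itself as the mediator component. The minus sign between the two
-- levels meets the value -1 of `contrast` at `a₀`, so the two terms add.
theorem integral_phiZ_sq (hφ : MemLp (M.phiFDTD a₁ a₀) 2 M.obsLaw) :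
    ∫ x, M.phiZ a₁ a₀ (projAZ x) * M.phiZ a₁ a₀ (projAZ x) ∂M.obsLaw =
      M.boundTerm a₁ + M.boundTerm a₀ := by
  rw [hM.integral_phiZ_mul h₁ h₀ hne (hM.isCentredTriple_phi h₁ h₀ hφ)
    (hM.memLp_phiFDTD_components h₁ h₀ hφ).2.1]
  have key : ∀ b, MemLp (fun ω => (M.Yout b ω : ℝ)) 2 M.μ →
      ∫ z, M.medReg z * M.phiZ a₁ a₀ (b, z) ∂M.lawZ b = contrast a₁ a₀ b * M.boundTerm b := by
    intro b hb
    have e : ∀ z, M.medReg z * M.phiZ a₁ a₀ (b, z) = contrast a₁ a₀ b / M.massA b *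
        (M.medReg z ^ 2 - M.medReg z * M.potMean b) := fun z => by
      simp only [phiZ]; ring
    have hm := hM.memLp_medReg hb
    simp only [e]
    rw [integral_const_mul, integral_sub hm.integrable_sq
      ((hm.integrable (by norm_num)).mul_const _), integral_mul_const, hM.integral_medReg hb,
      hM.boundTerm_eq hb]
    ring
  rw [key a₁ h₁, key a₀ h₀, contrast_left a₁ a₀ hne, contrast_right a₁ a₀ hne]
  ring

include h₁ h₀ in
theorem integral_phiCA_sq :
    ∫ w, M.phiCA a₁ a₀ w * M.phiCA a₁ a₀ w ∂M.lawCA =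
      (∑' w : 𝒜 × 𝒞, M.pAC w.1 w.2
      * (∑' z : 𝒵, M.EY w.1 z w.2 * (M.pZgivenA z a₁ - M.pZgivenA z a₀)) ^ 2)
        - M.ACE a₁ a₀ ^ 2 := by
  have hD : MemLp (fun w => M.trtReg a₁ w - M.trtReg a₀ w) 2 M.lawCA :=
    (hM.memLp_trtReg h₁).sub (hM.memLp_trtReg h₀)
  have hD0 : ∫ w, (M.trtReg a₁ w - M.trtReg a₀ w) ∂M.lawCA = M.ACE a₁ a₀ := by
    rw [integral_sub ((hM.memLp_trtReg h₁).integrable (by norm_num))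
      ((hM.memLp_trtReg h₀).integrable (by norm_num)), hM.integral_trtReg h₁,
      hM.integral_trtReg h₀, ACE_eq]
  have e : ∀ w, M.phiCA a₁ a₀ w * M.phiCA a₁ a₀ w = (M.trtReg a₁ w - M.trtReg a₀ w) ^ 2 -
      ((M.trtReg a₁ w - M.trtReg a₀ w) * (2 * M.ACE a₁ a₀) - M.ACE a₁ a₀ ^ 2) := fun w => by
    simp only [phiCA]; ring
  have i1 : Integrable (fun w => (M.trtReg a₁ w - M.trtReg a₀ w) * (2 * M.ACE a₁ a₀)) M.lawCA :=
    (hD.integrable (by norm_num)).mul_const _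
  simp only [e]
  rw [integral_sub hD.integrable_sq (by exact i1.sub (integrable_const _)),
    integral_sub i1 (integrable_const _), integral_mul_const, hD0,
    integral_eq_tsum_mass hD.integrable_sq, ← (Equiv.prodComm 𝒜 𝒞).tsum_eq]
  have e2 : ∀ w : 𝒜 × 𝒞, M.pAC w.1 w.2
      * (∑' z : 𝒵, M.EY w.1 z w.2 * (M.pZgivenA z a₁ - M.pZgivenA z a₀)) ^ 2 =
      M.lawCA.real {(Equiv.prodComm 𝒜 𝒞) w} * (M.trtReg a₁ ((Equiv.prodComm 𝒜 𝒞) w) -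
        M.trtReg a₀ ((Equiv.prodComm 𝒜 𝒞) w)) ^ 2 := fun w => by
    rw [hM.tsum_trtReg h₁ h₀, pAC_eq]; rfl
  rw [tsum_congr e2]
  simp
  ring

include h₁ h₀ in
theorem integral_phiFDTD (hφ : MemLp (M.phiFDTD a₁ a₀) 2 M.obsLaw) :
    ∫ x, M.phiFDTD a₁ a₀ x ∂M.obsLaw = 0 := by
  have := hM.isProbabilityMeasure_lawY
  obtain ⟨hY, hZ, hCA⟩ := hM.memLp_phiFDTD_components h₁ h₀ hφ
  have z1 := hM.integral_mul_projCAZ_eq_zero hY (hM.integral_phiY h₁ h₀) (g := fun _ => 1)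
    (memLp_const 1)
  have z2 := hM.integral_mul_projCA_eq_zero (f := fun v => M.phiZ a₁ a₀ (v.2.1, v.2.2)) hZ
    (fun _ a => hM.integral_phiZ h₁ h₀ a) (g := fun _ => 1) (memLp_const 1)
  simp only [mul_one] at z1 z2
  have i1 := hY.integrable (by norm_num : (1 : ENNReal) ≤ 2)
  have i2 := hZ.integrable (by norm_num : (1 : ENNReal) ≤ 2)
  have i3 := hCA.integrable (by norm_num : (1 : ENNReal) ≤ 2)
  simp only [hM.phiFDTD_eq h₁ h₀]
  rw [integral_add (by exact i1.add i2) i3, integral_add i1 i2, z1,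
    hM.obsLaw_isAssembled.integral_projCA, hM.integral_phiCA h₁ h₀]
  have z2' : ∫ x, M.phiZ a₁ a₀ (projAZ x) ∂M.obsLaw = 0 := z2
  rw [z2']
  norm_num

include hne h₁ h₀ in
theorem integral_phiFDTD_sq (hφ : MemLp (M.phiFDTD a₁ a₀) 2 M.obsLaw) :
    ∫ x, M.phiFDTD a₁ a₀ x ^ 2 ∂M.obsLaw = M.boundFDTD a₁ a₀ := by
  have := hM.isProbabilityMeasure_lawY
  have ht := hM.isCentredTriple_phi h₁ h₀ hφ
  have h := hM.integral_mul_triple (g := fun v => M.phiZ a₁ a₀ (v.2.1, v.2.2)) ht.memLp_fst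
    ht.centred_fst ht.memLp_snd (fun _ a => ht.centred_snd a) ht.memLp_trd ht
  have e : ∀ x, M.phiFDTD a₁ a₀ x ^ 2 =
      (M.phiY a₁ a₀ x + M.phiZ a₁ a₀ (projAZ x) + M.phiCA a₁ a₀ (projCA x)) *
      (M.phiY a₁ a₀ x + M.phiZ a₁ a₀ (projAZ x) + M.phiCA a₁ a₀ (projCA x)) := fun x => by
    rw [hM.phiFDTD_eq h₁ h₀]; ring
  have hc : ∀ u, condMean M.obsLaw projAZ (fun x => M.phiZ a₁ a₀ ((projCAZ x).2.1, (projCAZ x).2.2)) u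
      = M.phiZ a₁ a₀ u := hM.condMean_phiZ h₁ h₀
  simp only [hc] at h
  simp only [e]
  refine h.trans ?_
  rw [hM.integral_phiY_sq h₁ h₀ ht.memLp_fst, hM.integral_phiZ_sq hne h₁ h₀ hφ,
    hM.integral_phiCA_sq h₁ h₀, boundFDTD]
  ring

include hne h₁ h₀ in
theorem variance_phiFDTD (hφ : MemLp (M.phiFDTD a₁ a₀) 2 M.obsLaw) :
    variance (M.phiFDTD a₁ a₀) M.obsLaw = M.boundFDTD a₁ a₀ := by
  rw [variance_eq_sub hφ, hM.integral_phiFDTD h₁ h₀ hφ, ← hM.integral_phiFDTD_sq hne h₁ h₀ hφ]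
  simp

end IsFrontTwoDoor

end CausalModel

/-! ### Causal models with prescribed laws -/

theorem measurable_apply_of_countable {Ω ι β : Type*} [MeasurableSpace Ω] [MeasurableSpace ι]
    [MeasurableSingletonClass ι] [Countable ι] [MeasurableSpace β] {I : Ω → ι} (hI : Measurable I)
    {F : ι → Ω → β} (hF : ∀ i, Measurable (F i)) : Measurable fun ω => F (I ω) ω := by
  intro s hs
  have : (fun ω => F (I ω) ω) ⁻¹' s = ⋃ i, I ⁻¹' {i} ∩ F i ⁻¹' s := by
    ext ω; simp
  rw [this]
  exact MeasurableSet.iUnion fun i => (hI (measurableSet_singleton i)).inter (hF i hs)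

/-- Conditioning on the second coordinate keeps the coordinates of a product independent. -/
theorem indepFun_cond_snd {Ω₁ Ω₂ α β : Type*} [MeasurableSpace Ω₁] [MeasurableSpace Ω₂]
    [MeasurableSpace α] [MeasurableSpace β] {μ₁ : Measure Ω₁} {μ₂ : Measure Ω₂}
    [IsProbabilityMeasure μ₁] [IsProbabilityMeasure μ₂] {f : Ω₁ → α} {g : Ω₂ → β}
    (hf : Measurable f) (hg : Measurable g) (s : Set Ω₂) :
    IndepFun (fun ω => f ω.1) (fun ω => g ω.2) ((μ₁.prod μ₂)[|Prod.snd ⁻¹' s]) := by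
  have hs : (μ₁.prod μ₂) (Prod.snd ⁻¹' s) = μ₂ s := by
    rw [← Set.univ_prod, Measure.prod_prod, measure_univ, one_mul]
  have h : (μ₁.prod μ₂)[|Prod.snd ⁻¹' s] = μ₁.prod (μ₂[|s]) := by
    rw [ProbabilityTheory.cond, ProbabilityTheory.cond, hs, Measure.prod_smul_right,
      ← Set.univ_prod, ← Measure.prod_restrict, Measure.restrict_univ]
  -- Conditioning on a null event gives the zero measure, under which independence is trivial.
  by_cases h0 : μ₂ s = 0
  · rw [cond_eq_zero_of_meas_eq_zero (hs.trans h0)]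
    rw [indepFun_iff_measure_inter_preimage_eq_mul]
    simp
  have := cond_isProbabilityMeasure h0
  rw [h]
  exact indepFun_prod hf hg

namespace CausalModel

variable {𝒞 𝒜 𝒵 : Type u} {𝒴 : Set ℝ} [MeasurableSpace 𝒞] [MeasurableSpace 𝒜] [MeasurableSpace 𝒵]
variable [MeasurableSingletonClass 𝒞] [MeasurableSingletonClass 𝒜] [MeasurableSingletonClass 𝒵]
  [Countable 𝒞] [Countable 𝒜] [Countable 𝒵]

section ofLaws

variable (π : Measure (𝒞 × 𝒜)) (ν : 𝒜 → Measure 𝒵) (ρ : 𝒞 × 𝒜 × 𝒵 → Measure 𝒴)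
  [IsProbabilityMeasure π] [∀ a, IsProbabilityMeasure (ν a)] [∀ v, IsProbabilityMeasure (ρ v)]

/-- The causal model in which `(C, A)` has the law `π`, the potential mediators are independent with
the laws `ν a`, and the potential outcomes at `(C, A, z) = v` are independent with the laws `ρ v`. -/
def ofLaws : CausalModel 𝒞 𝒜 𝒵 𝒴 where
  -- The mediators occupy the first factor, everything else the second. Each independence assumption
  -- is then one between the two factors, conditioned at most on an event of the second.
  Ω := (𝒜 → 𝒵) × ((𝒞 × 𝒜) × (𝒞 × 𝒜 × 𝒵 → 𝒴))
  μ := (Measure.infinitePi ν).prod (π.prod (Measure.infinitePi ρ))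
  C ω := ω.2.1.1
  A ω := ω.2.1.2
  Z ω := ω.1 ω.2.1.2
  Y ω := ω.2.2 (ω.2.1.1, ω.2.1.2, ω.1 ω.2.1.2)
  Zpot b ω := ω.1 b
  -- The treatment argument is ignored, so there is no direct effect; the actual values of `C` and
  -- `A` still influence the outcome, which the assumptions permit.
  Ypot _ z ω := ω.2.2 (ω.2.1.1, ω.2.1.2, z)
  measurable_C := by fun_prop
  measurable_A := by fun_prop
  measurable_Z := measurable_apply_of_countable (I := fun ω : (𝒜 → 𝒵) × ((𝒞 × 𝒜) ×
    (𝒞 × 𝒜 × 𝒵 → 𝒴)) => ω.2.1.2) (F := fun a ω => ω.1 a) (by fun_prop) fun a => by fun_prop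
  measurable_Y := by
    refine measurable_apply_of_countable (I := fun ω : (𝒜 → 𝒵) × ((𝒞 × 𝒜) ×
      (𝒞 × 𝒜 × 𝒵 → 𝒴)) => (ω.2.1.1, ω.2.1.2, ω.1 ω.2.1.2)) (F := fun v ω => ω.2.2 v) ?_
      fun v => by fun_prop
    have := measurable_apply_of_countable (I := fun ω : (𝒜 → 𝒵) × ((𝒞 × 𝒜) ×
      (𝒞 × 𝒜 × 𝒵 → 𝒴)) => ω.2.1.2) (F := fun a ω => ω.1 a) (by fun_prop) fun a => by fun_prop
    fun_prop
  measurable_Zpot b := by fun_prop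
  measurable_Ypot _ z := measurable_apply_of_countable (I := fun ω : (𝒜 → 𝒵) × ((𝒞 × 𝒜) ×
    (𝒞 × 𝒜 × 𝒵 → 𝒴)) => (ω.2.1.1, ω.2.1.2, z)) (F := fun v ω => ω.2.2 v) (by fun_prop)
    fun v => by fun_prop

theorem infinitePi_eval {ι : Type*} {X : ι → Type*} [∀ i, MeasurableSpace (X i)]
    [∀ i, MeasurableSingletonClass (X i)] (m : ∀ i, Measure (X i))
    [∀ i, IsProbabilityMeasure (m i)] (i : ι) (x : X i) :
    Measure.infinitePi m {f | f i = x} = m i {x} := by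
  rw [← Measure.infinitePi_map_eval m i, Measure.map_apply (measurable_pi_apply i)
    (measurableSet_singleton x)]
  rfl

theorem ofLaws_measure (b : 𝒜) (c : 𝒞) (a : 𝒜) (z : 𝒵) (y : 𝒴) :
    (ofLaws π ν ρ).μ ({f : 𝒜 → 𝒵 | f b = z} ×ˢ ({((c, a) : 𝒞 × 𝒜)} ×ˢ
      {f : 𝒞 × 𝒜 × 𝒵 → 𝒴 | f (c, a, z) = y})) = π {(c, a)} * ν b {z} * ρ (c, a, z) {y} := by
  refine (Measure.prod_prod _ _).trans ?_
  rw [Measure.prod_prod, infinitePi_eval, infinitePi_eval, ← mul_assoc, mul_comm (ν b {z})]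

theorem ofLaws_potLaw_isAssembled (b : 𝒜) :
    IsAssembled ((ofLaws π ν ρ).potLaw b) π (fun _ => ν b) ρ := by
  intro c a z y
  rw [← ofLaws_measure, potLaw, Measure.map_apply (measurable_pot _ b) (measurableSet_singleton _)]
  congr 1
  refine Set.ext fun ⟨f, ⟨c', a'⟩, g⟩ => ?_
  change (c', a', f b, g (c', a', f b)) = (c, a, z, y) ↔
    f b = z ∧ (c', a') = (c, a) ∧ g (c, a, z) = y
  simp only [Prod.mk.injEq]
  constructor
  · rintro ⟨rfl, rfl, rfl, rfl⟩; exact ⟨rfl, ⟨rfl, rfl⟩, rfl⟩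
  · rintro ⟨rfl, ⟨rfl, rfl⟩, rfl⟩; exact ⟨rfl, rfl, rfl, rfl⟩

theorem ofLaws_obsLaw_isAssembled : IsAssembled (ofLaws π ν ρ).obsLaw π ν ρ := by
  intro c a z y
  rw [← ofLaws_measure, obsLaw, Measure.map_apply (measurable_obs _) (measurableSet_singleton _)]
  congr 1
  refine Set.ext fun ⟨f, ⟨c', a'⟩, g⟩ => ?_
  change (c', a', f a', g (c', a', f a')) = (c, a, z, y) ↔
    f a = z ∧ (c', a') = (c, a) ∧ g (c, a, z) = y
  simp only [Prod.mk.injEq]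
  constructor
  · rintro ⟨rfl, rfl, rfl, rfl⟩; exact ⟨rfl, ⟨rfl, rfl⟩, rfl⟩
  · rintro ⟨rfl, ⟨rfl, rfl⟩, rfl⟩; exact ⟨rfl, rfl, rfl, rfl⟩

theorem ofLaws_positivity (hπ : ∀ v, π {v} ≠ 0) (hν : ∀ a z, ν a {z} ≠ 0)
    (hρ : ∀ v y, ρ v {y} ≠ 0) : (ofLaws π ν ρ).Positivity := by
  classical
  intro a y a' z c
  -- Positivity pairs `Y(a)` with the observed mediator `Z(a')`, and `a` may differ from `a'`.
  -- Forcing both `Z(a)` and `Z(a')` to equal `z` gives a rectangle inside the event; the finite set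
  -- `{a, a'}` also covers `a = a'`.
  have hsub : (Set.pi (({a, a'} : Finset 𝒜) : Set 𝒜) fun _ => {z}) ×ˢ ({((c, a') : 𝒞 × 𝒜)} ×ˢ
      {f : 𝒞 × 𝒜 × 𝒵 → 𝒴 | f (c, a', z) = y}) ⊆ {ω : (ofLaws π ν ρ).Ω |
        (ofLaws π ν ρ).Yout a ω = y ∧ (ofLaws π ν ρ).A ω = a' ∧ (ofLaws π ν ρ).Z ω = z ∧
          (ofLaws π ν ρ).C ω = c} := by
    rintro ⟨f, ⟨c', a''⟩, g⟩ ⟨h1, h2, h3⟩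
    have e1 : f a = z := h1 a (by simp)
    have e2 : f a' = z := h1 a' (by simp)
    simp only [Set.mem_singleton_iff, Prod.mk.injEq] at h2
    obtain ⟨rfl, rfl⟩ := h2
    exact ⟨by simpa [Yout, ofLaws, e1] using h3, rfl, e2, rfl⟩
  refine lt_of_lt_of_le ?_ (measure_mono hsub)
  refine pos_iff_ne_zero.2 ?_
  have h := (Measure.prod_prod (μ := Measure.infinitePi ν) (ν := π.prod (Measure.infinitePi ρ))
    (Set.pi (({a, a'} : Finset 𝒜) : Set 𝒜) fun _ => {z}) ({((c, a') : 𝒞 × 𝒜)} ×ˢ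
      {f : 𝒞 × 𝒜 × 𝒵 → 𝒴 | f (c, a', z) = y}))
  refine ne_of_eq_of_ne h ?_
  rw [Measure.prod_prod, infinitePi_eval, Measure.infinitePi_pi ν fun i _ => measurableSet_singleton z]
  exact mul_ne_zero (Finset.prod_ne_zero_iff.2 fun i _ => hν i z) (mul_ne_zero (hπ _) (hρ _ _))

theorem ofLaws_isFrontTwoDoor (hπ : ∀ v, π {v} ≠ 0) (hν : ∀ a z, ν a {z} ≠ 0)
    (hρ : ∀ v y, ρ v {y} ≠ 0) : (ofLaws π ν ρ).IsFrontTwoDoor := by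
  have hY : ∀ z, Measurable fun w : (𝒞 × 𝒜) × (𝒞 × 𝒜 × 𝒵 → 𝒴) => w.2 (w.1.1, w.1.2, z) := fun z =>
    measurable_apply_of_countable (I := fun w : (𝒞 × 𝒜) × (𝒞 × 𝒜 × 𝒵 → 𝒴) => (w.1.1, w.1.2, z))
      (F := fun v w => w.2 v) (by fun_prop) fun v => by fun_prop
  have hA : Measurable fun w : (𝒞 × 𝒜) × (𝒞 × 𝒜 × 𝒵 → 𝒴) => w.1.2 := by fun_prop
  have hC : Measurable fun w : (𝒞 × 𝒜) × (𝒞 × 𝒜 × 𝒵 → 𝒴) => w.1.1 := by fun_prop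
  refine ⟨⟨?_, ?_, ?_⟩, ofLaws_positivity π ν ρ hπ hν hρ, ⟨?_, ?_, ?_⟩, ⟨?_, ?_, ?_⟩, ?_⟩
  · exact fun a => Eventually.of_forall fun ω h => by subst h; rfl
  · exact fun a => Eventually.of_forall fun ω h => by subst h; rfl
  · exact fun a z => Eventually.of_forall fun ω h h' => by subst h; subst h'; rfl
  · exact fun a a' z => EventuallyEq.rfl
  · exact fun a' => indepFun_prod (measurable_pi_apply a') hA
  · exact fun a a' z v => (indepFun_cond_snd (measurable_pi_apply a') (hY z)
      {w : (𝒞 × 𝒜) × (𝒞 × 𝒜 × 𝒵 → 𝒴) | w.1.2 = v}).symm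
  · exact fun a a' z => EventuallyEq.rfl
  · exact fun a' v => indepFun_cond_snd (measurable_pi_apply a') hA
      {w : (𝒞 × 𝒜) × (𝒞 × 𝒜 × 𝒵 → 𝒴) | w.1.1 = v}
  · exact fun a a' z v => (indepFun_cond_snd (measurable_pi_apply a') (hY z)
      {w : (𝒞 × 𝒜) × (𝒞 × 𝒜 × 𝒵 → 𝒴) | (w.1.2, w.1.1) = v}).symm
  · exact fun a v => indepFun_cond_snd (measurable_pi_apply a) hC
      {w : (𝒞 × 𝒜) × (𝒞 × 𝒜 × 𝒵 → 𝒴) | w.1.2 = v}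

end ofLaws

end CausalModel

/-! ### Perturbed laws -/

section perturb

variable {X : Type*} [MeasurableSpace X]

open Classical in
/-- The probability measure with the density `1 + t s` with respect to `μ`, if this is one. -/
def perturb (μ : Measure X) (s : X → ℝ) (t : ℝ) : Measure X :=
  if IsProbabilityMeasure (μ.withDensity fun x => ENNReal.ofReal (1 + t * s x)) then
    μ.withDensity fun x => ENNReal.ofReal (1 + t * s x) else μ

instance (μ : Measure X) [IsProbabilityMeasure μ] (s : X → ℝ) (t : ℝ) :
    IsProbabilityMeasure (perturb μ s t) := by
  unfold perturb
  split_ifs with h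
  · exact h
  · infer_instance

variable [MeasurableSingletonClass X] [Countable X]

theorem perturb_singleton {μ : Measure X} [IsProbabilityMeasure μ] {s : X → ℝ} {t B : ℝ}
    (hB : ∀ x, |s x| ≤ B) (ht : |t| * B ≤ 1 / 2) (h0 : ∫ x, s x ∂μ = 0) (x : X) :
    perturb μ s t {x} = ENNReal.ofReal (1 + t * s x) * μ {x} := by
  have hs : Integrable s μ := Integrable.of_bound
    (Measurable.of_discrete (f := s)).aestronglyMeasurable B (Eventually.of_forall hB)
  have hpos : ∀ x, 0 ≤ 1 + t * s x := fun x => by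
    have h1 : |t * s x| ≤ 1 / 2 := by
      rw [abs_mul]
      exact (mul_le_mul_of_nonneg_left (hB x) (abs_nonneg t)).trans ht
    linarith [neg_abs_le (t * s x)]
  have hi : Integrable (fun x => 1 + t * s x) μ := (integrable_const 1).add (hs.const_mul t)
  have hp : IsProbabilityMeasure (μ.withDensity fun x => ENNReal.ofReal (1 + t * s x)) := by
    refine ⟨?_⟩
    rw [withDensity_apply _ MeasurableSet.univ, Measure.restrict_univ,
      ← ofReal_integral_eq_lintegral_ofReal hi (Eventually.of_forall hpos),
      integral_add (integrable_const 1) (hs.const_mul t), integral_const_mul, h0]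
    simp
  rw [perturb, if_pos hp, withDensity_apply _ (measurableSet_singleton x), lintegral_singleton]

/-- While |t| B ≤ 1/2 the density lies between 1/2 and 3/2: masses stay positive and second moments
stay under control. -/
theorem perturb_real {μ : Measure X} [IsProbabilityMeasure μ] {s : X → ℝ} {t B : ℝ}
    (hB : ∀ x, |s x| ≤ B) (ht : |t| * B ≤ 1 / 2) (h0 : ∫ x, s x ∂μ = 0) (x : X) :
    (1 / 2 ≤ 1 + t * s x ∧ 1 + t * s x ≤ 3 / 2) ∧
      (perturb μ s t).real {x} = (1 + t * s x) * μ.real {x} := by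
  have h1 : |t * s x| ≤ 1 / 2 := by
    rw [abs_mul]
    exact (mul_le_mul_of_nonneg_left (hB x) (abs_nonneg t)).trans ht
  have h2 := neg_abs_le (t * s x)
  have h3 := le_abs_self (t * s x)
  refine ⟨⟨by linarith, by linarith⟩, ?_⟩
  rw [measureReal_def, perturb_singleton hB ht h0, ENNReal.toReal_mul,
    ENNReal.toReal_ofReal (by linarith)]
  rfl

theorem perturb_ne_zero {μ : Measure X} [IsProbabilityMeasure μ] {s : X → ℝ} {t B : ℝ}
    (hB : ∀ x, |s x| ≤ B) (ht : |t| * B ≤ 1 / 2) (h0 : ∫ x, s x ∂μ = 0) {x : X}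
    (hx : μ {x} ≠ 0) : perturb μ s t {x} ≠ 0 := by
  have h1 := (perturb_real hB ht h0 x).1.1
  rw [perturb_singleton hB ht h0]
  refine mul_ne_zero ?_ hx
  rw [ne_eq, ENNReal.ofReal_eq_zero]
  linarith

/-- With r = √(1 + u) the left side is (r - 1)² / 2, while u² = (r - 1)² (r + 1)² and r + 1 ≥ 1. -/
theorem abs_sqrt_one_add_sub_le {u : ℝ} (hu : -1 ≤ u) : |√(1 + u) - 1 - u / 2| ≤ u ^ 2 / 2 := by
  have h0 : 0 ≤ √(1 + u) := Real.sqrt_nonneg _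
  have h1 : √(1 + u) ^ 2 = 1 + u := Real.sq_sqrt (by linarith)
  set r := √(1 + u)
  have hu' : u = r ^ 2 - 1 := by linarith
  rw [hu', abs_le]
  constructor <;> nlinarith [sq_nonneg (r - 1), mul_nonneg h0 (sq_nonneg (r - 1)), sq_nonneg (r ^ 2 - 1),
    mul_nonneg (mul_nonneg h0 h0) (sq_nonneg (r - 1))]

/-- Put d = |t| B. The product is 1 + (linear part) + w with |w| ≤ (7/2) d², and its total increment
is at most (19/4) d. The preceding estimate then gives (19/4)² / 2 + 7/4 < 15. -/
theorem abs_sqrt_mul_mul_sub_le {t B u₁ u₂ u₃ : ℝ} (hB : 0 ≤ B) (h₁ : |u₁| ≤ B) (h₂ : |u₂| ≤ B)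
    (h₃ : |u₃| ≤ B) (ht : |t| * B ≤ 1 / 2) :
    |√((1 + t * u₁) * (1 + t * u₂) * (1 + t * u₃)) - 1 - t * (u₁ + u₂ + u₃) / 2| ≤
      15 * B ^ 2 * t ^ 2 := by
  have bnd : ∀ u, |u| ≤ B → |t * u| ≤ |t| * B := fun u hu => by
    rw [abs_mul]; exact mul_le_mul_of_nonneg_left hu (abs_nonneg t)
  have b₁ := bnd u₁ h₁
  have b₂ := bnd u₂ h₂
  have b₃ := bnd u₃ h₃
  have e : |t| ^ 2 = t ^ 2 := sq_abs t
  set d := |t| * B with hd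
  have hd0 : 0 ≤ d := by positivity
  have hd2 : B ^ 2 * t ^ 2 = d ^ 2 := by rw [hd, mul_pow, e]; ring
  have et : t * (u₁ + u₂ + u₃) = t * u₁ + t * u₂ + t * u₃ := by ring
  rw [et, mul_assoc 15 (B ^ 2), hd2]
  set x := t * u₁
  set y := t * u₂
  set z := t * u₃
  have hxy : |x * y| ≤ d ^ 2 := by rw [abs_mul, sq]; gcongr
  have hxz : |x * z| ≤ d ^ 2 := by rw [abs_mul, sq]; gcongr
  have hyz : |y * z| ≤ d ^ 2 := by rw [abs_mul, sq]; gcongr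
  have hxyz : |x * y * z| ≤ d ^ 2 * (1 / 2) := by
    rw [abs_mul]; exact mul_le_mul hxy (b₃.trans ht) (abs_nonneg _) (by positivity)
  set w := x * y + x * z + y * z + x * y * z with hw
  have hwb : |w| ≤ 7 / 2 * d ^ 2 := by
    calc |w| ≤ |x * y| + |x * z| + |y * z| + |x * y * z| :=
          (abs_add_le _ _).trans (add_le_add_left ((abs_add_le _ _).trans
            (add_le_add_left (abs_add_le _ _) _)) _)
      _ ≤ _ := by linarith
  have hprod : (1 + x) * (1 + y) * (1 + z) = 1 + (x + y + z + w) := by rw [hw]; ring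
  have hs : |x + y + z| ≤ 3 * d := by
    calc |x + y + z| ≤ |x| + |y| + |z| := (abs_add_le _ _).trans (add_le_add_left (abs_add_le _ _) _)
      _ ≤ _ := by linarith
  have hd3 : d ^ 2 ≤ d / 2 := by nlinarith
  have hu : |x + y + z + w| ≤ 19 / 4 * d := (abs_add_le _ _).trans (by linarith)
  have hge : -1 ≤ x + y + z + w := by
    have p₁ : 0 ≤ 1 + x := by linarith [neg_abs_le x]
    have p₂ : 0 ≤ 1 + y := by linarith [neg_abs_le y]
    have p₃ : 0 ≤ 1 + z := by linarith [neg_abs_le z]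
    have := mul_nonneg (mul_nonneg p₁ p₂) p₃
    linarith
  have h := abs_sqrt_one_add_sub_le hge
  have hu2 : (x + y + z + w) ^ 2 ≤ (19 / 4 * d) ^ 2 := sq_le_sq' (by linarith [neg_abs_le (x + y + z + w)])
    ((le_abs_self _).trans hu)
  rw [hprod]
  calc |√(1 + (x + y + z + w)) - 1 - (x + y + z) / 2|
      = |(√(1 + (x + y + z + w)) - 1 - (x + y + z + w) / 2) + w / 2| := by congr 1; ring
    _ ≤ |√(1 + (x + y + z + w)) - 1 - (x + y + z + w) / 2| + |w / 2| := abs_add_le _ _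
    _ ≤ (x + y + z + w) ^ 2 / 2 + |w| / 2 := by
        rw [abs_div, abs_two]; linarith
    _ ≤ 15 * d ^ 2 := by nlinarith

/-- Families whose density is a product of three affine factors are differentiable in quadratic
mean. -/
theorem diffQuadraticMean_of_mul {P : EuclideanSpace ℝ (Fin 1) → Measure X}
    [∀ h, IsProbabilityMeasure (P h)] {u₁ u₂ u₃ : X → ℝ} {B : ℝ} (hB : 0 ≤ B)
    (h₁ : ∀ x, |u₁ x| ≤ B) (h₂ : ∀ x, |u₂ x| ≤ B) (h₃ : ∀ x, |u₃ x| ≤ B)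
    (hP : ∀ h : EuclideanSpace ℝ (Fin 1), |h 0| * B ≤ 1 / 2 → ∀ x, (P h).real {x} =
      (P 0).real {x} * ((1 + h 0 * u₁ x) * (1 + h 0 * u₂ x) * (1 + h 0 * u₃ x))) :
    CausalModel.DiffQuadraticMean P
      fun x => EuclideanSpace.single 0 (u₁ x + u₂ x + u₃ x) := by
  have hnorm : ∀ h : EuclideanSpace ℝ (Fin 1), ‖h‖ ^ 2 = h 0 ^ 2 := fun h => by
    rw [EuclideanSpace.norm_sq_eq]; simp
  constructor
  · refine MemLp.of_bound (Measurable.of_discrete).aestronglyMeasurable (3 * B)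
      (Eventually.of_forall fun x => ?_)
    rw [PiLp.norm_single, Real.norm_eq_abs]
    calc |u₁ x + u₂ x + u₃ x| ≤ |u₁ x| + |u₂ x| + |u₃ x| :=
          (abs_add_le _ _).trans (add_le_add_left (abs_add_le _ _) _)
      _ ≤ 3 * B := by linarith [h₁ x, h₂ x, h₃ x]
  · have hsmall : ∀ᶠ h : EuclideanSpace ℝ (Fin 1) in 𝓝 0, |h 0| * B ≤ 1 / 2 := by
      have hc : Continuous fun h : EuclideanSpace ℝ (Fin 1) => |h 0| * B := by fun_prop
      have := hc.tendsto 0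
      simp only [PiLp.zero_apply, abs_zero, zero_mul] at this
      exact (this.eventually (eventually_lt_nhds (by norm_num : (0 : ℝ) < 1 / 2))).mono
        fun _ h => h.le
    -- At each point the remainder is the root of the mass times O(h²), uniformly; its squares sum
    -- to O(‖h‖⁴), which is o(‖h‖²).
    refine IsBigO.trans_isLittleO (g := fun h : EuclideanSpace ℝ (Fin 1) => ‖h‖ ^ 4) ?_ ?_
    · refine IsBigO.of_bound ((15 * B ^ 2) ^ 2) ?_
      filter_upwards [hsmall] with h hh
      have hterm : ∀ x, (√((P h).real {x}) - √((P 0).real {x}) -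
          ⟪h, EuclideanSpace.single 0 (u₁ x + u₂ x + u₃ x)⟫ / 2 * √((P 0).real {x})) ^ 2 ≤
          (P 0).real {x} * (15 * B ^ 2 * h 0 ^ 2) ^ 2 := fun x => by
        have hin : ⟪h, EuclideanSpace.single 0 (u₁ x + u₂ x + u₃ x)⟫ =
            h 0 * (u₁ x + u₂ x + u₃ x) := by
          rw [EuclideanSpace.inner_single_right]; simp [mul_comm]
        rw [hP h hh x, Real.sqrt_mul measureReal_nonneg, hin]
        have h1 := abs_sqrt_mul_mul_sub_le hB (h₁ x) (h₂ x) (h₃ x) hh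
        have h2 : (√((1 + h 0 * u₁ x) * (1 + h 0 * u₂ x) * (1 + h 0 * u₃ x)) - 1 -
            h 0 * (u₁ x + u₂ x + u₃ x) / 2) ^ 2 ≤ (15 * B ^ 2 * h 0 ^ 2) ^ 2 := by
          rw [← sq_abs]; gcongr
        have h3 : √((P 0).real {x}) ^ 2 = (P 0).real {x} := Real.sq_sqrt measureReal_nonneg
        calc _ = √((P 0).real {x}) ^ 2 * (√((1 + h 0 * u₁ x) * (1 + h 0 * u₂ x) * (1 + h 0 * u₃ x))
            - 1 - h 0 * (u₁ x + u₂ x + u₃ x) / 2) ^ 2 := by ring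
          _ ≤ _ := by rw [h3]; gcongr
      have hsum : Summable fun x => (P 0).real {x} * (15 * B ^ 2 * h 0 ^ 2) ^ 2 :=
        summable_mass_mul (integrable_const _)
      have hsum' := Summable.of_nonneg_of_le (fun x => sq_nonneg _) hterm hsum
      rw [Real.norm_of_nonneg (tsum_nonneg fun _ => sq_nonneg _)]
      refine (hsum'.tsum_le_tsum hterm hsum).trans ?_
      rw [← integral_eq_tsum_mass (P := P 0) (f := fun _ => (15 * B ^ 2 * h 0 ^ 2) ^ 2)
        (integrable_const _), integral_const, probReal_univ, one_smul, Real.norm_of_nonneg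
        (by positivity), show ‖h‖ ^ 4 = (‖h‖ ^ 2) ^ 2 by ring, hnorm]
      apply le_of_eq; ring
    · have : (fun h : EuclideanSpace ℝ (Fin 1) => ‖h‖ ^ 4) = fun h => ‖h‖ ^ 2 * ‖h‖ ^ 2 := by
        ext h; ring
      rw [this]
      have h1 : (fun h : EuclideanSpace ℝ (Fin 1) => ‖h‖ ^ 2) =o[𝓝 0] fun _ => (1 : ℝ) := by
        rw [isLittleO_one_iff]
        have hc : Continuous fun h : EuclideanSpace ℝ (Fin 1) => ‖h‖ ^ 2 := by fun_prop
        simpa using hc.tendsto 0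
      simpa using (isBigO_refl (fun h : EuclideanSpace ℝ (Fin 1) => ‖h‖ ^ 2) (𝓝 0)).mul_isLittleO h1

end perturb

/-! ### One-dimensional submodels with bounded scores -/

theorem memLp_two_of_mass_le {X : Type*} [MeasurableSpace X] [MeasurableSingletonClass X]
    [Countable X] {P P' : Measure X} [IsFiniteMeasure P'] {f : X → ℝ} {c : ℝ} (hf : MemLp f 2 P)
    (h : ∀ x, P'.real {x} ≤ c * P.real {x}) :
    MemLp f 2 P' ∧ ∫ x, f x ^ 2 ∂P' ≤ c * ∫ x, f x ^ 2 ∂P := by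
  have hsq : Integrable (fun x => f x ^ 2) P := hf.integrable_sq
  have hs : Summable fun x => c * (P.real {x} * f x ^ 2) := (summable_mass_mul hsq).mul_left c
  have hle : ∀ x, P'.real {x} * f x ^ 2 ≤ c * (P.real {x} * f x ^ 2) := fun x => by
    rw [← mul_assoc]; exact mul_le_mul_of_nonneg_right (h x) (sq_nonneg _)
  have hs' : Summable fun x => P'.real {x} * f x ^ 2 :=
    hs.of_nonneg_of_le (fun x => mul_nonneg measureReal_nonneg (sq_nonneg _)) hle
  have hi : Integrable (fun x => f x ^ 2) P' := integrable_of_summable_mass hs'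
  refine ⟨(memLp_two_iff_integrable_sq Measurable.of_discrete.aestronglyMeasurable).2 hi, ?_⟩
  rw [integral_eq_tsum_mass hi, integral_eq_tsum_mass hsq, ← tsum_mul_left]
  exact hs'.tsum_le_tsum hle hs

theorem IsAssembled.real_singleton_eq_mul {𝒞 𝒜 𝒵 𝒴 : Type*} [MeasurableSpace 𝒞] [MeasurableSpace 𝒜]
    [MeasurableSpace 𝒵] [MeasurableSpace 𝒴] {J J' : Measure (𝒞 × 𝒜 × 𝒵 × 𝒴)}
    {π π' : Measure (𝒞 × 𝒜)} {κ κ' : 𝒜 → Measure 𝒵} {ρ ρ' : 𝒞 × 𝒜 × 𝒵 → Measure 𝒴}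
    (h : IsAssembled J π κ ρ) (h' : IsAssembled J' π' κ' ρ') (x : 𝒞 × 𝒜 × 𝒵 × 𝒴) {r₁ r₂ r₃ : ℝ}
    (h₁ : (ρ' (projCAZ x)).real {x.2.2.2} = r₁ * (ρ (projCAZ x)).real {x.2.2.2})
    (h₂ : (κ' x.2.1).real {x.2.2.1} = r₂ * (κ x.2.1).real {x.2.2.1})
    (h₃ : π'.real {projCA x} = r₃ * π.real {projCA x}) :
    J'.real {x} = J.real {x} * (r₁ * r₂ * r₃) := by
  obtain ⟨c, a, z, y⟩ := x
  rw [measureReal_def, measureReal_def, h, h', ENNReal.toReal_mul, ENNReal.toReal_mul,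
    ENNReal.toReal_mul, ENNReal.toReal_mul]
  change π'.real {(c, a)} * (κ' a).real {z} * (ρ' (c, a, z)).real {y} =
    π.real {(c, a)} * (κ a).real {z} * (ρ (c, a, z)).real {y} * _
  change (ρ' (c, a, z)).real {y} = _ at h₁
  change (κ' a).real {z} = _ at h₂
  change π'.real {(c, a)} = _ at h₃
  rw [h₁, h₂, h₃]
  ring

namespace CausalModel

variable {𝒞 𝒜 𝒵 : Type u} {𝒴 : Set ℝ} [MeasurableSpace 𝒞] [MeasurableSpace 𝒜] [MeasurableSpace 𝒵]

/-- Bounded functions of the observed data, of `(A, Z)` and of `(C, A)`, which are centred given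
`(C, A, Z)`, given `A`, and unconditionally. -/
structure IsBoundedTriple (M : CausalModel 𝒞 𝒜 𝒵 𝒴) (s₁ : 𝒞 × 𝒜 × 𝒵 × 𝒴 → ℝ) (s₂ : 𝒜 × 𝒵 → ℝ)
    (s₃ : 𝒞 × 𝒜 → ℝ) : Prop where
  bounded : ∃ B, (∀ x, |s₁ x| ≤ B) ∧ (∀ u, |s₂ u| ≤ B) ∧ ∀ w, |s₃ w| ≤ B
  centred_fst : ∀ v : 𝒞 × 𝒜 × 𝒵, ∫ y, s₁ (v.1, v.2.1, v.2.2, y) ∂M.lawY v = 0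
  centred_snd : ∀ a, ∫ z, s₂ (a, z) ∂M.lawZ a = 0
  centred_trd : ∫ w, s₃ w ∂M.lawCA = 0

variable [MeasurableSingletonClass 𝒞] [MeasurableSingletonClass 𝒜] [MeasurableSingletonClass 𝒵]
  [Countable 𝒞] [Countable 𝒜] [Countable 𝒵]

/-- The submodel in which the factors of the law of `M` have the densities `1 + t sᵢ`. -/
def tilt (M : CausalModel 𝒞 𝒜 𝒵 𝒴) [∀ v, IsProbabilityMeasure (M.lawY v)]
    (s₁ : 𝒞 × 𝒜 × 𝒵 × 𝒴 → ℝ) (s₂ : 𝒜 × 𝒵 → ℝ) (s₃ : 𝒞 × 𝒜 → ℝ)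
    (h : EuclideanSpace ℝ (Fin 1)) : CausalModel 𝒞 𝒜 𝒵 𝒴 :=
  ofLaws (perturb M.lawCA s₃ (h 0)) (fun a => perturb (M.lawZ a) (fun z => s₂ (a, z)) (h 0))
    fun v => perturb (M.lawY v) (fun y => s₁ (v.1, v.2.1, v.2.2, y)) (h 0)

variable [Countable 𝒴] {M : CausalModel 𝒞 𝒜 𝒵 𝒴} {a₁ a₀ : 𝒜}

namespace IsFrontTwoDoor

variable (hM : M.IsFrontTwoDoor)
include hM

/-- Each factor of the law is perturbed separately and `ofLaws` realises the product as a causal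
model, so the family stays in the model. The potential law is tilted by the same functions, with
`s₂` taken at `b`. -/
theorem isRegularSubmodel_tilt [∀ v, IsProbabilityMeasure (M.lawY v)]
    (h₁ : MemLp (fun ω => (M.Yout a₁ ω : ℝ)) 2 M.μ)
    (h₀ : MemLp (fun ω => (M.Yout a₀ ω : ℝ)) 2 M.μ)
    {s₁ : 𝒞 × 𝒜 × 𝒵 × 𝒴 → ℝ} {s₂ : 𝒜 × 𝒵 → ℝ} {s₃ : 𝒞 × 𝒜 → ℝ}
    (hs : M.IsBoundedTriple s₁ s₂ s₃) :
    IsRegularSubmodel M a₁ a₀ (M.tilt s₁ s₂ s₃)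
      fun x => EuclideanSpace.single 0 (s₁ x + s₂ (projAZ x) + s₃ (projCA x)) := by
  obtain ⟨B, hB₁, hB₂, hB₃⟩ := hs.bounded
  obtain ⟨v₀⟩ : Nonempty (𝒞 × 𝒜) := by
    by_contra h
    rw [not_nonempty_iff] at h
    have := measure_univ (μ := M.lawCA)
    rw [Set.univ_eq_empty_iff.2 h, measure_empty] at this
    exact zero_ne_one this
  have hB : 0 ≤ B := (abs_nonneg _).trans (hB₃ v₀)
  have hsmall : ∀ᶠ h : EuclideanSpace ℝ (Fin 1) in 𝓝 0, |h 0| * B ≤ 1 / 2 := by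
    have hc : Continuous fun h : EuclideanSpace ℝ (Fin 1) => |h 0| * B := by fun_prop
    have := hc.tendsto 0
    simp only [PiLp.zero_apply, abs_zero, zero_mul] at this
    exact (this.eventually (eventually_lt_nhds (by norm_num : (0 : ℝ) < 1 / 2))).mono
      fun _ h => h.le
  have hY := fun (h : EuclideanSpace ℝ (Fin 1)) (hh : |h 0| * B ≤ 1 / 2) (v : 𝒞 × 𝒜 × 𝒵) =>
    perturb_real (fun y => hB₁ (v.1, v.2.1, v.2.2, y)) hh (hs.centred_fst v)
  have hZ := fun (h : EuclideanSpace ℝ (Fin 1)) (hh : |h 0| * B ≤ 1 / 2) (a : 𝒜) =>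
    perturb_real (fun z => hB₂ (a, z)) hh (hs.centred_snd a)
  have hCA := fun (h : EuclideanSpace ℝ (Fin 1)) (hh : |h 0| * B ≤ 1 / 2) =>
    perturb_real hB₃ hh hs.centred_trd
  have hobs : ∀ h : EuclideanSpace ℝ (Fin 1), |h 0| * B ≤ 1 / 2 → ∀ x,
      (M.tilt s₁ s₂ s₃ h).obsLaw.real {x} = M.obsLaw.real {x} *
        ((1 + h 0 * s₁ x) * (1 + h 0 * s₂ (projAZ x)) * (1 + h 0 * s₃ (projCA x))) :=
    fun h hh x => hM.obsLaw_isAssembled.real_singleton_eq_mul (ofLaws_obsLaw_isAssembled _ _ _) x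
      (hY h hh (projCAZ x) x.2.2.2).2 (hZ h hh x.2.1 x.2.2.1).2 (hCA h hh (projCA x)).2
  have hpot : ∀ (b : 𝒜) (h : EuclideanSpace ℝ (Fin 1)), |h 0| * B ≤ 1 / 2 → ∀ x,
      ((M.tilt s₁ s₂ s₃ h).potLaw b).real {x} = (M.potLaw b).real {x} *
        ((1 + h 0 * s₁ x) * (1 + h 0 * s₂ (b, projZ x)) * (1 + h 0 * s₃ (projCA x))) :=
    fun b h hh x => (hM.potLaw_isAssembled b).real_singleton_eq_mul
      (ofLaws_potLaw_isAssembled _ _ _ b) x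
      (hY h hh (projCAZ x) x.2.2.2).2 (hZ h hh b x.2.2.1).2 (hCA h hh (projCA x)).2
  have h0 : |(0 : EuclideanSpace ℝ (Fin 1)) 0| * B ≤ 1 / 2 := by simp
  have hobs0 : (M.tilt s₁ s₂ s₃ 0).obsLaw = M.obsLaw := by
    refine Measure.ext_of_singleton fun x => ?_
    have := hobs 0 h0 x
    simp only [PiLp.zero_apply, zero_mul, add_zero, mul_one] at this
    rwa [measureReal_def, measureReal_def, ENNReal.toReal_eq_toReal_iff' (measure_ne_top _ _)
      (measure_ne_top _ _)] at this
  have hpot0 : ∀ b x, ((M.tilt s₁ s₂ s₃ 0).potLaw b).real {x} = (M.potLaw b).real {x} := fun b x => by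
    have := hpot b 0 h0 x
    simpa only [PiLp.zero_apply, zero_mul, add_zero, mul_one] using this
  refine ⟨?_, hobs0, ?_, fun b hb => ?_, fun b hb => ?_⟩
  · filter_upwards [hsmall] with h hh
    refine ofLaws_isFrontTwoDoor _ _ _ (fun w => ?_) (fun a z => ?_) fun v y => ?_
    · exact perturb_ne_zero hB₃ hh hs.centred_trd (hM.lawCA_ne_zero w)
    · exact perturb_ne_zero (fun z => hB₂ (a, z)) hh (hs.centred_snd a) (hM.lawZ_ne_zero a z)
    · exact perturb_ne_zero (fun y => hB₁ (v.1, v.2.1, v.2.2, y)) hh (hs.centred_fst v)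
        (hM.lawY_ne_zero v y)
  · exact diffQuadraticMean_of_mul hB hB₁ (fun x => hB₂ (projAZ x)) (fun x => hB₃ (projCA x))
      fun h hh x => by rw [hobs0]; exact hobs h hh x
  · exact ⟨_, diffQuadraticMean_of_mul hB hB₁ (fun x => hB₂ (b, projZ x))
      (fun x => hB₃ (projCA x)) fun h hh x => by rw [hpot0]; exact hpot b h hh x⟩
  · have hmem : MemLp (fun ω => (M.Yout b ω : ℝ)) 2 M.μ := by
      rcases hb with rfl | rfl
      exacts [h₁, h₀]
    rw [← memLp_potLaw_outcome_iff] at hmem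
    -- The three factor densities are at most 3/2 each, and 27/8 = (3/2)³.
    refine ⟨27 / 8 * ∫ x, (x.2.2.2 : ℝ) ^ 2 ∂M.potLaw b, ?_⟩
    filter_upwards [hsmall] with h hh
    have := memLp_two_of_mass_le (P' := (M.tilt s₁ s₂ s₃ h).potLaw b) (c := 27 / 8) hmem
      fun x => by
        rw [hpot b h hh x, mul_comm]
        refine mul_le_mul_of_nonneg_right ?_ measureReal_nonneg
        have e₁ := (hY h hh (projCAZ x) x.2.2.2).1
        have e₂ := (hZ h hh b x.2.2.1).1
        have e₃ := (hCA h hh (projCA x)).1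
        calc _ ≤ (3 / 2 : ℝ) * (3 / 2) * (3 / 2) :=
              mul_le_mul (mul_le_mul e₁.2 e₂.2 (by linarith [e₂.1]) (by norm_num)) e₃.2
                (by linarith [e₃.1]) (by norm_num)
          _ = 27 / 8 := by norm_num
    rwa [memLp_potLaw_outcome_iff, integral_potLaw_outcome_sq] at this

/-- The constant family is a regular submodel of dimension zero. -/
theorem isRegularSubmodel_const
    (h₁ : MemLp (fun ω => (M.Yout a₁ ω : ℝ)) 2 M.μ)
    (h₀ : MemLp (fun ω => (M.Yout a₀ ω : ℝ)) 2 M.μ) :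
    IsRegularSubmodel M a₁ a₀ (fun _ : EuclideanSpace ℝ (Fin 0) => M) 0 := by
  have hP : ∀ P : Measure (𝒞 × 𝒜 × 𝒵 × 𝒴),
      DiffQuadraticMean (fun _ : EuclideanSpace ℝ (Fin 0) => P) 0 := fun P =>
    ⟨MemLp.zero, by simp⟩
  refine ⟨Eventually.of_forall fun _ => hM, rfl, hP _, fun b _ => ⟨0, hP _⟩, fun b hb =>
    ⟨_, Eventually.of_forall fun _ => ⟨?_, le_rfl⟩⟩⟩
  rcases hb with rfl | rfl
  exacts [h₁, h₀]

end IsFrontTwoDoor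

end CausalModel

/-! ### Density of the bounded scores -/

theorem MeasureTheory.L2.real_inner_eq_integral {X : Type*} [MeasurableSpace X] {P : Measure X}
    (f g : Lp ℝ 2 P) : ⟪f, g⟫ = ∫ x, f x * g x ∂P := by
  rw [L2.inner_def]
  exact integral_congr_ae (Eventually.of_forall fun x => mul_comm _ _)

theorem abs_indicator_one_le {X : Type*} (s : Set X) (x : X) :
    |s.indicator (fun _ => (1 : ℝ)) x| ≤ 1 := by
  by_cases h : x ∈ s <;> simp [h]

theorem integral_mul_indicator_eq_condMean {X γ : Type*} [MeasurableSpace X]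
    [MeasurableSingletonClass X] [Countable X] {P : Measure X} [IsFiniteMeasure P] {V : X → γ}
    {v : γ} (hv : P (V ⁻¹' {v}) ≠ 0) (g : X → ℝ) :
    ∫ x, g x * ({v} : Set γ).indicator (fun _ => (1 : ℝ)) (V x) ∂P =
      P.real (V ⁻¹' {v}) * condMean P V g v := by
  rw [condMean_eq_setIntegral, mul_inv_cancel_left₀ (measureReal_ne_zero_of hv),
    ← integral_indicator (MeasurableSet.of_discrete)]
  refine integral_congr_ae (Eventually.of_forall fun x => ?_)
  by_cases h : V x = v <;> simp [h]

theorem integral_indicator_singleton {X : Type*} [MeasurableSpace X] [MeasurableSingletonClass X]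
    (P : Measure X) (x : X) :
    ∫ y, ({x} : Set X).indicator (fun _ => (1 : ℝ)) y ∂P = P.real {x} := by
  rw [integral_indicator (measurableSet_singleton x)]
  simp [measureReal_def]

namespace CausalModel

variable {𝒞 𝒜 𝒵 : Type u} {𝒴 : Set ℝ} [MeasurableSpace 𝒞] [MeasurableSpace 𝒜] [MeasurableSpace 𝒵]
variable [MeasurableSingletonClass 𝒞] [MeasurableSingletonClass 𝒜] [MeasurableSingletonClass 𝒵]
  [Countable 𝒞] [Countable 𝒜] [Countable 𝒵] [Countable 𝒴]

namespace IsBoundedTriple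

variable {M : CausalModel 𝒞 𝒜 𝒵 𝒴} {s₁ t₁ : 𝒞 × 𝒜 × 𝒵 × 𝒴 → ℝ} {s₂ t₂ : 𝒜 × 𝒵 → ℝ}
  {s₃ t₃ : 𝒞 × 𝒜 → ℝ}

theorem memLp_score (hs : M.IsBoundedTriple s₁ s₂ s₃) :
    MemLp (fun x => s₁ x + s₂ (projAZ x) + s₃ (projCA x)) 2 M.obsLaw := by
  obtain ⟨B, h₁, h₂, h₃⟩ := hs.bounded
  refine MemLp.of_bound Measurable.of_discrete.aestronglyMeasurable (B + B + B)
    (Eventually.of_forall fun x => ?_)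
  rw [Real.norm_eq_abs]
  have := h₁ x
  have := h₂ (projAZ x)
  have := h₃ (projCA x)
  refine (abs_add_le _ _).trans (add_le_add ((abs_add_le _ _).trans (add_le_add ?_ ?_)) ?_) <;>
    assumption

theorem add [∀ v, IsProbabilityMeasure (M.lawY v)] (hs : M.IsBoundedTriple s₁ s₂ s₃)
    (ht : M.IsBoundedTriple t₁ t₂ t₃) : M.IsBoundedTriple (s₁ + t₁) (s₂ + t₂) (s₃ + t₃) := by
  obtain ⟨B, h₁, h₂, h₃⟩ := hs.bounded
  obtain ⟨B', h₁', h₂', h₃'⟩ := ht.bounded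
  have hi : ∀ {X : Type u} [MeasurableSpace X] [MeasurableSingletonClass X] [Countable X]
      (P : Measure X) [IsProbabilityMeasure P] (f : X → ℝ) (b : ℝ), (∀ x, |f x| ≤ b) →
      Integrable f P := fun P _ f b h => Integrable.of_bound
    Measurable.of_discrete.aestronglyMeasurable b (Eventually.of_forall h)
  have hiY : ∀ v (f : 𝒴 → ℝ) (b : ℝ), (∀ x, |f x| ≤ b) → Integrable f (M.lawY v) :=
    fun v f b h => Integrable.of_bound
      Measurable.of_discrete.aestronglyMeasurable b (Eventually.of_forall h)
  refine ⟨⟨B + B', fun x => ?_, fun x => ?_, fun x => ?_⟩, fun v => ?_, fun a => ?_, ?_⟩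
  · exact (abs_add_le _ _).trans (add_le_add (h₁ x) (h₁' x))
  · exact (abs_add_le _ _).trans (add_le_add (h₂ x) (h₂' x))
  · exact (abs_add_le _ _).trans (add_le_add (h₃ x) (h₃' x))
  · refine (integral_add (hiY _ _ B fun y => h₁ _) (hiY _ _ B' fun y => h₁' _)).trans ?_
    rw [hs.centred_fst, ht.centred_fst, add_zero]
  · refine (integral_add (hi _ _ B fun y => h₂ _) (hi _ _ B' fun y => h₂' _)).trans ?_
    rw [hs.centred_snd, ht.centred_snd, add_zero]
  · refine (integral_add (hi _ _ B fun y => h₃ _) (hi _ _ B' fun y => h₃' _)).trans ?_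
    rw [hs.centred_trd, ht.centred_trd, add_zero]

theorem smul (c : ℝ) (hs : M.IsBoundedTriple s₁ s₂ s₃) :
    M.IsBoundedTriple (c • s₁) (c • s₂) (c • s₃) := by
  obtain ⟨B, h₁, h₂, h₃⟩ := hs.bounded
  have hb : ∀ r, |r| ≤ B → |c * r| ≤ |c| * B := fun r hr => by
    rw [abs_mul]; exact mul_le_mul_of_nonneg_left hr (abs_nonneg c)
  refine ⟨⟨|c| * B, fun x => hb _ (h₁ x), fun x => hb _ (h₂ x), fun x => hb _ (h₃ x)⟩,
    fun v => ?_, fun a => ?_, ?_⟩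
  · refine (integral_const_mul c _).trans ?_
    rw [hs.centred_fst, mul_zero]
  · refine (integral_const_mul c _).trans ?_
    rw [hs.centred_snd, mul_zero]
  · refine (integral_const_mul c _).trans ?_
    rw [hs.centred_trd, mul_zero]

theorem zero (M : CausalModel 𝒞 𝒜 𝒵 𝒴) : M.IsBoundedTriple 0 0 0 :=
  ⟨⟨0, by simp, by simp, by simp⟩, by simp, by simp, by simp⟩

/-- Centred indicators of single points serve as test functions, here and in `of_snd` and `of_trd`:
orthogonality to them yields the relations between conditional means in
`IsCentredTriple.integral_mul_eq_zero`. -/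
theorem of_fst [∀ v, IsProbabilityMeasure (M.lawY v)] (x : 𝒞 × 𝒜 × 𝒵 × 𝒴) :
    M.IsBoundedTriple (fun x' => ({x} : Set _).indicator (fun _ => 1) x' -
      (M.lawY (projCAZ x)).real {x.2.2.2} *
        ({projCAZ x} : Set _).indicator (fun _ => 1) (projCAZ x')) 0 0 := by
  refine ⟨⟨1 + 1 * 1, fun x' => ?_, by simp, by simp⟩, fun v => ?_, by simp, by simp⟩
  · refine (abs_sub _ _).trans (add_le_add (abs_indicator_one_le _ _) ?_)
    rw [abs_mul]
    refine mul_le_mul ?_ (abs_indicator_one_le _ _) (abs_nonneg _) zero_le_one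
    rw [abs_of_nonneg measureReal_nonneg]
    exact measureReal_le_one
  · by_cases h : v = projCAZ x
    · subst h
      have : ∀ y : 𝒴, ({x} : Set (𝒞 × 𝒜 × 𝒵 × 𝒴)).indicator (fun _ => (1 : ℝ))
          (x.1, x.2.1, x.2.2.1, y) = ({x.2.2.2} : Set 𝒴).indicator (fun _ => 1) y := fun y => by
        obtain ⟨c, a, z, y'⟩ := x
        by_cases hy : y = y' <;> simp [hy]
      simp only [this, Set.indicator_of_mem (Set.mem_singleton _), mul_one]
      rw [integral_sub ((integrable_const 1).indicator (measurableSet_singleton _))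
        (integrable_const _), integral_indicator_singleton, integral_const]
      simp
    · have e : ∀ y : 𝒴, ({x} : Set (𝒞 × 𝒜 × 𝒵 × 𝒴)).indicator (fun _ => (1 : ℝ))
          (v.1, v.2.1, v.2.2, y) = 0 := fun y => Set.indicator_of_notMem (by
        rintro rfl; exact h rfl) _
      have e' : ({projCAZ x} : Set (𝒞 × 𝒜 × 𝒵)).indicator (fun _ => (1 : ℝ)) v = 0 :=
        Set.indicator_of_notMem (by simpa using h) _
      simp [e, e']

theorem of_snd (u : 𝒜 × 𝒵) :
    M.IsBoundedTriple 0 (fun u' => ({u} : Set _).indicator (fun _ => 1) u' -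
      (M.lawZ u.1).real {u.2} * ({u.1} : Set _).indicator (fun _ => 1) u'.1) 0 := by
  refine ⟨⟨1 + 1 * 1, by norm_num, fun u' => ?_, by norm_num⟩, by simp, fun a => ?_, by simp⟩
  · refine (abs_sub _ _).trans (add_le_add (abs_indicator_one_le _ _) ?_)
    rw [abs_mul]
    refine mul_le_mul ?_ (abs_indicator_one_le _ _) (abs_nonneg _) zero_le_one
    rw [abs_of_nonneg measureReal_nonneg]
    exact measureReal_le_one
  · by_cases h : a = u.1
    · subst h
      have : ∀ z : 𝒵, ({u} : Set (𝒜 × 𝒵)).indicator (fun _ => (1 : ℝ)) (u.1, z) =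
          ({u.2} : Set 𝒵).indicator (fun _ => 1) z := fun z => by
        obtain ⟨a, z'⟩ := u
        by_cases hz : z = z' <;> simp [hz]
      simp only [this, Set.indicator_of_mem (Set.mem_singleton _), mul_one]
      rw [integral_sub ((integrable_const 1).indicator (measurableSet_singleton _))
        (integrable_const _), integral_indicator_singleton, integral_const]
      simp
    · have e : ∀ z : 𝒵, ({u} : Set (𝒜 × 𝒵)).indicator (fun _ => (1 : ℝ)) (a, z) = 0 :=
        fun z => Set.indicator_of_notMem (by rintro rfl; exact h rfl) _
      have e' : ({u.1} : Set 𝒜).indicator (fun _ => (1 : ℝ)) a = 0 :=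
        Set.indicator_of_notMem (by simpa using h) _
      simp [e, e']

theorem of_trd (w : 𝒞 × 𝒜) :
    M.IsBoundedTriple 0 0 fun w' => ({w} : Set _).indicator (fun _ => 1) w' - M.lawCA.real {w} := by
  refine ⟨⟨1 + 1, by norm_num, by norm_num, fun w' => ?_⟩, by simp, by simp, ?_⟩
  · refine (abs_sub _ _).trans (add_le_add (abs_indicator_one_le _ _) ?_)
    rw [abs_of_nonneg measureReal_nonneg]
    exact measureReal_le_one
  · rw [integral_sub ((integrable_const 1).indicator (measurableSet_singleton _))
      (integrable_const _), integral_indicator_singleton, integral_const]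
    simp

end IsBoundedTriple

variable {M : CausalModel 𝒞 𝒜 𝒵 𝒴} {a₁ a₀ : 𝒜}

namespace IsCentredTriple

variable {s₁ : 𝒞 × 𝒜 × 𝒵 × 𝒴 → ℝ} {s₂ : 𝒜 × 𝒵 → ℝ} {s₃ : 𝒞 × 𝒜 → ℝ}

/-- A function orthogonal to the bounded scores is orthogonal to all scores. -/
theorem integral_mul_eq_zero (hM : M.IsFrontTwoDoor) (hs : M.IsCentredTriple s₁ s₂ s₃)
    {g : 𝒞 × 𝒜 × 𝒵 × 𝒴 → ℝ} (hg : MemLp g 2 M.obsLaw)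
    (h : ∀ t₁ t₂ t₃, M.IsBoundedTriple t₁ t₂ t₃ →
      ∫ x, g x * (t₁ x + t₂ (projAZ x) + t₃ (projCA x)) ∂M.obsLaw = 0) :
    ∫ x, g x * (s₁ x + s₂ (projAZ x) + s₃ (projCA x)) ∂M.obsLaw = 0 := by
  have hP := hM.isProbabilityMeasure_lawY
  have hgi : Integrable g M.obsLaw := hg.integrable one_le_two
  have hind : ∀ {γ : Type u} (V : 𝒞 × 𝒜 × 𝒵 × 𝒴 → γ) (v : γ),
      Integrable (fun x => g x * ({v} : Set γ).indicator (fun _ => (1 : ℝ)) (V x)) M.obsLaw :=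
    fun V v => hg.integrable_mul (q := 2) (MemLp.of_bound Measurable.of_discrete.aestronglyMeasurable 1
      (Eventually.of_forall fun x => abs_indicator_one_le _ _))
  -- Testing with a point shows that `g` is a function of `(C, A, Z)`; this holds everywhere because
  -- no point has mass zero.
  have e₁ : ∀ x, g x = condMean M.obsLaw projCAZ g (projCAZ x) := fun x => by
    have hx := hM.obsLaw_ne_zero x
    have hv := hM.obs_projCAZ_ne (projCAZ x)
    have h' := h _ _ _ (IsBoundedTriple.of_fst x)
    simp only [Pi.zero_apply, add_zero, mul_sub, mul_left_comm (g _)] at h'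
    rw [integral_sub (by exact hind id x) ((hind projCAZ (projCAZ x)).const_mul _),
      integral_const_mul, integral_mul_indicator_eq_condMean hv] at h'
    have hid := integral_mul_indicator_eq_condMean (P := M.obsLaw) (V := id) (v := x) hx g
    rw [show condMean M.obsLaw id g x = g x from condMean_comp_self (V := id) hx g] at hid
    have hm : M.obsLaw.real (id ⁻¹' {x}) =
        M.obsLaw.real (projCAZ ⁻¹' {projCAZ x}) * (M.lawY (projCAZ x)).real {x.2.2.2} := by
      rw [measureReal_def, measureReal_def, measureReal_def, ← ENNReal.toReal_mul,
        hM.obsLaw_isAssembled.measure_projCAZ]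
      congr 1
      exact hM.obsLaw_isAssembled x.1 x.2.1 x.2.2.1 x.2.2.2
    have hne := measureReal_ne_zero_of (P := M.obsLaw) (s := id ⁻¹' {x}) hx
    refine mul_left_cancel₀ hne ?_
    simp only [id] at h' hid
    rw [hid] at h'
    rw [sub_eq_zero.1 h', hm]
    ring
  -- Likewise the mean of `g` given `(A, Z)` depends on `A` alone, and in `e₃` the mean given `(C,
  -- A)` is constant. Each component of the score is centred given exactly the variables that are
  -- left.
  have e₂ : ∀ u : 𝒜 × 𝒵, condMean M.obsLaw projAZ g u = condMean M.obsLaw projA g u.1 := fun u => by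
    have hu := hM.obs_projAZ_ne u
    have ha := hM.obs_projA_ne u.1
    have h' := h _ _ _ (IsBoundedTriple.of_snd u)
    simp only [Pi.zero_apply, add_zero, zero_add, mul_sub, mul_left_comm (g _)] at h'
    rw [integral_sub (hind projAZ u) ((hind projA u.1).const_mul _), integral_const_mul,
      integral_mul_indicator_eq_condMean hu, integral_mul_indicator_eq_condMean ha] at h'
    have hm := hM.obs_real_projAZ u.1 u.2
    rw [← hM.obs_real_projA] at hm
    refine mul_left_cancel₀ (measureReal_ne_zero_of hu) ?_
    rw [sub_eq_zero.1 h', hm]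
    ring
  have e₃ : ∀ w : 𝒞 × 𝒜, condMean M.obsLaw projCA g w = ∫ x, g x ∂M.obsLaw := fun w => by
    have hw := hM.obs_projCA_ne w
    have h' := h _ _ _ (IsBoundedTriple.of_trd w)
    simp only [Pi.zero_apply, zero_add, mul_sub] at h'
    rw [integral_sub (hind projCA w) (hgi.mul_const _), integral_mul_const,
      integral_mul_indicator_eq_condMean hw] at h'
    refine mul_left_cancel₀ (measureReal_ne_zero_of hw) ?_
    rw [sub_eq_zero.1 h', hM.obs_real_projCA, mul_comm]
  have i₁ : Integrable (fun x => g x * s₁ x) M.obsLaw := hg.integrable_mul hs.memLp_fst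
  have i₂ : Integrable (fun x => g x * s₂ (projAZ x)) M.obsLaw := hg.integrable_mul hs.memLp_snd
  have i₃ : Integrable (fun x => g x * s₃ (projCA x)) M.obsLaw := hg.integrable_mul hs.memLp_trd
  have z₁ : ∫ x, g x * s₁ x ∂M.obsLaw = 0 := by
    have hc := hM.integral_mul_projCAZ_eq_zero hs.memLp_fst hs.centred_fst
      (memLp_condMean projCAZ hg)
    rw [← hc]
    exact integral_congr_ae (Eventually.of_forall fun x => by
      show g x * s₁ x = s₁ x * _
      rw [← e₁, mul_comm])
  have z₂ : ∫ x, g x * s₂ (projAZ x) ∂M.obsLaw = 0 := by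
    rw [integral_mul_comp projAZ i₂]
    have hc := hM.integral_mul_projCA_eq_zero (f := fun v => s₂ (v.2.1, v.2.2)) hs.memLp_snd
      (fun _ a => hs.centred_snd a) (g := fun w => condMean M.obsLaw projA g w.2)
      (memLp_condMean projA hg)
    rw [← hc]
    exact integral_congr_ae (Eventually.of_forall fun x => by
      show condMean M.obsLaw projAZ g (projAZ x) * _ = s₂ (projAZ x) * _
      rw [e₂, mul_comm])
  have z₃ : ∫ x, g x * s₃ (projCA x) ∂M.obsLaw = 0 := by
    rw [integral_mul_comp projCA i₃]
    simp only [e₃]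
    rw [integral_const_mul, hM.obsLaw_isAssembled.integral_projCA, hs.centred_trd, mul_zero]
  simp only [mul_add]
  refine (integral_add (i₁.add i₂) i₃).trans ?_
  rw [z₃, add_zero]
  refine (integral_add i₁ i₂).trans ?_
  rw [z₁, z₂, add_zero]

end IsCentredTriple

end CausalModel

/-! ### The tangent space and the efficiency bound -/

namespace CausalModel

variable {𝒞 𝒜 𝒵 : Type u} {𝒴 : Set ℝ} [MeasurableSpace 𝒞] [MeasurableSpace 𝒜] [MeasurableSpace 𝒵]
variable [MeasurableSingletonClass 𝒞] [MeasurableSingletonClass 𝒜] [MeasurableSingletonClass 𝒵]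
  [Countable 𝒞] [Countable 𝒜] [Countable 𝒵] [Countable 𝒴]

theorem IsCentredTriple.memLp_score {M : CausalModel 𝒞 𝒜 𝒵 𝒴} {s₁ : 𝒞 × 𝒜 × 𝒵 × 𝒴 → ℝ}
    {s₂ : 𝒜 × 𝒵 → ℝ} {s₃ : 𝒞 × 𝒜 → ℝ} (hs : M.IsCentredTriple s₁ s₂ s₃) :
    MemLp (fun x => s₁ x + s₂ (projAZ x) + s₃ (projCA x)) 2 M.obsLaw :=
  (hs.memLp_fst.add hs.memLp_snd).add hs.memLp_trd

/-- The space of the scores with bounded components. -/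
def boundedScores (M : CausalModel 𝒞 𝒜 𝒵 𝒴) [∀ v, IsProbabilityMeasure (M.lawY v)] :
    Submodule ℝ (Lp ℝ 2 M.obsLaw) where
  carrier := {f | ∃ s₁ s₂ s₃, M.IsBoundedTriple s₁ s₂ s₃ ∧
    f =ᵐ[M.obsLaw] fun x => s₁ x + s₂ (projAZ x) + s₃ (projCA x)}
  zero_mem' := ⟨0, 0, 0, IsBoundedTriple.zero M, (Lp.coeFn_zero ℝ 2 _).trans
    (Eventually.of_forall fun x => by simp)⟩
  add_mem' := by
    rintro f g ⟨s₁, s₂, s₃, hs, hf⟩ ⟨t₁, t₂, t₃, ht, hg⟩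
    refine ⟨_, _, _, hs.add ht, ?_⟩
    filter_upwards [Lp.coeFn_add f g, hf, hg] with x h1 h2 h3
    rw [h1, Pi.add_apply, h2, h3]
    simp only [Pi.add_apply]
    ring
  smul_mem' := by
    rintro c f ⟨s₁, s₂, s₃, hs, hf⟩
    refine ⟨_, _, _, hs.smul c, ?_⟩
    filter_upwards [Lp.coeFn_smul c f, hf] with x h1 h2
    rw [h1, Pi.smul_apply, h2]
    simp only [Pi.smul_apply, smul_eq_mul]
    ring

variable {M : CausalModel 𝒞 𝒜 𝒵 𝒴} {a₁ a₀ : 𝒜}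

/-- In a Hilbert space the closure of a subspace is its double orthogonal complement, so density
reduces to `integral_mul_eq_zero`. -/
theorem IsCentredTriple.toLp_mem_closure (hM : M.IsFrontTwoDoor)
    [∀ v, IsProbabilityMeasure (M.lawY v)] {s₁ : 𝒞 × 𝒜 × 𝒵 × 𝒴 → ℝ}
    {s₂ : 𝒜 × 𝒵 → ℝ} {s₃ : 𝒞 × 𝒜 → ℝ} (hs : M.IsCentredTriple s₁ s₂ s₃) :
    hs.memLp_score.toLp _ ∈ M.boundedScores.topologicalClosure := by
  rw [← Submodule.orthogonal_orthogonal_eq_closure, Submodule.mem_orthogonal]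
  intro g hg
  rw [L2.real_inner_eq_integral]
  have h0 : ∫ x, g x * (s₁ x + s₂ (projAZ x) + s₃ (projCA x)) ∂M.obsLaw = 0 := by
    refine hs.integral_mul_eq_zero hM (Lp.memLp g) fun t₁ t₂ t₃ ht => ?_
    have := (Submodule.mem_orthogonal' _ _).1 hg (ht.memLp_score.toLp _)
      ⟨t₁, t₂, t₃, ht, ht.memLp_score.coeFn_toLp⟩
    rw [L2.real_inner_eq_integral] at this
    rw [← this]
    refine integral_congr_ae ?_
    filter_upwards [ht.memLp_score.coeFn_toLp] with x hx
    rw [hx]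
  rw [← h0]
  refine integral_congr_ae ?_
  filter_upwards [hs.memLp_score.coeFn_toLp] with x hx
  rw [hx]

theorem boundedScores_le_tangentSpace (hM : M.IsFrontTwoDoor)
    [∀ v, IsProbabilityMeasure (M.lawY v)]
    (h₁ : MemLp (fun ω => (M.Yout a₁ ω : ℝ)) 2 M.μ)
    (h₀ : MemLp (fun ω => (M.Yout a₀ ω : ℝ)) 2 M.μ) :
    M.boundedScores.topologicalClosure ≤ tangentSpace M a₁ a₀ := by
  refine Submodule.topologicalClosure_mono ?_
  rintro f ⟨s₁, s₂, s₃, hs, hf⟩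
  refine Submodule.subset_span ⟨1, _, _, 0, hM.isRegularSubmodel_tilt h₁ h₀ hs, ?_⟩
  filter_upwards [hf] with x hx
  rw [hx]
  simp

/-- The difference of two influence functions is orthogonal to the tangent space. -/
theorem IsInfluenceFunction.integral_sub_mul_eq_zero {φ ψ : 𝒞 × 𝒜 × 𝒵 × 𝒴 → ℝ}
    (hψ : IsInfluenceFunction M a₁ a₀ ψ) (hφ : IsInfluenceFunction M a₁ a₀ φ)
    {g : Lp ℝ 2 M.obsLaw} (hg : g ∈ tangentSpace M a₁ a₀) :
    ∫ x, (ψ x - φ x) * g x ∂M.obsLaw = 0 := by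
  have hd : MemLp (fun x => ψ x - φ x) 2 M.obsLaw := hψ.1.sub hφ.1
  have hin : ∀ f : Lp ℝ 2 M.obsLaw, ⟪hd.toLp _, f⟫ = ∫ x, (ψ x - φ x) * f x ∂M.obsLaw := fun f => by
    rw [L2.real_inner_eq_integral]
    refine integral_congr_ae ?_
    filter_upwards [hd.coeFn_toLp] with x hx
    rw [hx]
  -- An orthogonal complement is a closed subspace, so it suffices to test single score components.
  have hle : tangentSpace M a₁ a₀ ≤ (Submodule.span ℝ {hd.toLp _})ᗮ := by
    refine Submodule.topologicalClosure_minimal _ (Submodule.span_le.2 ?_)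
      (Submodule.isClosed_orthogonal _)
    rintro f ⟨k, Q, S, i, hQ, hf⟩
    rw [SetLike.mem_coe, Submodule.mem_orthogonal_singleton_iff_inner_right, hin]
    have hS := hQ.memLp_score
    -- The gradient of θ along a submodel is unique, so E(ψS) = E(φS).
    have hu := (hψ.2 k Q S hQ).unique (hφ.2 k Q S hQ)
    have hi := congrArg (fun v => ⟪v, EuclideanSpace.single i (1 : ℝ)⟫) hu
    simp only [inner_integral_smul hψ.1 hS, inner_integral_smul hφ.1 hS] at hi
    have hSi := memLp_inner_const hS (EuclideanSpace.single i (1 : ℝ))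
    have hs := integral_sub (hψ.1.integrable_mul hSi) (hφ.1.integrable_mul hSi)
    simp only [Pi.mul_apply] at hs
    rw [hi, sub_self] at hs
    rw [← hs]
    refine integral_congr_ae ?_
    filter_upwards [hf] with x hx
    rw [hx]
    simp [EuclideanSpace.inner_single_right, sub_mul]
  rw [← hin]
  exact Submodule.mem_orthogonal_singleton_iff_inner_right.1 (hle hg)

/-- The Cramér–Rao bounds do not exceed the second moment of an influence function. -/
theorem IsInfluenceFunction.mem_upperBounds {φ : 𝒞 × 𝒜 × 𝒵 × 𝒴 → ℝ}
    (hφ : IsInfluenceFunction M a₁ a₀ φ) :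
    ∫ x, φ x ^ 2 ∂M.obsLaw ∈ upperBounds (cramerRaoBounds M a₁ a₀) := by
  rintro v ⟨k, Q, S, g, I, hQ, hg, hI, hdet, rfl⟩
  have hS := hQ.memLp_score
  set w : Fin k → ℝ := I⁻¹ *ᵥ fun i => g i with hw
  have hIw : I *ᵥ w = fun i => g i := by
    rw [hw, Matrix.mulVec_mulVec, Matrix.mul_nonsing_inv _ hdet, Matrix.one_mulVec]
  have hSi : ∀ i, MemLp (fun x => S x i) 2 M.obsLaw := fun i => by
    have := memLp_inner_const hS (EuclideanSpace.single i (1 : ℝ))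
    simpa [EuclideanSpace.inner_single_right] using this
  have hgi : ∀ i, g i = ∫ x, φ x * S x i ∂M.obsLaw := fun i => by
    rw [hg.unique (hφ.2 k Q S hQ)]
    have := inner_integral_smul hφ.1 hS (EuclideanSpace.single i (1 : ℝ))
    simpa [EuclideanSpace.inner_single_right] using this
  -- The projection of `φ` onto the span of the score components. Both E(φf) and E(f²) equal gᵀ I⁻¹
  -- g, so expanding E(φ - f)² ≥ 0 gives the bound.
  set f : 𝒞 × 𝒜 × 𝒵 × 𝒴 → ℝ := fun x => ∑ i, S x i * w i with hf
  have hfL : MemLp f 2 M.obsLaw := memLp_finsetSum _ fun i _ => (hSi i).mul_const (w i)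
  have hφf : ∫ x, φ x * f x ∂M.obsLaw = (fun i => g i) ⬝ᵥ w := by
    simp only [hf, Finset.mul_sum, ← mul_assoc]
    rw [integral_finsetSum _ fun i _ => by exact (hφ.1.integrable_mul (hSi i)).mul_const (w i)]
    simp only [integral_mul_const, ← hgi]
    rfl
  have hff : ∫ x, f x * f x ∂M.obsLaw = (fun i => g i) ⬝ᵥ w := by
    have e : ∀ x, f x * f x = ∑ i, w i * ∑ j, S x i * S x j * w j := fun x => by
      simp only [hf]
      rw [Finset.sum_mul_sum]
      simp only [Finset.mul_sum]
      exact Finset.sum_congr rfl fun i _ => Finset.sum_congr rfl fun j _ => by ring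
    have hij : ∀ i j, Integrable (fun x => S x i * S x j * w j) M.obsLaw := fun i j =>
      ((hSi i).integrable_mul (hSi j)).mul_const _
    simp only [e]
    rw [integral_finsetSum _ fun i _ => (integrable_finsetSum _ fun j _ => hij i j).const_mul _]
    simp only [integral_const_mul]
    rw [← hIw, dotProduct_comm]
    refine Finset.sum_congr rfl fun i _ => ?_
    rw [integral_finsetSum _ fun j _ => hij i j]
    simp only [integral_mul_const, ← hI]
    rfl
  have hpos : 0 ≤ ∫ x, (φ x - f x) ^ 2 ∂M.obsLaw := integral_nonneg fun x => sq_nonneg _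
  have hexp : ∫ x, (φ x - f x) ^ 2 ∂M.obsLaw = (∫ x, φ x ^ 2 ∂M.obsLaw)
      - 2 * (∫ x, φ x * f x ∂M.obsLaw) + ∫ x, f x * f x ∂M.obsLaw := by
    have i₁ : Integrable (fun x => φ x ^ 2) M.obsLaw := hφ.1.integrable_sq
    have i₂ : Integrable (fun x => φ x * f x) M.obsLaw := hφ.1.integrable_mul hfL
    have i₃ : Integrable (fun x => f x * f x) M.obsLaw := hfL.integrable_mul hfL
    rw [← integral_const_mul, ← integral_sub i₁ (i₂.const_mul 2),
      ← integral_add (by exact i₁.sub (i₂.const_mul 2)) i₃]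
    exact integral_congr_ae (Eventually.of_forall fun x => by ring)
  rw [hexp, hφf, hff] at hpos
  linarith

/-- The Cramér–Rao bound of a one-dimensional submodel with a bounded score. -/
theorem IsInfluenceFunction.sq_integral_le_of_mem_upperBounds (hM : M.IsFrontTwoDoor)
    [∀ v, IsProbabilityMeasure (M.lawY v)]
    (h₁ : MemLp (fun ω => (M.Yout a₁ ω : ℝ)) 2 M.μ)
    (h₀ : MemLp (fun ω => (M.Yout a₀ ω : ℝ)) 2 M.μ) {φ : 𝒞 × 𝒜 × 𝒵 × 𝒴 → ℝ}
    (hφ : IsInfluenceFunction M a₁ a₀ φ) {B : ℝ}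
    (hB : B ∈ upperBounds (cramerRaoBounds M a₁ a₀)) {s₁ : 𝒞 × 𝒜 × 𝒵 × 𝒴 → ℝ}
    {s₂ : 𝒜 × 𝒵 → ℝ} {s₃ : 𝒞 × 𝒜 → ℝ} (hs : M.IsBoundedTriple s₁ s₂ s₃) {s : 𝒞 × 𝒜 × 𝒵 × 𝒴 → ℝ}
    (hs' : ∀ x, s x = s₁ x + s₂ (projAZ x) + s₃ (projCA x)) (hne : ∫ x, s x * s x ∂M.obsLaw ≠ 0) :
    (∫ x, φ x * s x ∂M.obsLaw) ^ 2 ≤ B * ∫ x, s x * s x ∂M.obsLaw := by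
  have hQ := hM.isRegularSubmodel_tilt h₁ h₀ hs
  simp only [← hs'] at hQ
  have hS := hQ.memLp_score
  have hpos : 0 < ∫ x, s x * s x ∂M.obsLaw :=
    lt_of_le_of_ne (integral_nonneg fun x => mul_self_nonneg _) hne.symm
  have hg : (∫ x, φ x • (EuclideanSpace.single 0 (s x) : EuclideanSpace ℝ (Fin 1)) ∂M.obsLaw) 0 =
      ∫ x, φ x * s x ∂M.obsLaw := by
    have := inner_integral_smul hφ.1 hS (EuclideanSpace.single 0 (1 : ℝ))
    simpa [EuclideanSpace.inner_single_right] using this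
  have hle := hB ⟨1, _, _, _, Matrix.of fun i j => ∫ x,
    (EuclideanSpace.single 0 (s x) : EuclideanSpace ℝ (Fin 1)) i *
      (EuclideanSpace.single 0 (s x) : EuclideanSpace ℝ (Fin 1)) j ∂M.obsLaw,
    hQ, hφ.2 1 _ _ hQ, fun i j => rfl, ?_, rfl⟩
  · simp only [dotProduct, Matrix.mulVec, Finset.univ_unique, Fin.default_eq_zero, Fin.isValue,
      Finset.sum_singleton, hg] at hle
    simp at hle
    rw [← div_le_iff₀ hpos]
    calc _ = _ := by ring
      _ ≤ B := hle
  · rw [isUnit_iff_ne_zero]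
    simpa using hne

/-- The submodel of dimension zero shows that every upper bound is nonnegative, which settles the
case where the second moment of the influence function vanishes. -/
theorem zero_mem_cramerRaoBounds (hM : M.IsFrontTwoDoor)
    (h₁ : MemLp (fun ω => (M.Yout a₁ ω : ℝ)) 2 M.μ)
    (h₀ : MemLp (fun ω => (M.Yout a₀ ω : ℝ)) 2 M.μ) : 0 ∈ cramerRaoBounds M a₁ a₀ :=
  ⟨0, _, _, 0, 1, hM.isRegularSubmodel_const h₁ h₀, hasGradientAt_const _ _,
    fun i => i.elim0, by simp, by simp⟩

/-- The efficiency bound is the second moment of an influence function in the tangent space. -/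
theorem IsInfluenceFunction.isEfficiencyBound (hM : M.IsFrontTwoDoor)
    (h₁ : MemLp (fun ω => (M.Yout a₁ ω : ℝ)) 2 M.μ)
    (h₀ : MemLp (fun ω => (M.Yout a₀ ω : ℝ)) 2 M.μ) {φ : 𝒞 × 𝒜 × 𝒵 × 𝒴 → ℝ}
    (hφ : IsInfluenceFunction M a₁ a₀ φ) {s₁ : 𝒞 × 𝒜 × 𝒵 × 𝒴 → ℝ}
    {s₂ : 𝒜 × 𝒵 → ℝ} {s₃ : 𝒞 × 𝒜 → ℝ} (hs : M.IsCentredTriple s₁ s₂ s₃)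
    (hφs : ∀ x, φ x = s₁ x + s₂ (projAZ x) + s₃ (projCA x)) :
    IsEfficiencyBound M a₁ a₀ (∫ x, φ x ^ 2 ∂M.obsLaw) := by
  have hP := hM.isProbabilityMeasure_lawY
  refine ⟨hφ.mem_upperBounds, fun B hB => ?_⟩
  have hB0 : 0 ≤ B := hB (zero_mem_cramerRaoBounds hM h₁ h₀)
  set f := hs.memLp_score.toLp _
  have hf : f =ᵐ[M.obsLaw] φ :=
    hs.memLp_score.coeFn_toLp.trans (Eventually.of_forall fun x => (hφs x).symm)
  have hff : ⟪f, f⟫ = ∫ x, φ x ^ 2 ∂M.obsLaw := by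
    rw [L2.real_inner_eq_integral]
    refine integral_congr_ae ?_
    filter_upwards [hf] with x hx
    rw [hx, sq]
  have hL : ∀ u ∈ M.boundedScores, ⟪f, u⟫ ^ 2 ≤ B * ⟪u, u⟫ := by
    rintro u ⟨t₁, t₂, t₃, ht, hu⟩
    -- A vanishing score has singular information and provides no Cramér–Rao bound, but the
    -- inequality is then trivial.
    by_cases h0 : ⟪u, u⟫ = 0
    · rw [inner_self_eq_zero.1 h0]; simp
    have huu : ⟪u, u⟫ = ∫ x, (t₁ x + t₂ (projAZ x) + t₃ (projCA x)) *
        (t₁ x + t₂ (projAZ x) + t₃ (projCA x)) ∂M.obsLaw := by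
      rw [L2.real_inner_eq_integral]
      refine integral_congr_ae ?_
      filter_upwards [hu] with x hx
      rw [hx]
    have hfu : ⟪f, u⟫ = ∫ x, φ x * (t₁ x + t₂ (projAZ x) + t₃ (projCA x)) ∂M.obsLaw := by
      rw [L2.real_inner_eq_integral]
      refine integral_congr_ae ?_
      filter_upwards [hf, hu] with x hx hx'
      rw [hx, hx']
    rw [huu] at h0
    rw [hfu, huu]
    exact hφ.sq_integral_le_of_mem_upperBounds hM h₁ h₀ hB ht (fun _ => rfl) h0
  -- The inequality is a closed condition on `u`, so it extends from the bounded scores to `f`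
  -- itself; at `u = f` it reads ⟪f, f⟫² ≤ B ⟪f, f⟫.
  have hcl : IsClosed {u : Lp ℝ 2 M.obsLaw | ⟪f, u⟫ ^ 2 ≤ B * ⟪u, u⟫} :=
    isClosed_le (by fun_prop) (by fun_prop)
  have hfm : ⟪f, f⟫ ^ 2 ≤ B * ⟪f, f⟫ := closure_minimal hL hcl (hs.toLp_mem_closure hM)
  rw [hff] at hfm
  have hnn : 0 ≤ ∫ x, φ x ^ 2 ∂M.obsLaw := integral_nonneg fun x => sq_nonneg _
  rcases hnn.eq_or_lt with h | h
  · rwa [← h]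
  · rw [sq] at hfm
    exact le_of_mul_le_mul_right hfm h

/-- An influence function in the tangent space is the projection of each influence function. -/
theorem IsInfluenceFunction.isTangentProjection (hM : M.IsFrontTwoDoor)
    (h₁ : MemLp (fun ω => (M.Yout a₁ ω : ℝ)) 2 M.μ)
    (h₀ : MemLp (fun ω => (M.Yout a₀ ω : ℝ)) 2 M.μ) {φ ψ : 𝒞 × 𝒜 × 𝒵 × 𝒴 → ℝ}
    (hφ : IsInfluenceFunction M a₁ a₀ φ) (hψ : IsInfluenceFunction M a₁ a₀ ψ)
    {s₁ : 𝒞 × 𝒜 × 𝒵 × 𝒴 → ℝ} {s₂ : 𝒜 × 𝒵 → ℝ} {s₃ : 𝒞 × 𝒜 → ℝ}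
    (hs : M.IsCentredTriple s₁ s₂ s₃)
    (hφs : ∀ x, φ x = s₁ x + s₂ (projAZ x) + s₃ (projCA x)) :
    IsTangentProjection M a₁ a₀ ψ φ := by
  have hP := hM.isProbabilityMeasure_lawY
  refine ⟨hψ.1, ⟨_, boundedScores_le_tangentSpace hM h₁ h₀ (hs.toLp_mem_closure hM), ?_⟩,
    fun g hg => hψ.integral_sub_mul_eq_zero hφ hg⟩
  exact hs.memLp_score.coeFn_toLp.trans (Eventually.of_forall fun x => (hφs x).symm)

end CausalModel

end

/-! ### The main theorem, assembled -/

theorem proposition6 {𝒞 𝒜 𝒵 : Type u} [Countable 𝒞] [Countable 𝒜] [Countable 𝒵]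
    [MeasurableSpace 𝒞] [MeasurableSpace 𝒜] [MeasurableSpace 𝒵]
    [MeasurableSingletonClass 𝒞] [MeasurableSingletonClass 𝒜] [MeasurableSingletonClass 𝒵]
    {𝒴 : Set ℝ} (h𝒴 : 𝒴.Countable)
    (M : CausalModel 𝒞 𝒜 𝒵 𝒴) (hM : M.IsFrontTwoDoor)
    (a₁ a₀ : 𝒜) (hne : a₁ ≠ a₀)
    (h₁ : MemLp (fun ω => (M.Yout a₁ ω : ℝ)) 2 M.μ)
    (h₀ : MemLp (fun ω => (M.Yout a₀ ω : ℝ)) 2 M.μ)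
    (hφ : MemLp (M.phiFDTD a₁ a₀) 2 M.obsLaw) :
    (∀ c a z y, M.obsLaw.real {(c, a, z, y)} =
      M.pYgivenAZC y a z c * M.pZgivenA z a * M.pAgivenC a c * M.pC c) ∧
    CausalModel.IsEfficientInfluenceFunction M a₁ a₀ (M.phiFDTD a₁ a₀) ∧
    (MemLp (M.phiTD a₁ a₀) 2 M.obsLaw →
      CausalModel.IsInfluenceFunction M a₁ a₀ (M.phiTD a₁ a₀) ∧
      CausalModel.IsTangentProjection M a₁ a₀ (M.phiTD a₁ a₀) (M.phiFDTD a₁ a₀)) ∧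
    variance (M.phiFDTD a₁ a₀) M.obsLaw = M.boundFDTD a₁ a₀ ∧
    CausalModel.IsEfficiencyBound M a₁ a₀ (M.boundFDTD a₁ a₀) := by
  have : Countable 𝒴 := h𝒴.to_subtype
  have hI := hM.isInfluenceFunction_phiFDTD hne h₁ h₀ hφ
  have hs := hM.isCentredTriple_phi h₁ h₀ hφ
  have heq := hM.phiFDTD_eq h₁ h₀
  refine ⟨hM.obsLaw_real_eq, ⟨hI, fun ψ hψ => hI.isTangentProjection hM h₁ h₀ hψ hs heq⟩,
    fun hψ => ?_, hM.variance_phiFDTD hne h₁ h₀ hφ, ?_⟩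
  · have hT := hM.isInfluenceFunction_phiTD hne h₁ h₀ hψ
    exact ⟨hT, hI.isTangentProjection hM h₁ h₀ hT hs heq⟩
  · rw [← hM.integral_phiFDTD_sq hne h₁ h₀ hφ]
    exact hI.isEfficiencyBound hM h₁ h₀ hs heq
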